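/- Let $d\ge 1$, $s\in\mathbb{R}$, $0<q\le\infty$, and write $\langle x\rangle=(1+|x|^2)^{1/2}$, $\hat f(\xi)=\mathcal{F}f(\xi)=\int_{\mathbb{R}^d} e^{-2\pi i x\cdot\xi}f(x)\,dx$, $T_xg(y)=g(y-x)$, $M_\xi g(y)=e^{2\pi i\xi\cdot y}g(y)$. For $0<p\le\infty$, a window $g$ and $f\in\mathcal{S}'(\mathbb{R}^d)$ let $V_gf(x,\xi)=\langle f,M_\xi T_xg\rangle=\int e^{-2\pi i\xi\cdot y}f(y)\overline{g(y-x)}\,dy$ and $$\|f\|_{M^{p,q}_s}=\Big(\int_{\mathbb{R}^d}\Big(\int_{\mathbb{R}^d}|V_gf(x,\xi)|^p\,dx\Big)^{q/p}\langle\xi\rangle^{sq}\,d\xi\Big)^{1/q}$$ (with essential suprema for infinite exponents). The admissible windows are all non-zero $g\in\mathcal{S}(\mathbb{R}^d)$ if $p,q\ge1$; if $p<1$ or $q<1$ they are the $g\in\mathcal{S}(\mathbb{R}^d)$ with $\operatorname{supp}\hat g\subset\{|\xi|\le1\}$ and $\sum_{k\in\mathbb{Z}^d}\hat g(\xi-ak)\equiv1$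 for some $a>0$. The modulation space $\mathcal{M}^{p,q}_s(\mathbb{R}^d)$ is the closure of $\mathcal{S}(\mathbb{R}^d)$ in $\mathcal{S}'(\mathbb{R}^d)$ with respect to $\|\cdot\|_{M^{p,q}_s}$. For $0<r\le\infty$, $\gamma\in\mathbb{R}$, a non-zero window $\varphi\in\mathcal{S}(\mathbb{R}^d)$ and a function $\sigma$ on $\mathbb{R}^d$ let $$\|\sigma\|_{W(\mathcal{F}L^r,L^\infty_\gamma)}=\operatorname*{ess\,sup}_{x\in\mathbb{R}^d}\,\langle x\rangle^\gamma\,\|\mathcal{F}(\sigma\, T_x\varphi)\|_{L^r}.$$ The Fourier multiplier with symbol $\sigma$ is $H_\sigma f(x)=\int_{\mathbb{R}^d}e^{2\pi i x\cdot\xi}\sigma(\xi)\hat f(\xi)\,d\xi$, $f\in\mathcal{S}(\mathbb{R}^d)$. Let $$\sigma_{\alpha,\delta}(\xi)=\frac{\sin|\xi|^\alpha}{|\xi|^\delta}\quad(0<\alpha\le1,\ \delta\le\alpha),\qquad \tau(\xi)=\cos|\xi| .$$ Then, for all admissible windows $g$ and all non-zero $\varphi\in\mathcal{S}(\mathbb{R}^d)$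 (the same $g$ being used on both sides of each estimate), the Wiener amalgam norms below are finite and the following hold. (i) For every $1\le p\le\infty$ and $0<\alpha\le1$, $\delta\le\alpha$, the operator $H_{\sigma_{\alpha,\delta}}$ extends from $\mathcal{S}(\mathbb{R}^d)$ to a bounded linear operator from $\mathcal{M}^{p,q}_s(\mathbb{R}^d)$ into $\mathcal{M}^{p,q}_{s+\delta}(\mathbb{R}^d)$, with $$\|H_{\sigma_{\alpha,\delta}}f\|_{M^{p,q}_{s+\delta}}\le C\,\|\sigma_{\alpha,\delta}\|_{W(\mathcal{F}L^1,L^\infty_\delta)}\,\|f\|_{M^{p,q}_s},\qquad f\in\mathcal{M}^{p,q}_s,$$ where $C$ depends only on $d,s,p,q,\delta$ and the windows (not on $\alpha$ or $f$). (ii) For every $0<p<1$, $H_{\sigma_{1,1}}$ extends to a bounded linear operator from $\mathcal{M}^{p,q}_s(\mathbb{R}^d)$ into $\mathcal{M}^{p,q}_{s+1}(\mathbb{R}^d)$, with $$\|H_{\sigma_{1,1}}f\|_{M^{p,q}_{s+1}}\le C\,\|\sigma_{1,1}\|_{W(\mathcal{F}L^p,L^\infty_1)}\,\|f\|_{M^{p,q}_s},\qquad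 f\in\mathcal{M}^{p,q}_s,$$ where $C$ depends only on $d,s,p,q$ and the windows. (iii) For every $0<p\le\infty$, $H_\tau$ extends to a bounded linear operator from $\mathcal{M}^{p,q}_s(\mathbb{R}^d)$ into itself, with $$\|H_\tau f\|_{M^{p,q}_s}\le C\,\|\tau\|_{W(\mathcal{F}L^r,L^\infty)}\,\|f\|_{M^{p,q}_s},\qquad f\in\mathcal{M}^{p,q}_s,\quad r=\min\{1,p\},$$ where $C$ depends only on $d,s,p,q$ and the windows. -/

import Mathlib

open MeasureTheory FourierTransform
open scoped SchwartzMap ENNReal NNReal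

noncomputable section

namespace ModSpace

/-- Euclidean space `ℝ^d`. -/
abbrev Eu (d : ℕ) : Type := EuclideanSpace ℝ (Fin d)

variable {d : ℕ}

/-! ### Time-frequency shifts and the short-time Fourier transform -/

/-- The function `t ↦ exp (2 π i t)` on `ℝ` has all derivatives bounded. -/
theorem hasTemperateGrowth_fourierChar :
    Function.HasTemperateGrowth (fun t : ℝ => (Real.fourierChar t : ℂ)) := by
  have key : ∀ n : ℕ, iteratedDeriv n (fun t : ℝ => (Real.fourierChar t : ℂ)) =
      fun t : ℝ => (2 * Real.pi * Complex.I) ^ n * (Real.fourierChar t : ℂ) := by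
    intro n
    induction n with
    | zero => ext t; simp
    | succ k ih =>
      ext t
      rw [iteratedDeriv_succ, ih, ((Real.hasDerivAt_fourierChar t).const_mul _).deriv]
      ring
  refine ⟨?_, fun n => ⟨0, (2 * Real.pi) ^ n, fun t => ?_⟩⟩
  · simp only [Real.fourierChar_apply]
    exact Complex.contDiff_exp.comp ((Complex.ofRealCLM.contDiff.comp
      (contDiff_const.mul contDiff_id)).mul contDiff_const)
  · rw [norm_iteratedFDeriv_eq_norm_iteratedDeriv, key]
    simp [abs_of_pos Real.pi_pos, Circle.norm_coe]

/-- The character `y ↦ exp (-2 π i ξ·y)` has temperate growth. -/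
theorem hasTemperateGrowth_char (ξ : Eu d) :
    Function.HasTemperateGrowth (fun y : Eu d => (Real.fourierChar (-inner ℝ y ξ) : ℂ)) :=
  hasTemperateGrowth_fourierChar.comp
    (f := fun y : Eu d => -inner ℝ y ξ) (Function.hasTemperateGrowth_inner_left ξ).neg

/-- The Schwartz function `conj (M_ξ T_x g)`, that is
`y ↦ exp (-2 π i ξ·y) * conj (g (y - x))`; see `atom_apply`. -/
def atom (g : 𝓢(Eu d, ℂ)) (x ξ : Eu d) : 𝓢(Eu d, ℂ) :=
  SchwartzMap.smulLeftCLM ℂ (fun y : Eu d => (Real.fourierChar (-inner ℝ y ξ) : ℂ))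
    (SchwartzMap.postcompCLM (𝕜 := ℝ) (Complex.conjCLE : ℂ →L[ℝ] ℂ)
      (SchwartzMap.compSubConstCLM ℝ x g))

theorem atom_apply (g : 𝓢(Eu d, ℂ)) (x ξ y : Eu d) :
    atom g x ξ y = (Real.fourierChar (-inner ℝ y ξ) : ℂ) * (starRingEnd ℂ) (g (y - x)) := by
  rw [atom, SchwartzMap.smulLeftCLM_apply_apply (hasTemperateGrowth_char ξ)]
  simp

/-- The short-time Fourier transform
`V_g f (x, ξ) = ⟨f, M_ξ T_x g⟩ = ∫ exp (-2 π i ξ·y) f(y) conj (g (y - x)) dy`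
of a tempered distribution `f`. -/
def stft (g : 𝓢(Eu d, ℂ)) (f : 𝓢'(Eu d, ℂ)) (x ξ : Eu d) : ℂ :=
  f (atom g x ξ)

/-! ### Modulation spaces -/

/-- The weight `⟨x⟩^s = (1 + |x|²)^(s/2)`. -/
def weight (s : ℝ) (x : Eu d) : ℝ≥0∞ :=
  ENNReal.ofReal ((1 + ‖x‖ ^ 2) ^ (s / 2))

/-- The modulation space (quasi-)norm with window `g`: the `L^p` (quasi-)norm of `V_g f` in `x`,
followed by the `⟨ξ⟩^s`-weighted `L^q` (quasi-)norm in `ξ`; essential suprema for infinite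
exponents. -/
def modNorm (p q : ℝ≥0∞) (s : ℝ) (g : 𝓢(Eu d, ℂ)) (f : 𝓢'(Eu d, ℂ)) : ℝ≥0∞ :=
  eLpNorm (fun ξ : Eu d => weight s ξ * eLpNorm (fun x : Eu d => stft g f x ξ) p volume) q volume

/-- The admissible windows: all non-zero Schwartz functions if `p, q ≥ 1`; in the quasi-Banach case
(`p < 1` or `q < 1`) those with Fourier transform supported in the closed unit ball whose
translates along some lattice `a ℤ^d`, `a > 0`, sum up to one. -/
def IsWindow (p q : ℝ≥0∞) (g : 𝓢(Eu d, ℂ)) : Prop :=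
  g ≠ 0 ∧ (p < 1 ∨ q < 1 →
    Function.support (𝓕 (g : Eu d → ℂ)) ⊆ Metric.closedBall 0 1 ∧
    ∃ a : ℝ, 0 < a ∧ ∀ ξ : Eu d,
      HasSum (fun k : Fin d → ℤ =>
        𝓕 (g : Eu d → ℂ) (ξ - a • WithLp.toLp 2 (fun i => (k i : ℝ)))) 1)

/-- A Schwartz function as a tempered distribution, `ψ ↦ ∫ φ ψ`. -/
def ofSchwartz (φ : 𝓢(Eu d, ℂ)) : 𝓢'(Eu d, ℂ) :=
  SchwartzMap.toTemperedDistributionCLM (Eu d) ℂ volume φ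

/-- The modulation space `𝓜^{p,q}_s(ℝ^d)`: the closure, with respect to the modulation space
(quasi-)norm, of the Schwartz class in the tempered distributions. -/
def modSpace (p q : ℝ≥0∞) (s : ℝ) (g : 𝓢(Eu d, ℂ)) : Set 𝓢'(Eu d, ℂ) :=
  {f | ∀ ε : ℝ≥0∞, 0 < ε → ∃ φ : 𝓢(Eu d, ℂ), modNorm p q s g (f - ofSchwartz φ) < ε}

/-! ### Wiener amalgam norms -/

/-- The Wiener amalgam (quasi-)norm `‖σ‖_{W(𝓕L^r, L^p_γ)}` of a function `σ` with window `φ`: the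
`⟨x⟩^γ`-weighted `L^p` (quasi-)norm of `x ↦ ‖𝓕 (σ · T_x φ)‖_{L^r}`. -/
def wienerNorm (r p : ℝ≥0∞) (γ : ℝ) (φ : 𝓢(Eu d, ℂ)) (σ : Eu d → ℂ) : ℝ≥0∞ :=
  eLpNorm (fun x : Eu d =>
    weight γ x * eLpNorm (𝓕 (fun ξ : Eu d => σ ξ * φ (ξ - x))) r volume) p volume

/-! ### Fourier multipliers -/

/-- The Fourier multiplier `H_σ f(x) = ∫ exp (2 π i x·ξ) σ(ξ) (𝓕 f)(ξ) dξ` on Schwartz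
functions. -/
def multiplier (σ : Eu d → ℂ) (f : 𝓢(Eu d, ℂ)) : Eu d → ℂ :=
  𝓕⁻ (fun ξ : Eu d => σ ξ * 𝓕 (f : Eu d → ℂ) ξ)

/-- `T` is an extension of `H_σ` to a bounded linear operator from `𝓜^{p,q}_s` into
`𝓜^{p,q}_t`, of norm at most `K`. Only the values of `T` on `𝓜^{p,q}_s` matter. -/
structure IsBoundedExtension (σ : Eu d → ℂ) (p q : ℝ≥0∞) (s t : ℝ) (g : 𝓢(Eu d, ℂ))
    (K : ℝ≥0∞) (T : 𝓢'(Eu d, ℂ) → 𝓢'(Eu d, ℂ)) : Prop where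
  /-- `T` maps `𝓜^{p,q}_s` into `𝓜^{p,q}_t`. -/
  maps_to : ∀ f ∈ modSpace p q s g, T f ∈ modSpace p q t g
  map_add : ∀ f₁ ∈ modSpace p q s g, ∀ f₂ ∈ modSpace p q s g, T (f₁ + f₂) = T f₁ + T f₂
  map_smul : ∀ (c : ℂ), ∀ f ∈ modSpace p q s g, T (c • f) = c • T f
  /-- The integral defining `H_σ` converges absolutely on Schwartz functions. -/
  integrable : ∀ φ : 𝓢(Eu d, ℂ), Integrable (fun ξ : Eu d => σ ξ * 𝓕 (φ : Eu d → ℂ) ξ) volume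
  /-- On Schwartz functions `T` is `H_σ`. -/
  extends_multiplier : ∀ φ ψ : 𝓢(Eu d, ℂ),
    T (ofSchwartz φ) ψ = ∫ x : Eu d, multiplier σ φ x * ψ x
  bound : ∀ f ∈ modSpace p q s g, modNorm p q t g (T f) ≤ K * modNorm p q s g f

/-- The symbol `σ_{α,δ}(ξ) = sin(|ξ|^α) / |ξ|^δ`. -/
def sinSymbol (α δ : ℝ) (ξ : Eu d) : ℂ :=
  ((Real.sin (‖ξ‖ ^ α) / ‖ξ‖ ^ δ : ℝ) : ℂ)

/-- The symbol `τ(ξ) = cos |ξ|`. -/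
def cosSymbol (ξ : Eu d) : ℂ :=
  ((Real.cos ‖ξ‖ : ℝ) : ℂ)

end ModSpace

end

noncomputable section

namespace ModSpace

section

/-! ### Integral inequalities for functions with values in `[0, ∞]` -/

section Minkowski

variable {X Y : Type*} [MeasurableSpace X] [MeasurableSpace Y]

/-! Up to a unimodular factor, `V_g f(·, ξ)` is the profile `𝓕⁻¹(m · 𝓕 f)` with `m = T_ξ (win g)`,
where `win g` is the conjugate of `𝓕 g`. On profiles, a Fourier multiplier replaces `m` by `σ m`,
and multiplying `m` by a Schwartz function `a` is convolution with `𝓕 a` (`prof_mulBy`). So the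
theorem is about the `L^p` norm of the profile of `σ · T_ξ (win g)`.

For `p ≥ 1`, insert a continuous partition of unity `∫ T_η h dη = const`, with `h` a product of
windows. Each piece factors into a function whose `𝓕L¹` norm decays rapidly in `η - ξ`, the
localized symbol `σ T_η φ`, whose `𝓕L¹` norm is at most `⟨η⟩^{-δ}` times the amalgam norm, and a
translate of the window. Young's inequality in `x` handles each piece. For `q ≥ 1` the resulting
frequency convolution is bounded on weighted `L^q`. For `q < 1` the band limitation of the window
gives an estimate pointwise in `ξ`. The result, `exists_multiplier_bound`, has a constant
independent of `σ`. For `p < 1` Young's inequality fails, but both factors are band-limited near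
`ξ`, so a reproducing formula gives an `L^p` substitute (`exists_profNorm_mulBy_le_of_le_one`).

The symbols `cos |ξ|` and `sin |ξ| / |ξ|` are even entire functions of `|ξ|`, hence smooth, with all
derivatives bounded by the right power at infinity. Multipliers with such symbols act on all of
`𝓢'`, and the estimates apply directly.

A general `sin |ξ|^α / |ξ|^δ` is not smooth at the origin. It is a smooth symbol plus a dyadic
series of Schwartz functions `b j` supported in the unit ball and summable in `𝓕L¹`
(`exists_isLocalPerturbation_sinSymbol`): near the origin it has the form `c + E(|ξ|^α) |ξ|^β` with
`E` entire and `β > 0`, and each dyadic piece is a dilate, with factor `2^{-jβ}`, of a member of one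
compact smooth family. The low frequencies of any `f` of finite modulation norm have bounded
profiles, so the corresponding series of multipliers converges weakly. Moving the first `J` terms
into the smooth part and letting `J → ∞` removes every error term and leaves the amalgam norm of the
symbol itself, with a constant that does not see `α`. This is
`exists_isBoundedExtension_of_perturbation`. -/

theorem eLpNorm_ennreal_eq_lintegral {μ : Measure X} {p : ℝ≥0∞} (hp0 : p ≠ 0) (hp : p ≠ ∞)
    (f : X → ℝ≥0∞) : eLpNorm f p μ = (∫⁻ x, f x ^ p.toReal ∂μ) ^ (1 / p.toReal) := by
  rw [eLpNorm_eq_lintegral_rpow_enorm_toReal hp0 hp]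
  simp

/-- The essential supremum of a section is at most `a` exactly when the section of `{a < F}` is
null, and measures of sections are measurable. -/
theorem measurable_essSup_prod {μ : Measure X} [SFinite μ] {F : Y × X → ℝ≥0∞}
    (hF : Measurable F) : Measurable (fun y => essSup (fun x => F (y, x)) μ) := by
  refine measurable_of_Ioi fun a => ?_
  have h : (fun y => essSup (fun x => F (y, x)) μ) ⁻¹' Set.Ioi a =
      {y | μ (Prod.mk y ⁻¹' {z | a < F z}) = 0}ᶜ := by
    ext y
    simp only [Set.mem_preimage, Set.mem_Ioi, Set.mem_compl_iff, Set.mem_ofPred_eq]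
    rw [← not_le, not_iff_not]
    constructor
    · intro h
      have h1 : ∀ᵐ x ∂μ, F (y, x) ≤ a := (ENNReal.ae_le_essSup _).mono fun x hx => hx.trans h
      simpa [ae_iff] using h1
    · intro h
      refine essSup_le_of_ae_le a ?_
      have : ∀ᵐ x ∂μ, F (y, x) ≤ a := by simpa [ae_iff] using h
      exact this
  rw [h]
  have hm : MeasurableSet {z | a < F z} := measurableSet_lt measurable_const hF
  exact (measurable_measure_prodMk_left hm (measurableSet_singleton 0)).compl

theorem measurable_eLpNorm_prod {μ : Measure X} [SFinite μ] {p : ℝ≥0∞} {F : Y × X → ℝ≥0∞}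
    (hF : Measurable F) : Measurable (fun y => eLpNorm (fun x => F (y, x)) p μ) := by
  by_cases hp0 : p = 0
  · simp [hp0]
  by_cases hp : p = ∞
  · simp only [hp, eLpNorm_exponent_top, eLpNormEssSup, enorm_eq_self]
    exact measurable_essSup_prod hF
  · simp only [eLpNorm_ennreal_eq_lintegral hp0 hp]
    exact (Measurable.lintegral_prod_right' (hF.pow_const _)).pow_const _

/-- Jensen's inequality for the weight `k`. -/
theorem lintegral_mul_rpow_le {ν : Measure Y} {p : ℝ} (hp : 1 ≤ p) {k F : Y → ℝ≥0∞}
    (hk : Measurable k) (hF : Measurable F) :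
    (∫⁻ y, k y * F y ∂ν) ^ p ≤ (∫⁻ y, k y ∂ν) ^ (p - 1) * ∫⁻ y, k y * F y ^ p ∂ν := by
  rcases hp.eq_or_lt with rfl | hp1
  · simp
  have hp0 : 0 < p := by linarith
  set r := p / (p - 1) with hr
  have hpr : r.HolderConjugate p := (Real.HolderConjugate.conjExponent hp1).symm
  have hr0 : 0 < r := hpr.pos
  have hsplit : ∀ y, k y * F y = k y ^ (1 / r) * (k y ^ (1 / p) * F y) := by
    intro y
    rw [← mul_assoc, ← ENNReal.rpow_add_of_nonneg _ _ (by positivity) (by positivity)]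
    have : 1 / r + 1 / p = 1 := by simpa using hpr.inv_add_inv_eq_one
    rw [this, ENNReal.rpow_one]
  have h := ENNReal.lintegral_mul_le_Lp_mul_Lq ν hpr (f := fun y => k y ^ (1 / r))
    (g := fun y => k y ^ (1 / p) * F y) (hk.pow_const _).aemeasurable
    ((hk.pow_const _).mul hF).aemeasurable
  have e1 : ∀ y, (k y ^ (1 / r)) ^ r = k y := fun y => by
    rw [← ENNReal.rpow_mul, one_div_mul_cancel hr0.ne', ENNReal.rpow_one]
  have e2 : ∀ y, (k y ^ (1 / p) * F y) ^ p = k y * F y ^ p := fun y => by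
    rw [ENNReal.mul_rpow_of_nonneg _ _ hp0.le, ← ENNReal.rpow_mul, one_div_mul_cancel hp0.ne',
      ENNReal.rpow_one]
  simp only [Pi.mul_apply, ← hsplit, e1, e2] at h
  calc (∫⁻ y, k y * F y ∂ν) ^ p
      ≤ ((∫⁻ y, k y ∂ν) ^ (1 / r) * (∫⁻ y, k y * F y ^ p ∂ν) ^ (1 / p)) ^ p := by gcongr
    _ = _ := by
      rw [ENNReal.mul_rpow_of_nonneg _ _ hp0.le, ← ENNReal.rpow_mul, ← ENNReal.rpow_mul,
        one_div_mul_cancel hp0.ne', ENNReal.rpow_one]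
      congr 2
      rw [hr]
      field_simp

/-- **Minkowski's integral inequality**. -/
theorem eLpNorm_lintegral_le {μ : Measure X} {ν : Measure Y} [SFinite μ] [SFinite ν] {p : ℝ≥0∞}
    (hp : 1 ≤ p) {F : Y × X → ℝ≥0∞} (hF : Measurable F) :
    eLpNorm (fun x => ∫⁻ y, F (y, x) ∂ν) p μ ≤
      ∫⁻ y, eLpNorm (fun x => F (y, x)) p μ ∂ν := by
  have hp0 : p ≠ 0 := (zero_lt_one.trans_le hp).ne'
  set B : Y → ℝ≥0∞ := fun y => eLpNorm (fun x => F (y, x)) p μ with hB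
  have hBm : Measurable B := measurable_eLpNorm_prod hF
  by_cases hBt : ∫⁻ y, B y ∂ν = ∞
  · simp [hBt]
  by_cases hpt : p = ∞
  · subst hpt
    rw [eLpNorm_exponent_top]
    refine essSup_le_of_ae_le _ ?_
    have h1 : ∀ᵐ y ∂ν, ∀ᵐ x ∂μ, F (y, x) ≤ B y := by
      refine ae_of_all _ fun y => ?_
      have := ENNReal.ae_le_essSup (μ := μ) (fun x => F (y, x))
      simpa [hB, eLpNormEssSup] using this
    have h2 : ∀ᵐ x ∂μ, ∀ᵐ y ∂ν, F (y, x) ≤ B y :=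
      (Measure.ae_ae_comm (p := fun y x => F (y, x) ≤ B y)
        (measurableSet_le hF (hBm.comp measurable_fst))).1 h1
    filter_upwards [h2] with x hx
    simpa using lintegral_mono_ae hx
  · have hpr : 1 ≤ p.toReal := by
      rw [← ENNReal.toReal_one]
      exact ENNReal.toReal_mono hpt hp
    have hp0r : 0 < p.toReal := by linarith
    have hBpow : ∀ y, ∫⁻ x, F (y, x) ^ p.toReal ∂μ = B y ^ p.toReal := fun y => by
      simp only [hB, eLpNorm_ennreal_eq_lintegral hp0 hpt]
      rw [← ENNReal.rpow_mul, one_div_mul_cancel hp0r.ne', ENNReal.rpow_one]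
    have hBfin : ∀ᵐ y ∂ν, B y < ∞ := ae_lt_top hBm hBt
    -- Normalizing each slice by its norm `B y` allows Jensen's inequality with weight `B`; the
    -- normalized slices have `L^p` norm at most one, so only `∫ B` survives.
    have h1 : ∀ᵐ y ∂ν, ∀ᵐ x ∂μ, F (y, x) = B y * (F (y, x) / B y) := by
      filter_upwards [hBfin] with y hy
      by_cases h0 : B y = 0
      · have : ∫⁻ x, F (y, x) ^ p.toReal ∂μ = 0 := by rw [hBpow, h0, ENNReal.zero_rpow_of_pos hp0r]
        rw [lintegral_eq_zero_iff (by fun_prop)] at this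
        filter_upwards [this] with x hx
        have : F (y, x) = 0 := by
            simpa [hp0r, ENNReal.rpow_eq_zero_iff, not_lt.2 hp0r.le] using hx
        simp [this]
      · exact ae_of_all _ fun x => (ENNReal.mul_div_cancel h0 hy.ne).symm
    have hm2 : Measurable fun z : Y × X => F z / B z.1 := hF.div (hBm.comp measurable_fst)
    have h2 : ∀ᵐ x ∂μ, ∀ᵐ y ∂ν, F (y, x) = B y * (F (y, x) / B y) :=
      (Measure.ae_ae_comm (p := fun y x => F (y, x) = B y * (F (y, x) / B y))
        (measurableSet_eq_fun hF ((hBm.comp measurable_fst).mul hm2))).1 h1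
    rw [eLpNorm_ennreal_eq_lintegral hp0 hpt]
    have key : ∫⁻ x, (∫⁻ y, F (y, x) ∂ν) ^ p.toReal ∂μ ≤ (∫⁻ y, B y ∂ν) ^ p.toReal := by
      calc ∫⁻ x, (∫⁻ y, F (y, x) ∂ν) ^ p.toReal ∂μ
          ≤ ∫⁻ x, (∫⁻ y, B y ∂ν) ^ (p.toReal - 1) *
              ∫⁻ y, B y * (F (y, x) / B y) ^ p.toReal ∂ν ∂μ := by
            refine lintegral_mono_ae ?_
            filter_upwards [h2] with x hx
            rw [lintegral_congr_ae hx]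
            exact lintegral_mul_rpow_le hpr hBm (hm2.comp measurable_prodMk_right)
        _ = (∫⁻ y, B y ∂ν) ^ (p.toReal - 1) *
              ∫⁻ x, ∫⁻ y, B y * (F (y, x) / B y) ^ p.toReal ∂ν ∂μ := by
            rw [lintegral_const_mul']
            exact ENNReal.rpow_ne_top_of_nonneg (by linarith) hBt
        _ = (∫⁻ y, B y ∂ν) ^ (p.toReal - 1) *
              ∫⁻ y, ∫⁻ x, B y * (F (y, x) / B y) ^ p.toReal ∂μ ∂ν := by
            rw [lintegral_lintegral_swap]
            exact ((hBm.comp measurable_snd).mul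
              ((hm2.comp measurable_swap).pow_const _)).aemeasurable
        _ ≤ (∫⁻ y, B y ∂ν) ^ (p.toReal - 1) * ∫⁻ y, B y ∂ν := by
            refine mul_le_mul' le_rfl (lintegral_mono_ae ?_)
            filter_upwards [hBfin] with y hy
            rw [lintegral_const_mul' _ _ hy.ne]
            simp only [div_eq_mul_inv, ENNReal.mul_rpow_of_nonneg _ _ hp0r.le, ENNReal.inv_rpow]
            rw [lintegral_mul_const _ (by fun_prop), hBpow]
            calc B y * (B y ^ p.toReal * (B y ^ p.toReal)⁻¹) ≤ B y * 1 := by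
                  gcongr; exact ENNReal.mul_inv_le_one _
              _ = B y := mul_one _
        _ = (∫⁻ y, B y ∂ν) ^ p.toReal := by
            conv_lhs => rw [← ENNReal.rpow_one (∫⁻ y, B y ∂ν), ← ENNReal.rpow_mul, one_mul]
            rw [← ENNReal.rpow_add_of_nonneg _ _ (by linarith) zero_le_one]
            simp
    calc (∫⁻ x, (∫⁻ y, F (y, x) ∂ν) ^ p.toReal ∂μ) ^ (1 / p.toReal)
        ≤ ((∫⁻ y, B y ∂ν) ^ p.toReal) ^ (1 / p.toReal) := by gcongr
      _ = ∫⁻ y, B y ∂ν := by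
        rw [← ENNReal.rpow_mul, mul_one_div_cancel hp0r.ne', ENNReal.rpow_one]

theorem eLpNorm_const_mul_ennreal {μ : Measure X} {p : ℝ≥0∞} {c : ℝ≥0∞} (hc : c ≠ ∞)
    (f : X → ℝ≥0∞) : eLpNorm (fun x => c * f x) p μ = c * eLpNorm f p μ := by
  by_cases hp0 : p = 0
  · simp [hp0]
  by_cases hp : p = ∞
  · simp only [hp, eLpNorm_exponent_top, eLpNormEssSup, enorm_eq_self]
    exact ENNReal.essSup_const_mul
  · have hp0r : 0 < p.toReal := ENNReal.toReal_pos hp0 hp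
    simp only [eLpNorm_ennreal_eq_lintegral hp0 hp, ENNReal.mul_rpow_of_nonneg _ _ hp0r.le]
    rw [lintegral_const_mul' _ _ (ENNReal.rpow_ne_top_of_nonneg hp0r.le hc),
      ENNReal.mul_rpow_of_nonneg _ _ (by positivity), ← ENNReal.rpow_mul,
      mul_one_div_cancel hp0r.ne', ENNReal.rpow_one]

theorem eLpNorm_mono_ennreal {μ : Measure X} {p : ℝ≥0∞} {f g : X → ℝ≥0∞}
    (h : ∀ᵐ x ∂μ, f x ≤ g x) : eLpNorm f p μ ≤ eLpNorm g p μ :=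
  eLpNorm_mono_enorm_ae (by simpa using h)

end Minkowski

variable {d : ℕ}

theorem eLpNorm_comp_add_right {ε : Type*} [TopologicalSpace ε] [ContinuousENorm ε]
    (f : Eu d → ε) (p : ℝ≥0∞) (a : Eu d) :
    eLpNorm (fun x => f (x + a)) p volume = eLpNorm f p volume := by
  have h := (MeasurableEquiv.addRight a).measurableEmbedding
  have := h.eLpNorm_map_measure (g := f) (p := p) (μ := (volume : Measure (Eu d)))
  rw [show Measure.map (MeasurableEquiv.addRight a) (volume : Measure (Eu d)) = volume from
    (measurePreserving_add_right volume a).map_eq] at this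
  exact this.symm

/-- **Young's inequality** `L¹ * L^p ⊆ L^p`. -/
theorem eLpNorm_lintegral_mul_comp_add_le {p : ℝ≥0∞} (hp : 1 ≤ p) {k u : Eu d → ℝ≥0∞}
    (hk : Measurable k) (hu : Measurable u) :
    eLpNorm (fun x => ∫⁻ y, k y * u (x + y)) p volume ≤ (∫⁻ y, k y) * eLpNorm u p volume := by
  have hF : Measurable fun z : Eu d × Eu d => k z.1 * u (z.2 + z.1) :=
    (hk.comp measurable_fst).mul (hu.comp (measurable_snd.add measurable_fst))
  refine (eLpNorm_lintegral_le hp hF).trans ?_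
  rw [← lintegral_mul_const _ hk]
  refine lintegral_mono fun y => ?_
  -- A constant leaves the `L^p` norm only when finite. For an infinite one, either `u` vanishes
  -- almost everywhere or the right side is infinite.
  by_cases h : k y = ∞
  · by_cases h0 : eLpNorm u p volume = 0
    · have h1 : u =ᵐ[volume] 0 :=
        (eLpNorm_eq_zero_iff hu.aestronglyMeasurable (zero_lt_one.trans_le hp).ne').1 h0
      have h2 : (fun x => u (x + y)) =ᵐ[volume] 0 :=
        (measurePreserving_add_right volume y).quasiMeasurePreserving.ae_eq_comp h1
      have h3 : (fun x => k y * u (x + y)) =ᵐ[volume] 0 := by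
        filter_upwards [h2] with x hx
        rw [hx]; simp
      change eLpNorm (fun x => k y * u (x + y)) p volume ≤ _
      rw [eLpNorm_congr_ae h3]
      simp
    · rw [h, ENNReal.top_mul h0]
      exact le_top
  · change eLpNorm (fun x => k y * u (x + y)) p volume ≤ _
    rw [eLpNorm_const_mul_ennreal h, eLpNorm_comp_add_right u]

end

section

open Filter Topology LineDeriv

variable {d : ℕ}

/-! ### Translations of Schwartz functions -/

/-- Translation of a Schwartz function. -/
abbrev translate (x : Eu d) : 𝓢(Eu d, ℂ) →L[ℂ] 𝓢(Eu d, ℂ) :=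
  SchwartzMap.compSubConstCLM ℂ x

theorem iteratedFDeriv_translate (x : Eu d) (ψ : 𝓢(Eu d, ℂ)) (n : ℕ) (t : Eu d) :
    iteratedFDeriv ℝ n (translate x ψ) t = iteratedFDeriv ℝ n ψ (t - x) :=
  iteratedFDeriv_comp_sub n x t

theorem norm_pow_mul_iteratedFDeriv_sub_le (k n : ℕ) (ψ : 𝓢(Eu d, ℂ)) (t y : Eu d) :
    ‖t‖ ^ k * ‖iteratedFDeriv ℝ n ψ (t - y)‖ ≤
      (1 + ‖y‖) ^ k * (2 ^ k * (Finset.Iic (k, n)).sup (schwartzSeminormFamily ℂ (Eu d) ℂ) ψ) := by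
  have h1 := SchwartzMap.one_add_le_sup_seminorm_apply (𝕜 := ℂ) (m := (k, n)) le_rfl le_rfl ψ (t - y)
  have h2 : ‖t‖ ≤ (1 + ‖y‖) * (1 + ‖t - y‖) := by
    have : ‖t‖ ≤ ‖t - y‖ + ‖y‖ := by simpa using norm_add_le (t - y) y
    nlinarith [norm_nonneg y, norm_nonneg (t - y)]
  calc ‖t‖ ^ k * ‖iteratedFDeriv ℝ n ψ (t - y)‖
      ≤ ((1 + ‖y‖) * (1 + ‖t - y‖)) ^ k * ‖iteratedFDeriv ℝ n ψ (t - y)‖ := by gcongr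
    _ = (1 + ‖y‖) ^ k * ((1 + ‖t - y‖) ^ k * ‖iteratedFDeriv ℝ n ψ (t - y)‖) := by
        rw [mul_pow, mul_assoc]
    _ ≤ _ := mul_le_mul_of_nonneg_left h1 (by positivity)

theorem seminorm_translate_le (k n : ℕ) (x : Eu d) (ψ : 𝓢(Eu d, ℂ)) :
    SchwartzMap.seminorm ℂ k n (translate x ψ) ≤ (1 + ‖x‖) ^ k *
      (2 ^ k * (Finset.Iic (k, n)).sup (schwartzSeminormFamily ℂ (Eu d) ℂ) ψ) := by
  refine SchwartzMap.seminorm_le_bound ℂ k n _ (by positivity) fun t => ?_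
  rw [iteratedFDeriv_translate]
  exact norm_pow_mul_iteratedFDeriv_sub_le k n ψ t x

/-- Mean value inequality in the shift, at the price of one more derivative. Restricting to `‖x -
x₀‖ ≤ 1` keeps the constant dependent on `x₀` only. -/
theorem seminorm_translate_sub_le (k n : ℕ) {x x₀ : Eu d} (hx : ‖x - x₀‖ ≤ 1) (ψ : 𝓢(Eu d, ℂ)) :
    SchwartzMap.seminorm ℂ k n (translate x ψ - translate x₀ ψ) ≤
      (2 + ‖x₀‖) ^ k *
        (2 ^ k * (Finset.Iic (k, n + 1)).sup (schwartzSeminormFamily ℂ (Eu d) ℂ) ψ) * ‖x - x₀‖ := by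
  refine SchwartzMap.seminorm_le_bound ℂ k n _ (by positivity) fun t => ?_
  set C := (2 + ‖x₀‖) ^ k *
    (2 ^ k * (Finset.Iic (k, n + 1)).sup (schwartzSeminormFamily ℂ (Eu d) ℂ) ψ) with hC
  have hsub : iteratedFDeriv ℝ n (translate x ψ - translate x₀ ψ : 𝓢(Eu d, ℂ)) t =
      iteratedFDeriv ℝ n ψ (t - x) - iteratedFDeriv ℝ n ψ (t - x₀) := by
    rw [← iteratedFDeriv_translate, ← iteratedFDeriv_translate]
    exact iteratedFDeriv_sub_apply ((translate x ψ).smooth n).contDiffAt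
      ((translate x₀ ψ).smooth n).contDiffAt
  rw [hsub]
  rcases (pow_nonneg (norm_nonneg t) k).eq_or_lt with h0 | h0
  · rw [← h0, zero_mul]
    positivity
  have hd : ∀ y, HasFDerivAt (fun y => iteratedFDeriv ℝ n ψ (t - y))
      ((fderiv ℝ (iteratedFDeriv ℝ n ψ) (t - y)).comp (-ContinuousLinearMap.id ℝ (Eu d))) y := by
    intro y
    have h1 : DifferentiableAt ℝ (iteratedFDeriv ℝ n ψ) (t - y) :=
      ((ψ.smooth (n + 1)).differentiable_iteratedFDeriv (by norm_cast; omega)).differentiableAt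
    exact h1.hasFDerivAt.comp y ((hasFDerivAt_id y).const_sub t)
  have hb : ∀ y ∈ Metric.closedBall x₀ 1, ‖(fderiv ℝ (iteratedFDeriv ℝ n ψ) (t - y)).comp
        (-ContinuousLinearMap.id ℝ (Eu d))‖ ≤ C / ‖t‖ ^ k := by
    intro y hy
    have hy' : ‖y‖ ≤ ‖x₀‖ + 1 := by
      have : ‖y - x₀‖ ≤ 1 := by simpa [dist_eq_norm] using hy
      have h3 : ‖y‖ ≤ ‖y - x₀‖ + ‖x₀‖ := by simpa using norm_add_le (y - x₀) x₀
      linarith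
    rw [le_div_iff₀' h0]
    calc ‖t‖ ^ k * ‖(fderiv ℝ (iteratedFDeriv ℝ n ψ) (t - y)).comp
          (-ContinuousLinearMap.id ℝ (Eu d))‖
        ≤ ‖t‖ ^ k * ‖iteratedFDeriv ℝ (n + 1) ψ (t - y)‖ := by
          gcongr
          rw [← norm_fderiv_iteratedFDeriv]
          refine (ContinuousLinearMap.opNorm_comp_le _ _).trans ?_
          rw [norm_neg]
          exact mul_le_of_le_one_right (norm_nonneg _) ContinuousLinearMap.norm_id_le
      _ ≤ _ := norm_pow_mul_iteratedFDeriv_sub_le k (n + 1) ψ t y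
      _ ≤ C := by
          rw [hC]
          have : 1 + ‖y‖ ≤ 2 + ‖x₀‖ := by linarith
          gcongr
  have := (convex_closedBall x₀ 1).norm_image_sub_le_of_norm_hasFDerivWithin_le
    (fun y _ => (hd y).hasFDerivWithinAt) hb (Metric.mem_closedBall_self zero_le_one)
    (show x ∈ Metric.closedBall x₀ 1 by simpa [dist_eq_norm] using hx)
  rwa [div_mul_eq_mul_div, le_div_iff₀' h0] at this

theorem continuous_sup_seminorm (s : Finset (ℕ × ℕ)) :
    Continuous fun ψ : 𝓢(Eu d, ℂ) => s.sup (schwartzSeminormFamily ℂ (Eu d) ℂ) ψ := by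
  refine Seminorm.continuous_of_le (q := ∑ i ∈ s, schwartzSeminormFamily ℂ (Eu d) ℂ i) ?_
    (Seminorm.finset_sup_le_sum _ _)
  have : (⇑(∑ i ∈ s, schwartzSeminormFamily ℂ (Eu d) ℂ i) : 𝓢(Eu d, ℂ) → ℝ) =
      fun ψ => ∑ i ∈ s, schwartzSeminormFamily ℂ (Eu d) ℂ i ψ := by
    ext ψ
    simp
  rw [this]
  exact continuous_finsetSum _ fun i _ =>
    (schwartz_withSeminorms ℂ (Eu d) ℂ).continuous_seminorm i

/-- Translation is jointly continuous on the Schwartz space. -/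
theorem continuous_translate :
    Continuous fun z : Eu d × 𝓢(Eu d, ℂ) => translate z.1 z.2 := by
  rw [continuous_iff_continuousAt]
  rintro ⟨x₀, ψ₀⟩
  refine ((schwartz_withSeminorms ℂ (Eu d) ℂ).tendsto_nhds _ _).2 ?_
  rintro ⟨k, n⟩ ε hε
  set b : Eu d × 𝓢(Eu d, ℂ) → ℝ := fun z =>
    (1 + ‖z.1‖) ^ k * (2 ^ k *
      (Finset.Iic (k, n)).sup (schwartzSeminormFamily ℂ (Eu d) ℂ) (z.2 - ψ₀)) +
    (2 + ‖x₀‖) ^ k *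
        (2 ^ k * (Finset.Iic (k, n + 1)).sup (schwartzSeminormFamily ℂ (Eu d) ℂ) ψ₀) *
        ‖z.1 - x₀‖ with hb
  have hbc : Continuous b := by
    have h1 : Continuous fun z : Eu d × 𝓢(Eu d, ℂ) =>
        (Finset.Iic (k, n)).sup (schwartzSeminormFamily ℂ (Eu d) ℂ) (z.2 - ψ₀) :=
      (continuous_sup_seminorm _).comp (continuous_snd.sub continuous_const)
    have h2 : Continuous fun z : Eu d × 𝓢(Eu d, ℂ) => z.1 := continuous_fst
    fun_prop
  have hb0 : b (x₀, ψ₀) < ε := by simpa [hb] using hε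
  have hball : ∀ᶠ z : Eu d × 𝓢(Eu d, ℂ) in 𝓝 (x₀, ψ₀), ‖z.1 - x₀‖ < 1 := by
    have : Continuous fun z : Eu d × 𝓢(Eu d, ℂ) => ‖z.1 - x₀‖ := by
      have h2 : Continuous fun z : Eu d × 𝓢(Eu d, ℂ) => z.1 := continuous_fst
      fun_prop
    exact this.continuousAt.eventually_lt continuousAt_const (by simp)
  filter_upwards [hbc.continuousAt.eventually_lt continuousAt_const hb0, hball] with z hz hz1
  refine lt_of_le_of_lt ?_ hz
  have e : translate z.1 z.2 - translate x₀ ψ₀ =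
      translate z.1 (z.2 - ψ₀) + (translate z.1 ψ₀ - translate x₀ ψ₀) := by
    rw [map_sub]; abel
  rw [SchwartzMap.schwartzSeminormFamily_apply, e]
  exact (map_add_le_add _ _ _).trans (add_le_add (seminorm_translate_le k n z.1 _)
    (seminorm_translate_sub_le k n hz1.le ψ₀))

/-! ### Integrals of families of Schwartz functions -/

/-- The Schwartz function `ψ` is the integral of the family `Ψ`, which is continuous and integrable
with respect to all Schwartz seminorms. -/
structure IsIntegralOf (ψ : 𝓢(Eu d, ℂ)) (Ψ : Eu d → 𝓢(Eu d, ℂ)) : Prop where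
  continuous : Continuous Ψ
  bound : ∀ k n : ℕ, ∃ b : Eu d → ℝ, Integrable b ∧ ∀ z, SchwartzMap.seminorm ℂ k n (Ψ z) ≤ b z
  eq_integral : ∀ t, ψ t = ∫ z, Ψ z t

/-- Evaluation at a point as a functional on the Schwartz space. -/
def evalAt (u : Eu d) : 𝓢(Eu d, ℂ) →L[ℂ] ℂ :=
  (BoundedContinuousFunction.evalCLM ℂ u).comp
    (SchwartzMap.toBoundedContinuousFunctionCLM ℂ (Eu d) ℂ)

theorem exists_seminorm_bound (f : 𝓢(Eu d, ℂ) →L[ℂ] ℂ) : ∃ (s : Finset (ℕ × ℕ)) (C : ℝ), 0 ≤ C ∧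
    ∀ ψ, ‖f ψ‖ ≤ C * s.sup (schwartzSeminormFamily ℂ (Eu d) ℂ) ψ := by
  obtain ⟨s, C, -, hC⟩ := Seminorm.bound_of_continuous (schwartz_withSeminorms ℂ (Eu d) ℂ)
    ((normSeminorm ℂ ℂ).comp f.toLinearMap) (by
      have : Continuous fun ψ => ‖f ψ‖ := f.continuous.norm
      exact this)
  exact ⟨s, C, C.2, fun ψ => hC ψ⟩

theorem exists_seminorm_bound_clm (A : 𝓢(Eu d, ℂ) →L[ℂ] 𝓢(Eu d, ℂ)) (k n : ℕ) :
    ∃ (s : Finset (ℕ × ℕ)) (C : ℝ), 0 ≤ C ∧ ∀ ψ, SchwartzMap.seminorm ℂ k n (A ψ) ≤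
      C * s.sup (schwartzSeminormFamily ℂ (Eu d) ℂ) ψ := by
  obtain ⟨s, C, -, hC⟩ := Seminorm.bound_of_continuous (schwartz_withSeminorms ℂ (Eu d) ℂ)
    ((SchwartzMap.seminorm ℂ k n).comp A.toLinearMap) (by
      have : Continuous fun ψ => SchwartzMap.seminorm ℂ k n (A ψ) :=
        ((schwartz_withSeminorms ℂ (Eu d) ℂ).continuous_seminorm (k, n)).comp A.continuous
      exact this)
  exact ⟨s, C, C.2, fun ψ => hC ψ⟩

theorem sup_seminorm_le_sum (s : Finset (ℕ × ℕ)) (ψ : 𝓢(Eu d, ℂ)) :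
    s.sup (schwartzSeminormFamily ℂ (Eu d) ℂ) ψ ≤ ∑ i ∈ s, SchwartzMap.seminorm ℂ i.1 i.2 ψ := by
  have := Seminorm.finset_sup_le_sum (schwartzSeminormFamily ℂ (Eu d) ℂ) s ψ
  rw [sum_apply] at this
  exact this

theorem IsIntegralOf.sup_bound {ψ : 𝓢(Eu d, ℂ)} {Ψ : Eu d → 𝓢(Eu d, ℂ)} (h : IsIntegralOf ψ Ψ)
    (s : Finset (ℕ × ℕ)) : ∃ b : Eu d → ℝ, Integrable b ∧
      ∀ z, s.sup (schwartzSeminormFamily ℂ (Eu d) ℂ) (Ψ z) ≤ b z := by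
  choose b hbi hb using h.bound
  exact ⟨fun z => ∑ i ∈ s, b i.1 i.2 z, integrable_finsetSum _ fun i _ => hbi _ _, fun z =>
    (sup_seminorm_le_sum s _).trans (Finset.sum_le_sum fun i _ => hb _ _ z)⟩

theorem IsIntegralOf.integrable {ψ : 𝓢(Eu d, ℂ)} {Ψ : Eu d → 𝓢(Eu d, ℂ)} (h : IsIntegralOf ψ Ψ)
    (f : 𝓢(Eu d, ℂ) →L[ℂ] ℂ) : Integrable fun z => f (Ψ z) := by
  obtain ⟨s, C, hC, hf⟩ := exists_seminorm_bound f
  obtain ⟨b, hbi, hb⟩ := h.sup_bound s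
  exact (hbi.const_mul C).mono' (f.continuous.comp h.continuous).aestronglyMeasurable
    (ae_of_all _ fun z => (hf _).trans (mul_le_mul_of_nonneg_left (hb z) hC))

/-- Differentiation under the integral sign: the sup norms of the derivatives are dominated because
differentiation is continuous on the Schwartz space. -/
theorem IsIntegralOf.lineDeriv {ψ : 𝓢(Eu d, ℂ)} {Ψ : Eu d → 𝓢(Eu d, ℂ)} (h : IsIntegralOf ψ Ψ)
    (m : Eu d) : IsIntegralOf (∂_{m} ψ) (fun z => ∂_{m} (Ψ z)) := by
  set A : 𝓢(Eu d, ℂ) →L[ℂ] 𝓢(Eu d, ℂ) := lineDerivOpCLM ℂ 𝓢(Eu d, ℂ) m with hA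
  have hAe : ∀ φ, A φ = ∂_{m} φ := fun φ => rfl
  have hbound : ∀ k n : ℕ, ∃ b : Eu d → ℝ, Integrable b ∧
      ∀ z, SchwartzMap.seminorm ℂ k n (∂_{m} (Ψ z)) ≤ b z := by
    intro k n
    obtain ⟨s, C, hC, hs⟩ := exists_seminorm_bound_clm A k n
    obtain ⟨b, hbi, hb⟩ := h.sup_bound s
    exact ⟨fun z => C * b z, hbi.const_mul C, fun z => (hs _).trans
      (mul_le_mul_of_nonneg_left (hb z) hC)⟩
  refine ⟨A.continuous.comp h.continuous, hbound, fun t => ?_⟩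
  obtain ⟨b, hbi, hb⟩ := hbound 0 0
  have hline : ∀ (φ : 𝓢(Eu d, ℂ)) (s : ℝ),
      HasDerivAt (fun s : ℝ => φ (t + s • m)) ((∂_{m} φ : 𝓢(Eu d, ℂ)) (t + s • m)) s := by
    intro φ s
    have h1 : HasDerivAt (fun s : ℝ => t + s • m) m s := by
      simpa using ((hasDerivAt_id s).smul_const m).const_add t
    rw [SchwartzMap.lineDerivOp_apply_eq_fderiv]
    exact (φ.hasFDerivAt (t + s • m)).comp_hasDerivAt s h1
  have hcont : ∀ u : Eu d, Continuous fun φ : 𝓢(Eu d, ℂ) => φ u := fun u =>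
    (evalAt u).continuous
  have key := hasDerivAt_integral_of_dominated_loc_of_deriv_le (μ := (volume : Measure (Eu d)))
    (F := fun (s : ℝ) z => Ψ z (t + s • m)) (F' := fun s z => (∂_{m} (Ψ z) : 𝓢(Eu d, ℂ)) (t + s • m))
    (x₀ := (0 : ℝ)) (s := Set.univ) (bound := b) Filter.univ_mem
    (Eventually.of_forall fun s => ((hcont _).comp h.continuous).aestronglyMeasurable)
    (h.integrable (evalAt (t + (0 : ℝ) • m)))
    ((hcont _).comp (A.continuous.comp h.continuous)).aestronglyMeasurable
    (ae_of_all _ fun z s _ => (SchwartzMap.norm_le_seminorm ℂ _ _).trans (hb z)) hbi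
    (ae_of_all _ fun z s _ => hline _ s)
  have h2 := hline ψ 0
  simp only [h.eq_integral] at h2
  simpa using h2.unique key.2

theorem IsIntegralOf.iteratedLineDeriv {ψ : 𝓢(Eu d, ℂ)} {Ψ : Eu d → 𝓢(Eu d, ℂ)}
    (h : IsIntegralOf ψ Ψ) {n : ℕ} (m : Fin n → Eu d) :
    IsIntegralOf (∂^{m} ψ) (fun z => ∂^{m} (Ψ z)) := by
  induction n with
  | zero => simpa using h
  | succ n ih =>
    simp only [iteratedLineDerivOp_succ_left]
    exact (ih (Fin.tail m)).lineDeriv (m 0)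

theorem IsIntegralOf.iteratedFDeriv_eq {ψ : 𝓢(Eu d, ℂ)} {Ψ : Eu d → 𝓢(Eu d, ℂ)}
    (h : IsIntegralOf ψ Ψ) (n : ℕ) (t : Eu d) (m : Fin n → Eu d) :
    iteratedFDeriv ℝ n ψ t m = ∫ z, iteratedFDeriv ℝ n (Ψ z) t m := by
  simp only [← SchwartzMap.iteratedLineDerivOp_eq_iteratedFDeriv]
  exact (h.iteratedLineDeriv m).eq_integral t

/-- Bounded continuous functions with values in the `n`-linear forms. -/
def BddForm (d n : ℕ) : Type := BoundedContinuousFunction (Eu d) ((Eu d) [×n]→L[ℝ] ℂ)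

instance (n : ℕ) : NormedAddCommGroup (BddForm d n) :=
  inferInstanceAs (NormedAddCommGroup (BoundedContinuousFunction (Eu d) ((Eu d) [×n]→L[ℝ] ℂ)))

instance (n : ℕ) : NormedSpace ℂ (BddForm d n) :=
  inferInstanceAs (NormedSpace ℂ (BoundedContinuousFunction (Eu d) ((Eu d) [×n]→L[ℝ] ℂ)))

instance (n : ℕ) : CompleteSpace (BddForm d n) :=
  inferInstanceAs (CompleteSpace (BoundedContinuousFunction (Eu d) ((Eu d) [×n]→L[ℝ] ℂ)))

/-- Evaluation of an element of `BddForm` at a point and at a tuple of vectors. -/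
def BddForm.eval (n : ℕ) (t : Eu d) (m : Fin n → Eu d) : BddForm d n →L[ℝ] ℂ :=
  (ContinuousMultilinearMap.apply ℝ (fun _ : Fin n => Eu d) ℂ m).comp
    (BoundedContinuousFunction.evalCLM ℝ t)

theorem BddForm.ext_eval {n : ℕ} {u v : BddForm d n} (h : ∀ t m, BddForm.eval n t m u =
    BddForm.eval n t m v) : u = v := by
  refine BoundedContinuousFunction.ext fun t => ContinuousMultilinearMap.ext fun m => h t m

/-- The map `ψ ↦ ‖·‖ ^ k • D ^ n ψ` into the bounded continuous functions. -/
def weightedDeriv (k n : ℕ) :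
    𝓢(Eu d, ℂ) →L[ℂ] BddForm d n :=
  SchwartzMap.mkCLMtoNormedSpace (σ := RingHom.id ℂ)
    (fun ψ => BoundedContinuousFunction.ofNormedAddCommGroup
      (fun t => ((‖t‖ ^ k : ℝ) : ℂ) • iteratedFDeriv ℝ n ψ t)
      ((Complex.continuous_ofReal.comp (continuous_norm.pow k)).smul
        ((ψ.smooth n).continuous_iteratedFDeriv le_rfl)) (SchwartzMap.seminorm ℂ k n ψ)
      (fun t => by
        rw [norm_smul]
        simpa using SchwartzMap.le_seminorm ℂ k n ψ t))
    (fun ψ φ => by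
      refine BoundedContinuousFunction.ext fun t => ?_
      have : iteratedFDeriv ℝ n (ψ + φ : 𝓢(Eu d, ℂ)) t =
          iteratedFDeriv ℝ n ψ t + iteratedFDeriv ℝ n φ t :=
        iteratedFDeriv_add_apply (ψ.smooth n).contDiffAt (φ.smooth n).contDiffAt
      change ((‖t‖ ^ k : ℝ) : ℂ) • iteratedFDeriv ℝ n (ψ + φ : 𝓢(Eu d, ℂ)) t = _
      rw [this, smul_add]
      rfl)
    (fun c ψ => by
      refine BoundedContinuousFunction.ext fun t => ?_
      have : iteratedFDeriv ℝ n (c • ψ : 𝓢(Eu d, ℂ)) t = c • iteratedFDeriv ℝ n ψ t :=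
        iteratedFDeriv_const_smul_apply (ψ.smooth n).contDiffAt
      change ((‖t‖ ^ k : ℝ) : ℂ) • iteratedFDeriv ℝ n (c • ψ : 𝓢(Eu d, ℂ)) t = _
      rw [this]
      exact smul_comm _ c _)
    ⟨{(k, n)}, 1, zero_le_one, fun ψ => by
      rw [one_mul, Finset.sup_singleton]
      exact BoundedContinuousFunction.norm_ofNormedAddCommGroup_le _ (by positivity) _⟩

theorem eval_weightedDeriv (k n : ℕ) (ψ : 𝓢(Eu d, ℂ)) (t : Eu d) (m : Fin n → Eu d) :
    BddForm.eval n t m (weightedDeriv k n ψ) = (‖t‖ ^ k : ℝ) • iteratedFDeriv ℝ n ψ t m := rfl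

theorem norm_weightedDeriv_le (k n : ℕ) (ψ : 𝓢(Eu d, ℂ)) :
    ‖weightedDeriv k n ψ‖ ≤ SchwartzMap.seminorm ℂ k n ψ :=
  BoundedContinuousFunction.norm_ofNormedAddCommGroup_le _ (by positivity) (fun t => by
    rw [norm_smul]
    simpa using SchwartzMap.le_seminorm ℂ k n ψ t)

theorem seminorm_le_norm_weightedDeriv (k n : ℕ) (ψ : 𝓢(Eu d, ℂ)) :
    SchwartzMap.seminorm ℂ k n ψ ≤ ‖weightedDeriv k n ψ‖ := by
  refine SchwartzMap.seminorm_le_bound ℂ k n _ (norm_nonneg (weightedDeriv k n ψ)) fun t => ?_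
  have h : ‖((‖t‖ ^ k : ℝ) : ℂ) • iteratedFDeriv ℝ n ψ t‖ ≤ ‖weightedDeriv k n ψ‖ :=
    BoundedContinuousFunction.norm_coe_le_norm
      (show BoundedContinuousFunction (Eu d) ((Eu d) [×n]→L[ℝ] ℂ) from weightedDeriv k n ψ) t
  rw [norm_smul] at h
  simpa using h

/-- Continuous functionals commute with integrals of families of Schwartz functions. -/
theorem IsIntegralOf.apply_eq {ψ : 𝓢(Eu d, ℂ)} {Ψ : Eu d → 𝓢(Eu d, ℂ)} (h : IsIntegralOf ψ Ψ)
    (f : 𝓢(Eu d, ℂ) →L[ℂ] ℂ) : f ψ = ∫ z, f (Ψ z) := by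
  obtain ⟨s, C, hC, hf⟩ := exists_seminorm_bound f
  -- The functional is controlled by finitely many seminorms, so it factors through a finite product
  -- of Banach spaces, where Bochner integrals commute with functionals. The index `(0, 0)` is added
  -- to make the map `J` injective.
  set S : Finset (ℕ × ℕ) := insert (0, 0) s with hS
  set J : 𝓢(Eu d, ℂ) →L[ℂ]
      ((i : S) → BddForm d i.1.2) :=
    ContinuousLinearMap.pi fun i => weightedDeriv i.1.1 i.1.2 with hJ
  have hJa : ∀ φ i, J φ i = weightedDeriv i.1.1 i.1.2 φ := fun φ i => rfl
  have hinj : Function.Injective J.toLinearMap := by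
    refine (injective_iff_map_eq_zero _).2 fun φ hφ => ?_
    ext t
    have h0 : J φ ⟨(0, 0), by simp [hS]⟩ = 0 := by
      have : J φ = 0 := hφ
      rw [this]; rfl
    rw [hJa] at h0
    have h1 := eval_weightedDeriv 0 0 φ t 0
    rw [h0] at h1
    simpa using h1.symm
  have hfJ : ∀ φ, ‖f φ‖ ≤ C * ‖J φ‖ := by
    intro φ
    refine (hf φ).trans (mul_le_mul_of_nonneg_left ?_ hC)
    refine Seminorm.finset_sup_apply_le (norm_nonneg _) fun i hi => ?_
    exact (seminorm_le_norm_weightedDeriv i.1 i.2 φ).trans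
      (norm_le_pi_norm (J φ) ⟨i, by simp [hS, hi]⟩)
  set e := LinearEquiv.ofInjective J.toLinearMap hinj with he
  set f' : StrongDual ℂ (LinearMap.range J.toLinearMap) :=
    (f.toLinearMap.comp e.symm.toLinearMap).mkContinuous C (fun y => by
      obtain ⟨φ, rfl⟩ := e.surjective y
      have : e.symm (e φ) = φ := e.symm_apply_apply φ
      change ‖f (e.symm (e φ))‖ ≤ C * ‖J φ‖
      rw [this]
      exact hfJ φ) with hf'
  -- Hahn–Banach: the Bochner integral of `J ∘ Ψ` is formed in the whole product, so the functional
  -- must be defined there and not only on the range of `J`.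
  obtain ⟨g, hg, -⟩ := exists_extension_norm_eq _ f'
  have hgJ : ∀ φ, g (J φ) = f φ := by
    intro φ
    have h1 := hg (e φ)
    have h2 : f' (e φ) = f φ := by
      change f (e.symm (e φ)) = f φ
      rw [e.symm_apply_apply]
    rw [← h2, ← h1]; rfl
  have hint : Integrable fun z => J (Ψ z) := by
    obtain ⟨b, hbi, hb⟩ := h.sup_bound S
    refine hbi.mono' (J.continuous.comp h.continuous).aestronglyMeasurable
      (ae_of_all _ fun z => le_trans ?_ (hb z))
    refine (pi_norm_le_iff_of_nonneg (by positivity)).2 fun i => ?_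
    rw [hJa]
    refine (norm_weightedDeriv_le _ _ _).trans ?_
    exact Seminorm.le_finset_sup_apply (p := schwartzSeminormFamily ℂ (Eu d) ℂ) i.2
  have hJψ : J ψ = ∫ z, J (Ψ z) := by
    funext i
    have h1 : (∫ z, J (Ψ z)) i = ∫ z, J (Ψ z) i :=
      ((ContinuousLinearMap.proj (R := ℂ) i).integral_comp_comm hint).symm
    have hi1 : Integrable fun z => J (Ψ z) i :=
      (ContinuousLinearMap.proj (R := ℂ) i).integrable_comp hint
    refine BddForm.ext_eval fun t m => ?_
    rw [h1, ← (BddForm.eval _ t m).integral_comp_comm hi1]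
    simp only [hJa, eval_weightedDeriv]
    rw [integral_smul, h.iteratedFDeriv_eq]
  rw [← hgJ, hJψ, ← g.integral_comp_comm hint]
  simp only [hgJ]

end

section

open Filter Topology

variable {d : ℕ}

/-! ### Weights -/

/-- For negative `r`, apply the triangle inequality to `x = (t + x) - t` with exponent `-r` and
invert. -/
theorem one_add_norm_rpow_add_le (r : ℝ) (x t : Eu d) :
    (1 + ‖t + x‖) ^ r ≤ (1 + ‖x‖) ^ r * (1 + ‖t‖) ^ |r| := by
  have ht := norm_nonneg t
  have hx := norm_nonneg x
  have htx := norm_nonneg (t + x)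
  rcases le_total 0 r with hr | hr
  · rw [abs_of_nonneg hr, ← Real.mul_rpow (by positivity) (by positivity)]
    refine Real.rpow_le_rpow (by positivity) ?_ hr
    nlinarith [norm_add_le t x]
  · rw [abs_of_nonpos hr]
    have h1 : (1 + ‖x‖) ^ (-r) ≤ (1 + ‖t + x‖) ^ (-r) * (1 + ‖t‖) ^ (-r) := by
      rw [← Real.mul_rpow (by positivity) (by positivity)]
      refine Real.rpow_le_rpow (by positivity) ?_ (by linarith)
      have : ‖x‖ ≤ ‖t + x‖ + ‖t‖ := by simpa using norm_sub_le (t + x) t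
      nlinarith
    rw [Real.rpow_neg (by positivity), Real.rpow_neg (by positivity)] at h1
    rw [Real.rpow_neg (by positivity)] at h1 ⊢
    have e1 : 0 < (1 + ‖x‖) ^ r := by positivity
    have e2 : 0 < (1 + ‖t + x‖) ^ r := by positivity
    have e3 : 0 < (1 + ‖t‖) ^ r := by positivity
    rw [← mul_inv, inv_le_inv₀ e1 (by positivity)] at h1
    rwa [← div_eq_mul_inv, le_div_iff₀ e3]

theorem weight_add (s t : ℝ) (x : Eu d) : weight (s + t) x = weight s x * weight t x := by
  rw [weight, weight, weight, ← ENNReal.ofReal_mul (by positivity), add_div,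
    Real.rpow_add (by positivity)]

theorem weight_zero (x : Eu d) : weight 0 x = 1 := by simp [weight]

theorem weight_ne_top (s : ℝ) (x : Eu d) : weight s x ≠ ∞ := ENNReal.ofReal_ne_top

theorem weight_pos (s : ℝ) (x : Eu d) : 0 < weight s x := by
  rw [weight, ENNReal.ofReal_pos]; positivity

theorem weight_mul_weight_neg (s : ℝ) (x : Eu d) : weight s x * weight (-s) x = 1 := by
  rw [← weight_add, add_neg_cancel, weight_zero]

theorem continuous_weight (s : ℝ) : Continuous (weight s : Eu d → ℝ≥0∞) := by
  refine ENNReal.continuous_ofReal.comp (Continuous.rpow_const (by fun_prop) fun x => Or.inl ?_)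
  positivity

/-- Rests on `(1 + |x|)² / 4 ≤ 1 + |x|² ≤ (1 + |x|)²`; the factor `2 ^ |s|` is the `4` of the lower
bound raised to `|s| / 2`. -/
theorem weight_le (s : ℝ) (x : Eu d) :
    weight s x ≤ ENNReal.ofReal (2 ^ |s|) * ENNReal.ofReal ((1 + ‖x‖) ^ s) := by
  rw [← ENNReal.ofReal_mul (by positivity)]
  refine ENNReal.ofReal_le_ofReal ?_
  have hx := norm_nonneg x
  have e : ((1 + ‖x‖) ^ (2 : ℕ)) ^ (s / 2) = (1 + ‖x‖) ^ s := by
    rw [← Real.rpow_natCast, ← Real.rpow_mul (by positivity)]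
    congr 1; push_cast; ring
  rw [← e]
  have h2 : (1 : ℝ) ≤ 2 ^ |s| := Real.one_le_rpow (by norm_num) (abs_nonneg s)
  rcases le_total 0 s with hs | hs
  · refine (Real.rpow_le_rpow (by positivity) ?_ (by positivity)).trans
      (le_mul_of_one_le_left (by positivity) h2)
    nlinarith
  · have h1 : ((1 + ‖x‖) ^ 2 / 4) ^ (s / 2) = 2 ^ |s| * ((1 + ‖x‖) ^ 2) ^ (s / 2) := by
      rw [Real.div_rpow (by positivity) (by positivity), abs_of_nonpos hs,
        Real.rpow_neg (by positivity), div_eq_inv_mul]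
      congr 2
      rw [show (4 : ℝ) = 2 ^ (2 : ℝ) by norm_num, ← Real.rpow_mul (by positivity)]
      congr 1; ring
    rw [← h1]
    refine Real.rpow_le_rpow_of_nonpos (by positivity) ?_ (by linarith)
    nlinarith [sq_nonneg (‖x‖ - 1)]

theorem le_weight (s : ℝ) (x : Eu d) :
    ENNReal.ofReal ((1 + ‖x‖) ^ s) ≤ ENNReal.ofReal (2 ^ |s|) * weight s x := by
  have h := weight_le (-s) x
  rw [abs_neg] at h
  have e : ENNReal.ofReal ((1 + ‖x‖) ^ s) * ENNReal.ofReal ((1 + ‖x‖) ^ (-s)) = 1 := by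
    rw [← ENNReal.ofReal_mul (by positivity), ← Real.rpow_add (by positivity)]
    simp
  calc ENNReal.ofReal ((1 + ‖x‖) ^ s)
      = ENNReal.ofReal ((1 + ‖x‖) ^ s) * (weight s x * weight (-s) x) := by
        rw [weight_mul_weight_neg, mul_one]
    _ ≤ ENNReal.ofReal ((1 + ‖x‖) ^ s) * (weight s x *
          (ENNReal.ofReal (2 ^ |s|) * ENNReal.ofReal ((1 + ‖x‖) ^ (-s)))) := by gcongr
    _ = (ENNReal.ofReal ((1 + ‖x‖) ^ s) * ENNReal.ofReal ((1 + ‖x‖) ^ (-s))) *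
          (ENNReal.ofReal (2 ^ |s|) * weight s x) := by ring
    _ = _ := by rw [e, one_mul]

/-- **Peetre's inequality**. -/
theorem weight_add_le (s : ℝ) (x t : Eu d) : weight s (t + x) ≤
    ENNReal.ofReal (2 ^ |s|) * ENNReal.ofReal (2 ^ |s|) *
      (weight s x * ENNReal.ofReal ((1 + ‖t‖) ^ |s|)) := by
  calc weight s (t + x) ≤ ENNReal.ofReal (2 ^ |s|) * ENNReal.ofReal ((1 + ‖t + x‖) ^ s) :=
        weight_le s _
    _ ≤ ENNReal.ofReal (2 ^ |s|) *
        (ENNReal.ofReal ((1 + ‖x‖) ^ s) * ENNReal.ofReal ((1 + ‖t‖) ^ |s|)) := by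
        refine mul_le_mul' le_rfl ?_
        rw [← ENNReal.ofReal_mul (by positivity)]
        exact ENNReal.ofReal_le_ofReal (one_add_norm_rpow_add_le s x t)
    _ ≤ ENNReal.ofReal (2 ^ |s|) *
        ((ENNReal.ofReal (2 ^ |s|) * weight s x) * ENNReal.ofReal ((1 + ‖t‖) ^ |s|)) := by
        gcongr
        exact le_weight s x
    _ = _ := by ring

/-! ### Symbols -/

/-- Smooth functions all of whose derivatives are bounded by `(1 + |ξ|) ^ (-γ)`. -/
structure HasSymbolBound (γ : ℝ) (σ : Eu d → ℂ) : Prop where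
  smooth : ContDiff ℝ ((⊤ : ℕ∞) : WithTop ℕ∞) σ
  bound : ∀ n : ℕ, ∃ C : ℝ, ∀ ξ, ‖iteratedFDeriv ℝ n σ ξ‖ ≤ C * (1 + ‖ξ‖) ^ (-γ)

theorem HasSymbolBound.hasTemperateGrowth {γ : ℝ} {σ : Eu d → ℂ} (h : HasSymbolBound γ σ) :
    σ.HasTemperateGrowth := by
  refine ⟨h.smooth, fun n => ?_⟩
  obtain ⟨C, hC⟩ := h.bound n
  refine ⟨⌈|γ|⌉₊, |C|, fun ξ => (hC ξ).trans ?_⟩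
  have hξ := norm_nonneg ξ
  refine mul_le_mul (le_abs_self C) ?_ (by positivity) (abs_nonneg C)
  rw [← Real.rpow_natCast]
  refine Real.rpow_le_rpow_of_exponent_le (by linarith) ?_
  exact (neg_le_abs γ).trans (Nat.le_ceil _)

/-- Since `γ` is arbitrary, windows and compactly supported corrections can be treated as symbols of
any order. -/
theorem hasSymbolBound_schwartz (γ : ℝ) (φ : 𝓢(Eu d, ℂ)) : HasSymbolBound γ φ := by
  refine ⟨φ.smooth ⊤, fun n => ?_⟩
  set k := ⌈γ⌉₊
  refine ⟨2 ^ k * (Finset.Iic (k, n)).sup (schwartzSeminormFamily ℂ (Eu d) ℂ) φ, fun ξ => ?_⟩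
  have hξ := norm_nonneg ξ
  have h1 := SchwartzMap.one_add_le_sup_seminorm_apply (𝕜 := ℂ) (m := (k, n)) le_rfl le_rfl φ ξ
  rw [Real.rpow_neg (by positivity), ← div_eq_mul_inv, le_div_iff₀ (by positivity)]
  refine le_trans ?_ h1
  rw [mul_comm]
  refine mul_le_mul_of_nonneg_right ?_ (norm_nonneg _)
  rw [← Real.rpow_natCast]
  exact Real.rpow_le_rpow_of_exponent_le (by linarith) (Nat.le_ceil _)

theorem hasTemperateGrowth_comp_add {σ : Eu d → ℂ} (h : σ.HasTemperateGrowth) (x : Eu d) :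
    (fun t => σ (t + x)).HasTemperateGrowth := by
  refine h.comp (f := fun t => t + x) ?_
  fun_prop

/-- After recentring at the window, Leibniz's rule applies. Peetre's inequality bounds `(1 + |t +
x|)^{-γ}` by `(1 + |x|)^{-γ}` times at most `(1 + |t|)^K`, and the decay of `φ` absorbs that power
together with `|t|^k`. -/
theorem HasSymbolBound.seminorm_le {γ : ℝ} {σ : Eu d → ℂ} (h : HasSymbolBound γ σ)
    (φ : 𝓢(Eu d, ℂ)) (k n : ℕ) : ∃ C : ℝ, 0 ≤ C ∧ ∀ x : Eu d,
      SchwartzMap.seminorm ℂ k n (SchwartzMap.smulLeftCLM ℂ (fun t => σ (t + x)) φ) ≤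
        C * (1 + ‖x‖) ^ (-γ) := by
  choose A hA using h.bound
  set K := ⌈|γ|⌉₊
  set B : ℕ → ℝ := fun j =>
    2 ^ (k + K) * (Finset.Iic (k + K, j)).sup (schwartzSeminormFamily ℂ (Eu d) ℂ) φ with hB
  refine ⟨∑ i ∈ Finset.range (n + 1), n.choose i * |A i| * B (n - i), ?_, fun x => ?_⟩
  · exact Finset.sum_nonneg fun i _ => by positivity
  refine SchwartzMap.seminorm_le_bound ℂ k n _ ?_ fun t => ?_
  · have := norm_nonneg x
    have : 0 ≤ ∑ i ∈ Finset.range (n + 1), n.choose i * |A i| * B (n - i) :=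
      Finset.sum_nonneg fun i _ => by positivity
    positivity
  have htg := hasTemperateGrowth_comp_add h.hasTemperateGrowth x
  have e : (SchwartzMap.smulLeftCLM ℂ (fun t => σ (t + x)) φ : Eu d → ℂ) =
      fun t => σ (t + x) * φ t := by
    rw [SchwartzMap.smulLeftCLM_apply htg]; rfl
  rw [e]
  have hle := norm_iteratedFDeriv_mul_le (𝕜 := ℝ) (N := ((⊤ : ℕ∞) : WithTop ℕ∞)) htg.1 (φ.smooth ⊤) t
    (n := n) (by exact_mod_cast le_top)
  calc ‖t‖ ^ k * ‖iteratedFDeriv ℝ n (fun t => σ (t + x) * φ t) t‖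
      ≤ ‖t‖ ^ k * ∑ i ∈ Finset.range (n + 1), n.choose i *
          ‖iteratedFDeriv ℝ i (fun t => σ (t + x)) t‖ * ‖iteratedFDeriv ℝ (n - i) φ t‖ := by
        gcongr
    _ = ∑ i ∈ Finset.range (n + 1), ‖t‖ ^ k * (n.choose i *
          ‖iteratedFDeriv ℝ i (fun t => σ (t + x)) t‖ * ‖iteratedFDeriv ℝ (n - i) φ t‖) := by
        rw [Finset.mul_sum]
    _ ≤ ∑ i ∈ Finset.range (n + 1), n.choose i * |A i| * B (n - i) * (1 + ‖x‖) ^ (-γ) := by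
        refine Finset.sum_le_sum fun i _ => ?_
        have ht := norm_nonneg t
        have hx := norm_nonneg x
        have h1 : ‖iteratedFDeriv ℝ i (fun t => σ (t + x)) t‖ ≤
            |A i| * ((1 + ‖x‖) ^ (-γ) * (1 + ‖t‖) ^ K) := by
          rw [iteratedFDeriv_comp_add_right]
          refine (hA i _).trans (mul_le_mul (le_abs_self _) ?_ (by positivity) (abs_nonneg _))
          refine (one_add_norm_rpow_add_le (-γ) x t).trans ?_
          gcongr
          rw [← Real.rpow_natCast, abs_neg]
          exact Real.rpow_le_rpow_of_exponent_le (by linarith) (Nat.le_ceil _)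
        have h2 : (1 + ‖t‖) ^ (k + K) * ‖iteratedFDeriv ℝ (n - i) φ t‖ ≤ B (n - i) :=
          SchwartzMap.one_add_le_sup_seminorm_apply (𝕜 := ℂ) (m := (k + K, n - i)) le_rfl le_rfl φ t
        have h3 : ‖t‖ ^ k ≤ (1 + ‖t‖) ^ k := by gcongr; linarith
        calc ‖t‖ ^ k * (n.choose i *
              ‖iteratedFDeriv ℝ i (fun t => σ (t + x)) t‖ * ‖iteratedFDeriv ℝ (n - i) φ t‖)
            ≤ (1 + ‖t‖) ^ k * (n.choose i * (|A i| * ((1 + ‖x‖) ^ (-γ) * (1 + ‖t‖) ^ K)) *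
                ‖iteratedFDeriv ℝ (n - i) φ t‖) := by gcongr
          _ = n.choose i * |A i| * (1 + ‖x‖) ^ (-γ) *
                ((1 + ‖t‖) ^ (k + K) * ‖iteratedFDeriv ℝ (n - i) φ t‖) := by
              rw [pow_add]; ring
          _ ≤ n.choose i * |A i| * (1 + ‖x‖) ^ (-γ) * B (n - i) := by gcongr
          _ = _ := by ring
    _ = _ := by rw [Finset.sum_mul]

theorem HasSymbolBound.sup_seminorm_le {γ : ℝ} {σ : Eu d → ℂ} (h : HasSymbolBound γ σ)
    (φ : 𝓢(Eu d, ℂ)) (A : 𝓢(Eu d, ℂ) →L[ℂ] 𝓢(Eu d, ℂ)) (s : Finset (ℕ × ℕ)) :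
    ∃ C : ℝ, 0 ≤ C ∧ ∀ x : Eu d, s.sup (schwartzSeminormFamily ℂ (Eu d) ℂ)
        (A (SchwartzMap.smulLeftCLM ℂ (fun t => σ (t + x)) φ)) ≤ C * (1 + ‖x‖) ^ (-γ) := by
  have key : ∀ i : ℕ × ℕ, ∃ C : ℝ, 0 ≤ C ∧ ∀ x : Eu d, SchwartzMap.seminorm ℂ i.1 i.2
        (A (SchwartzMap.smulLeftCLM ℂ (fun t => σ (t + x)) φ)) ≤ C * (1 + ‖x‖) ^ (-γ) := by
    intro i
    obtain ⟨s, C, hC, hs⟩ := exists_seminorm_bound_clm A i.1 i.2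
    choose D hD0 hD using h.seminorm_le φ
    refine ⟨C * ∑ j ∈ s, D j.1 j.2, mul_nonneg hC (Finset.sum_nonneg fun j _ => hD0 _ _),
      fun x => (hs _).trans ?_⟩
    rw [mul_assoc, Finset.sum_mul]
    refine mul_le_mul_of_nonneg_left ((sup_seminorm_le_sum s _).trans ?_) hC
    exact Finset.sum_le_sum fun j _ => hD _ _ x
  choose D hD0 hD using key
  refine ⟨∑ j ∈ s, D j, Finset.sum_nonneg fun j _ => hD0 _, fun x => ?_⟩
  rw [Finset.sum_mul]
  exact (sup_seminorm_le_sum s _).trans (Finset.sum_le_sum fun j _ => hD _ x)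

/-! ### Translations and the Fourier transform -/

theorem fourier_translate_apply (ξ : Eu d) (ψ : 𝓢(Eu d, ℂ)) (y : Eu d) :
    𝓕 (translate ξ ψ) y = (Real.fourierChar (-inner ℝ ξ y) : ℂ) * 𝓕 ψ y := by
  simp only [SchwartzMap.fourier_coe, Real.fourier_eq, Circle.smul_def, smul_eq_mul]
  rw [← integral_const_mul, ← integral_sub_right_eq_self (fun v =>
    (Real.fourierChar (-inner ℝ ξ y) : ℂ) * ((Real.fourierChar (-inner ℝ v y) : ℂ) * ψ v)) ξ]
  congr 1 with v
  rw [SchwartzMap.compSubConstCLM_apply, ← mul_assoc, ← Circle.coe_mul, ← AddChar.map_add_eq_mul]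
  congr 3
  rw [inner_sub_left]; ring

theorem fourierInv_translate_apply (ξ : Eu d) (ψ : 𝓢(Eu d, ℂ)) (y : Eu d) :
    𝓕⁻ (translate ξ ψ) y = (Real.fourierChar (inner ℝ ξ y) : ℂ) * 𝓕⁻ ψ y := by
  simp only [SchwartzMap.fourierInv_coe, Real.fourierInv_eq, Circle.smul_def, smul_eq_mul]
  rw [← integral_const_mul, ← integral_sub_right_eq_self (fun v =>
    (Real.fourierChar (inner ℝ ξ y) : ℂ) * ((Real.fourierChar (inner ℝ v y) : ℂ) * ψ v)) ξ]
  congr 1 with v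
  rw [SchwartzMap.compSubConstCLM_apply, ← mul_assoc, ← Circle.coe_mul, ← AddChar.map_add_eq_mul]
  congr 3
  rw [inner_sub_left]; ring

theorem enorm_fourier_translate (ξ : Eu d) (ψ : 𝓢(Eu d, ℂ)) (y : Eu d) :
    ‖𝓕 (translate ξ ψ) y‖ₑ = ‖𝓕 ψ y‖ₑ := by
  rw [fourier_translate_apply, enorm_mul]
  rw [← ofReal_norm, Circle.norm_coe, ENNReal.ofReal_one, one_mul]

theorem eLpNorm_fourier_translate (ξ : Eu d) (ψ : 𝓢(Eu d, ℂ)) (r : ℝ≥0∞) :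
    eLpNorm (𝓕 (translate ξ ψ) : 𝓢(Eu d, ℂ)) r volume = eLpNorm (𝓕 ψ : 𝓢(Eu d, ℂ)) r volume :=
  eLpNorm_congr_enorm_ae (ae_of_all _ fun y => enorm_fourier_translate ξ ψ y)

/-- Translating the symbol instead of the window leaves an outer translation, which is invisible in
the modulus of the Fourier transform. -/
theorem smulLeftCLM_translate {σ : Eu d → ℂ} (h : σ.HasTemperateGrowth) (x : Eu d)
    (φ : 𝓢(Eu d, ℂ)) : SchwartzMap.smulLeftCLM ℂ σ (translate x φ) =
      translate x (SchwartzMap.smulLeftCLM ℂ (fun t => σ (t + x)) φ) := by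
  ext t
  rw [SchwartzMap.smulLeftCLM_apply_apply h, SchwartzMap.compSubConstCLM_apply,
    SchwartzMap.compSubConstCLM_apply,
    SchwartzMap.smulLeftCLM_apply_apply (hasTemperateGrowth_comp_add h x), sub_add_cancel]

/-- Decay in `x` of the `𝓕L^r` norm of `σ · T_x φ`. -/
theorem HasSymbolBound.eLpNorm_fourier_le {γ : ℝ} {σ : Eu d → ℂ} (h : HasSymbolBound γ σ)
    (φ : 𝓢(Eu d, ℂ)) (r : ℝ≥0∞) : ∃ C : ℝ≥0, ∀ x : Eu d,
      eLpNorm (𝓕 (SchwartzMap.smulLeftCLM ℂ σ (translate x φ)) : 𝓢(Eu d, ℂ)) r volume ≤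
        C * ENNReal.ofReal ((1 + ‖x‖) ^ (-γ)) := by
  obtain ⟨k, C, hC⟩ := SchwartzMap.eLpNorm_le_seminorm (E := Eu d) (F := ℂ) ℂ r volume
  obtain ⟨D, hD0, hD⟩ := h.sup_seminorm_le φ (fourierCLM ℂ 𝓢(Eu d, ℂ)) (Finset.Iic (k, 0))
  refine ⟨C * D.toNNReal, fun x => ?_⟩
  rw [smulLeftCLM_translate h.hasTemperateGrowth, eLpNorm_fourier_translate]
  refine (hC _).trans ?_
  rw [ENNReal.coe_mul, mul_assoc]
  gcongr
  refine (ENNReal.ofReal_le_ofReal (hD x)).trans ?_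
  rw [ENNReal.ofReal_mul hD0]
  rfl

/-- Decay in `x` and `ζ` of the Fourier transform of `σ · T_x φ`. -/
theorem HasSymbolBound.norm_fourier_le {γ : ℝ} {σ : Eu d → ℂ} (h : HasSymbolBound γ σ)
    (φ : 𝓢(Eu d, ℂ)) (k : ℕ) : ∃ C : ℝ, 0 ≤ C ∧ ∀ x ζ : Eu d,
      ‖𝓕 (SchwartzMap.smulLeftCLM ℂ σ (translate x φ)) ζ‖ ≤
        C * (1 + ‖x‖) ^ (-γ) * (1 + ‖ζ‖) ^ (-(k : ℝ)) := by
  obtain ⟨D, hD0, hD⟩ := h.sup_seminorm_le φ (fourierCLM ℂ 𝓢(Eu d, ℂ)) (Finset.Iic (k, 0))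
  refine ⟨2 ^ k * D, by positivity, fun x ζ => ?_⟩
  rw [smulLeftCLM_translate h.hasTemperateGrowth, fourier_translate_apply, norm_mul,
    Circle.norm_coe, one_mul]
  have h1 := SchwartzMap.one_add_le_sup_seminorm_apply (𝕜 := ℂ) (m := (k, 0)) le_rfl le_rfl
    (𝓕 (SchwartzMap.smulLeftCLM ℂ (fun t => σ (t + x)) φ)) ζ
  rw [norm_iteratedFDeriv_zero] at h1
  have hζ := norm_nonneg ζ
  rw [Real.rpow_neg (x := 1 + ‖ζ‖) (by positivity), ← div_eq_mul_inv,
    le_div_iff₀ (by positivity), mul_comm, Real.rpow_natCast, mul_assoc]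
  exact h1.trans (mul_le_mul_of_nonneg_left (hD x) (by positivity))

end

section

open Filter Topology

variable {d : ℕ}

/-! ### Profiles of tempered distributions -/

/-- Multiplication of Schwartz functions by a function of temperate growth. -/
abbrev mulBy (σ : Eu d → ℂ) : 𝓢(Eu d, ℂ) →L[ℂ] 𝓢(Eu d, ℂ) := SchwartzMap.smulLeftCLM ℂ σ

theorem mulBy_apply {σ : Eu d → ℂ} (h : σ.HasTemperateGrowth) (ψ : 𝓢(Eu d, ℂ)) (t : Eu d) :
    mulBy σ ψ t = σ t * ψ t := by
  rw [SchwartzMap.smulLeftCLM_apply_apply h, smul_eq_mul]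

theorem mulBy_schwartz_apply (a ψ : 𝓢(Eu d, ℂ)) (t : Eu d) : mulBy a ψ t = a t * ψ t :=
  mulBy_apply a.hasTemperateGrowth ψ t

/-- The complex conjugate of a Schwartz function. -/
def conjS (ψ : 𝓢(Eu d, ℂ)) : 𝓢(Eu d, ℂ) :=
  SchwartzMap.postcompCLM (𝕜 := ℝ) (Complex.conjCLE : ℂ →L[ℝ] ℂ) ψ

theorem conjS_apply (ψ : 𝓢(Eu d, ℂ)) (t : Eu d) : conjS ψ t = (starRingEnd ℂ) (ψ t) := rfl

/-- A tempered distribution as a continuous functional. -/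
def functional (f : 𝓢'(Eu d, ℂ)) : 𝓢(Eu d, ℂ) →L[ℂ] ℂ := ⟨f.toLinearMap, f.cont⟩

theorem functional_apply (f : 𝓢'(Eu d, ℂ)) (ψ : 𝓢(Eu d, ℂ)) : functional f ψ = f ψ := rfl

/-- The value at `x` of the inverse Fourier transform of `m` times the Fourier transform of `f`. -/
def prof (f : 𝓢'(Eu d, ℂ)) (m : 𝓢(Eu d, ℂ)) (x : Eu d) : ℂ :=
  f (translate x (𝓕 m))

/-- The `L^p` norm of a profile. -/
def profNorm (f : 𝓢'(Eu d, ℂ)) (p : ℝ≥0∞) (m : 𝓢(Eu d, ℂ)) : ℝ≥0∞ :=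
  eLpNorm (prof f m) p volume

/-- The window on the Fourier side. -/
def win (g : 𝓢(Eu d, ℂ)) : 𝓢(Eu d, ℂ) := 𝓕⁻ (conjS g)

theorem fourier_win (g : 𝓢(Eu d, ℂ)) : 𝓕 (win g) = conjS g := by
  simp [win]

theorem atom_eq (g : 𝓢(Eu d, ℂ)) (x ξ : Eu d) :
    atom g x ξ = (Real.fourierChar (-inner ℝ x ξ) : ℂ) •
      translate x (𝓕 (translate ξ (win g))) := by
  ext y
  rw [atom_apply, smul_apply, SchwartzMap.compSubConstCLM_apply, fourier_translate_apply,
    fourier_win, conjS_apply, smul_eq_mul, ← mul_assoc, ← Circle.coe_mul,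
    ← AddChar.map_add_eq_mul]
  congr 3
  rw [inner_sub_right, real_inner_comm ξ x, real_inner_comm ξ y]; ring

/-- A modulation in time is a translation in frequency. The remaining phase disappears in absolute
value, so modulation norms become weighted `L^q` norms of `profNorm`. -/
theorem stft_eq (g : 𝓢(Eu d, ℂ)) (f : 𝓢'(Eu d, ℂ)) (x ξ : Eu d) :
    stft g f x ξ = (Real.fourierChar (-inner ℝ x ξ) : ℂ) * prof f (translate ξ (win g)) x := by
  rw [stft, atom_eq, map_smul, smul_eq_mul, prof]

theorem eLpNorm_stft (p : ℝ≥0∞) (g : 𝓢(Eu d, ℂ)) (f : 𝓢'(Eu d, ℂ)) (ξ : Eu d) :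
    eLpNorm (fun x => stft g f x ξ) p volume = profNorm f p (translate ξ (win g)) := by
  refine eLpNorm_congr_norm_ae (ae_of_all _ fun x => ?_)
  rw [stft_eq, norm_mul, Circle.norm_coe, one_mul]

theorem modNorm_eq (p q : ℝ≥0∞) (s : ℝ) (g : 𝓢(Eu d, ℂ)) (f : 𝓢'(Eu d, ℂ)) :
    modNorm p q s g f =
      eLpNorm (fun ξ => weight s ξ * profNorm f p (translate ξ (win g))) q volume := by
  simp only [modNorm, eLpNorm_stft]

/-- Joint continuity supplies the measurability in `(ξ, x)` needed for Minkowski's inequality; `A`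
makes room for multiplication by a symbol. -/
theorem continuous_prof₂ (f : 𝓢'(Eu d, ℂ)) (A : 𝓢(Eu d, ℂ) →L[ℂ] 𝓢(Eu d, ℂ)) (h : 𝓢(Eu d, ℂ)) :
    Continuous fun z : Eu d × Eu d => prof f (A (translate z.1 h)) z.2 := by
  have h1 : Continuous fun z : Eu d × Eu d => A (translate z.1 h) :=
    A.continuous.comp (continuous_translate.comp (continuous_fst.prodMk continuous_const))
  have h2 : Continuous fun z : Eu d × Eu d => translate z.2 (𝓕 (A (translate z.1 h))) :=
    continuous_translate.comp
      (continuous_snd.prodMk ((fourierCLM ℂ 𝓢(Eu d, ℂ)).continuous.comp h1))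
  exact (functional f).continuous.comp h2

theorem continuous_prof (f : 𝓢'(Eu d, ℂ)) (m : 𝓢(Eu d, ℂ)) : Continuous (prof f m) :=
  (functional f).continuous.comp
    (continuous_translate.comp (continuous_id.prodMk continuous_const))

theorem measurable_profNorm (f : 𝓢'(Eu d, ℂ)) (p : ℝ≥0∞) (A : 𝓢(Eu d, ℂ) →L[ℂ] 𝓢(Eu d, ℂ))
    (h : 𝓢(Eu d, ℂ)) : Measurable fun ξ => profNorm f p (A (translate ξ h)) := by
  have := measurable_eLpNorm_prod (μ := (volume : Measure (Eu d))) (p := p)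
    (F := fun z : Eu d × Eu d => ‖prof f (A (translate z.1 h)) z.2‖ₑ)
    (continuous_prof₂ f A h).enorm.measurable
  simpa only [profNorm, eLpNorm_enorm] using this

theorem prof_add (f₁ f₂ : 𝓢'(Eu d, ℂ)) (m : 𝓢(Eu d, ℂ)) :
    prof (f₁ + f₂) m = prof f₁ m + prof f₂ m := rfl

/-- The Fourier multiplier acts on profiles by multiplication. -/
theorem prof_fourierMultiplier {σ : Eu d → ℂ} (h : σ.HasTemperateGrowth) (f : 𝓢'(Eu d, ℂ))
    (m : 𝓢(Eu d, ℂ)) :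
    prof (TemperedDistribution.fourierMultiplierCLM ℂ σ f) m = prof f (mulBy σ m) := by
  ext x
  rw [prof, prof, TemperedDistribution.fourierMultiplierCLM_apply_apply]
  congr 1
  have : SchwartzMap.smulLeftCLM ℂ σ (𝓕⁻ (translate x (𝓕 m))) =
      𝓕⁻ (translate x (𝓕 (mulBy σ m))) := by
    ext t
    rw [mulBy_apply h, fourierInv_translate_apply, fourierInv_translate_apply]
    simp only [FourierTransform.fourierInv_fourier_eq]
    rw [mulBy_apply h]; ring
  rw [this, FourierTransform.fourier_fourierInv_eq]

/-! ### Integral representations -/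

/-- The convolution theorem, from the duality `∫ 𝓕⁻¹κ · h = ∫ κ · 𝓕⁻¹h` applied to `m` times the
character of frequency `t`. -/
theorem fourier_mulBy_fourierInv (κ m : 𝓢(Eu d, ℂ)) (t : Eu d) :
    𝓕 (mulBy (𝓕⁻ κ : 𝓢(Eu d, ℂ)) m) t = ∫ z, κ z * 𝓕 m (t - z) := by
  set h : 𝓢(Eu d, ℂ) :=
    mulBy (fun y : Eu d => (Real.fourierChar (-inner ℝ y t) : ℂ)) m with hh
  have h1 : ∀ z, 𝓕⁻ h z = 𝓕 m (t - z) := by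
    intro z
    rw [SchwartzMap.fourierInv_coe, SchwartzMap.fourier_coe, Real.fourierInv_eq, Real.fourier_eq]
    congr 1 with v
    rw [hh, mulBy_apply (hasTemperateGrowth_char t), Circle.smul_def, Circle.smul_def, smul_eq_mul,
      smul_eq_mul, ← mul_assoc, ← Circle.coe_mul, ← AddChar.map_add_eq_mul]
    congr 3
    rw [inner_sub_right]; ring
  have h2 := SchwartzMap.integral_fourierInv_mul_eq κ h
  simp only [h1] at h2
  rw [← h2, SchwartzMap.fourier_coe, Real.fourier_eq]
  congr 1 with v
  rw [hh, mulBy_apply (hasTemperateGrowth_char t), mulBy_schwartz_apply, Circle.smul_def,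
    smul_eq_mul]
  ring

theorem integrable_one_add_norm_rpow {r : ℝ} (hr : (d : ℝ) < r) :
    Integrable fun x : Eu d => (1 + ‖x‖) ^ (-r) :=
  integrable_one_add_norm (by simpa using hr)

theorem isIntegralOf_convolution (κ m : 𝓢(Eu d, ℂ)) (x : Eu d) :
    IsIntegralOf (translate x (𝓕 (mulBy (𝓕⁻ κ : 𝓢(Eu d, ℂ)) m)))
      (fun z => κ z • translate (x + z) (𝓕 m)) := by
  refine ⟨?_, fun k n => ?_, fun t => ?_⟩
  · exact κ.continuous.smul (continuous_translate.comp
      ((continuous_const.add continuous_id).prodMk continuous_const))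
  -- Of the decay of `κ`, the power `k` pays for the growth of seminorms under translation and `d +
  -- 1` for integrability.
  · obtain ⟨C, hC⟩ := (hasSymbolBound_schwartz (k + (d + 1)) κ).bound 0
    set D := 2 ^ k * (Finset.Iic (k, n)).sup (schwartzSeminormFamily ℂ (Eu d) ℂ) (𝓕 m) with hD
    refine ⟨fun z => |C| * (1 + ‖x‖) ^ k * D * (1 + ‖z‖) ^ (-((d : ℝ) + 1)),
      (integrable_one_add_norm_rpow (by linarith)).const_mul _, fun z => ?_⟩
    have hx := norm_nonneg x
    have hz := norm_nonneg z
    rw [map_smul_eq_mul]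
    have h1 : ‖κ z‖ ≤ |C| * (1 + ‖z‖) ^ (-((k : ℝ) + (d + 1))) := by
      have := hC z
      rw [norm_iteratedFDeriv_zero] at this
      exact this.trans (mul_le_mul_of_nonneg_right (le_abs_self C) (by positivity))
    have h2 : (1 + ‖x + z‖) ^ k ≤ (1 + ‖x‖) ^ k * (1 + ‖z‖) ^ k := by
      rw [← mul_pow]
      have := norm_add_le x z
      gcongr
      nlinarith
    calc ‖κ z‖ * SchwartzMap.seminorm ℂ k n (translate (x + z) (𝓕 m))
        ≤ (|C| * (1 + ‖z‖) ^ (-((k : ℝ) + (d + 1)))) *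
            (((1 + ‖x‖) ^ k * (1 + ‖z‖) ^ k) * D) := by
          refine mul_le_mul h1 ((seminorm_translate_le k n _ _).trans ?_) (by positivity)
            (by positivity)
          exact mul_le_mul_of_nonneg_right h2 (by positivity)
      _ = |C| * (1 + ‖x‖) ^ k * D * ((1 + ‖z‖) ^ (-((k : ℝ) + (d + 1))) * (1 + ‖z‖) ^ k) := by
          ring
      _ = _ := by
          rw [← Real.rpow_natCast (1 + ‖z‖) k, ← Real.rpow_add (by positivity)]
          congr 2; ring
  · rw [SchwartzMap.compSubConstCLM_apply, fourier_mulBy_fourierInv]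
    congr 1 with z
    rw [smul_apply, SchwartzMap.compSubConstCLM_apply, smul_eq_mul, sub_sub]

theorem prof_convolution (f : 𝓢'(Eu d, ℂ)) (κ m : 𝓢(Eu d, ℂ)) (x : Eu d) :
    prof f (mulBy (𝓕⁻ κ : 𝓢(Eu d, ℂ)) m) x = ∫ z, κ z * prof f m (x + z) := by
  have := (isIntegralOf_convolution κ m x).apply_eq (functional f)
  simpa [functional_apply, prof] using this

/-- Multiplication in frequency is convolution in `x` against `𝓕 a`; all `L^p` estimates of
multipliers go through this identity. -/
theorem prof_mulBy (f : 𝓢'(Eu d, ℂ)) (a m : 𝓢(Eu d, ℂ)) (x : Eu d) :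
    prof f (mulBy a m) x = ∫ z, 𝓕 a z * prof f m (x + z) := by
  have := prof_convolution f (𝓕 a) m x
  rwa [FourierTransform.fourierInv_fourier_eq] at this

theorem profNorm_mulBy_le (f : 𝓢'(Eu d, ℂ)) {p : ℝ≥0∞} (hp : 1 ≤ p) (a m : 𝓢(Eu d, ℂ)) :
    profNorm f p (mulBy a m) ≤ eLpNorm (𝓕 a : 𝓢(Eu d, ℂ)) 1 volume * profNorm f p m := by
  have h1 := eLpNorm_lintegral_mul_comp_add_le hp (k := fun z => ‖(𝓕 a : 𝓢(Eu d, ℂ)) z‖ₑ)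
    (u := fun z => ‖prof f m z‖ₑ) (𝓕 a : 𝓢(Eu d, ℂ)).continuous.enorm.measurable
    (continuous_prof f m).enorm.measurable
  rw [eLpNorm_enorm] at h1
  rw [eLpNorm_one_eq_lintegral_enorm]
  refine le_trans ?_ h1
  refine eLpNorm_mono_enorm_ae (ae_of_all _ fun x => ?_)
  rw [prof_mulBy, enorm_eq_self]
  refine (enorm_integral_le_lintegral_enorm _).trans_eq ?_
  simp only [enorm_mul]

theorem translate_mulBy (ξ : Eu d) (a b : 𝓢(Eu d, ℂ)) :
    translate ξ (mulBy a b) = mulBy (translate ξ a) (translate ξ b) := by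
  ext t
  simp only [SchwartzMap.compSubConstCLM_apply, mulBy_schwartz_apply]

/-- A continuous partition of unity: the translates of `h` integrate to the constant `∫ h`, and the
factor `a` makes the integral converge in every Schwartz seminorm. -/
theorem isIntegralOf_mulBy_translate (a h : 𝓢(Eu d, ℂ)) :
    IsIntegralOf ((∫ t, h t) • a) (fun η => mulBy a (translate η h)) := by
  refine ⟨?_, fun k n => ?_, fun t => ?_⟩
  · exact (mulBy a).continuous.comp
      (continuous_translate.comp (continuous_id.prodMk continuous_const))
  · obtain ⟨C, hC0, hC⟩ := (hasSymbolBound_schwartz (k + (d + 1)) a).sup_seminorm_le h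
      (ContinuousLinearMap.id ℂ _) (Finset.Iic (k, n))
    refine ⟨fun z => 2 ^ k * C * (1 + ‖z‖) ^ (-((d : ℝ) + 1)),
      (integrable_one_add_norm_rpow (by linarith)).const_mul _, fun z => ?_⟩
    have hz := norm_nonneg z
    rw [mulBy, smulLeftCLM_translate a.hasTemperateGrowth]
    calc _ ≤ (1 + ‖z‖) ^ k * (2 ^ k * (C * (1 + ‖z‖) ^ (-((k : ℝ) + (d + 1))))) := by
          refine (seminorm_translate_le k n _ _).trans ?_
          refine mul_le_mul_of_nonneg_left (mul_le_mul_of_nonneg_left (hC z) (by positivity))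
            (by positivity)
      _ = 2 ^ k * C * ((1 + ‖z‖) ^ (-((k : ℝ) + (d + 1))) * (1 + ‖z‖) ^ k) := by ring
      _ = _ := by
          rw [← Real.rpow_natCast (1 + ‖z‖) k, ← Real.rpow_add (by positivity)]
          congr 2; ring
  · simp only [mulBy_schwartz_apply, SchwartzMap.compSubConstCLM_apply]
    rw [integral_const_mul, integral_sub_left_eq_self (fun t => h t), smul_apply, smul_eq_mul,
      mul_comm]

/-- Resolution of a profile into profiles of localized functions. -/
theorem profNorm_le_lintegral (f : 𝓢'(Eu d, ℂ)) {p : ℝ≥0∞} (hp : 1 ≤ p) (σ : Eu d → ℂ)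
    (a h : 𝓢(Eu d, ℂ)) (hh : ∫ t, h t ≠ 0) :
    profNorm f p (mulBy σ a) ≤ ‖(∫ t, h t)⁻¹‖ₑ *
      ∫⁻ η, profNorm f p (mulBy σ (mulBy a (translate η h))) := by
  set c := ∫ t, h t with hc
  have hrep : ∀ x, prof f (mulBy σ a) x =
      c⁻¹ * ∫ η, prof f (mulBy σ (mulBy a (translate η h))) x := by
    intro x
    have := (isIntegralOf_mulBy_translate a h).apply_eq
      ((functional f).comp ((translate x).comp ((fourierCLM ℂ 𝓢(Eu d, ℂ)).comp (mulBy σ))))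
    rw [map_smul, ← hc, smul_eq_mul] at this
    rw [eq_inv_mul_iff_mul_eq₀ hh]
    exact this
  have hmeas := (continuous_prof₂ f ((mulBy σ).comp (mulBy a)) h).enorm.measurable
  have h1 := eLpNorm_lintegral_le (μ := (volume : Measure (Eu d))) (ν := (volume : Measure (Eu d)))
    hp hmeas
  simp only [eLpNorm_enorm] at h1
  refine le_trans ?_ (mul_le_mul' le_rfl h1)
  rw [← eLpNorm_const_mul_ennreal (by simp)]
  refine eLpNorm_mono_enorm_ae (ae_of_all _ fun x => ?_)
  rw [enorm_eq_self, hrep, enorm_mul]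
  exact mul_le_mul' le_rfl (enorm_integral_le_lintegral_enorm _)

/-- Almost orthogonality of distant translates: a common translation does not affect the modulus of
the Fourier transform, so only `η - ξ` matters. -/
theorem eLpNorm_fourier_mulBy_translate_le (a b : 𝓢(Eu d, ℂ)) (r : ℝ≥0∞) (L : ℝ) :
    ∃ C : ℝ≥0, ∀ ξ η : Eu d,
      eLpNorm (𝓕 (mulBy (translate ξ a) (translate η b)) : 𝓢(Eu d, ℂ)) r volume ≤
        C * ENNReal.ofReal ((1 + ‖η - ξ‖) ^ (-L)) := by
  obtain ⟨C, hC⟩ := (hasSymbolBound_schwartz L a).eLpNorm_fourier_le b r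
  refine ⟨C, fun ξ η => ?_⟩
  have : mulBy (translate ξ a) (translate η b) = translate ξ (mulBy a (translate (η - ξ) b)) := by
    rw [translate_mulBy, SchwartzMap.compSubConstCLM_comp, sub_add_cancel]
  rw [this, eLpNorm_fourier_translate]
  exact hC _

end

section

open Filter Topology

variable {d : ℕ}

/-! ### Multiplier estimates for `p ≥ 1` -/

theorem lintegral_one_add_norm_lt_top {r : ℝ} (hr : (d : ℝ) < r) :
    ∫⁻ x : Eu d, ENNReal.ofReal ((1 + ‖x‖) ^ (-r)) < ∞ :=
  finite_integral_one_add_norm (by simpa using hr)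

theorem measurable_one_add_norm_rpow (r : ℝ) :
    Measurable fun x : Eu d => ENNReal.ofReal ((1 + ‖x‖) ^ r) := by
  refine (ENNReal.continuous_ofReal.comp
    (Continuous.rpow_const (by fun_prop) fun x => Or.inl ?_)).measurable
  positivity

theorem measurable_weight (s : ℝ) : Measurable (weight s : Eu d → ℝ≥0∞) :=
  (continuous_weight s).measurable

theorem exists_mul_translate_ne_zero {a b : 𝓢(Eu d, ℂ)} (ha : a ≠ 0) (hb : b ≠ 0) :
    ∃ y t : Eu d, a t * translate y b t ≠ 0 := by
  obtain ⟨t, ht⟩ : ∃ t, a t ≠ 0 := by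
    by_contra! h
    exact ha (SchwartzMap.ext h)
  obtain ⟨u, hu⟩ : ∃ u, b u ≠ 0 := by
    by_contra! h
    exact hb (SchwartzMap.ext h)
  exact ⟨t - u, t, by simpa [SchwartzMap.compSubConstCLM_apply] using ⟨ht, hu⟩⟩

theorem integral_conjS_mul_self_ne_zero {ψ : 𝓢(Eu d, ℂ)} (h : ∃ t, ψ t ≠ 0) :
    ∫ t, mulBy (conjS ψ) ψ t ≠ 0 := by
  have e : ∀ t, mulBy (conjS ψ) ψ t = ((‖ψ t‖ ^ 2 : ℝ) : ℂ) := fun t => by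
    rw [mulBy_schwartz_apply, conjS_apply, Complex.conj_mul']
    push_cast; rfl
  simp only [e]
  rw [integral_complex_ofReal]
  have hint : Integrable fun t => ‖ψ t‖ ^ 2 := by
    have := (mulBy (conjS ψ) ψ).integrable (μ := volume).norm
    refine this.congr (ae_of_all _ fun t => ?_)
    simp only [e, Complex.norm_real, norm_pow, norm_norm]
  obtain ⟨t₀, ht₀⟩ := h
  have := integral_pos_of_integrable_nonneg_nonzero (μ := (volume : Measure (Eu d)))
    (f := fun t => ‖ψ t‖ ^ 2) (ψ.continuous.norm.pow 2) hint (fun t => by positivity)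
    (x := t₀) (by simpa using ht₀)
  exact_mod_cast this.ne'

/-- The `𝓕L^r` norm of the localized symbol. -/
def localNorm (r : ℝ≥0∞) (σ : Eu d → ℂ) (φ : 𝓢(Eu d, ℂ)) (x : Eu d) : ℝ≥0∞ :=
  eLpNorm (𝓕 (mulBy σ (translate x φ)) : 𝓢(Eu d, ℂ)) r volume

theorem profNorm_mulBy_mulBy_le (f : 𝓢'(Eu d, ℂ)) {p : ℝ≥0∞} (hp : 1 ≤ p) (a b m : 𝓢(Eu d, ℂ)) :
    profNorm f p (mulBy a (mulBy b m)) ≤ eLpNorm (𝓕 a : 𝓢(Eu d, ℂ)) 1 volume *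
      (eLpNorm (𝓕 b : 𝓢(Eu d, ℂ)) 1 volume * profNorm f p m) :=
  (profNorm_mulBy_le f hp _ _).trans (mul_le_mul' le_rfl (profNorm_mulBy_le f hp _ _))

theorem weight_neg_mul_le_of_le {δ : ℝ} {x : Eu d} {a w : ℝ≥0∞} (h : weight δ x * a ≤ w) :
    a ≤ w * weight (-δ) x := by
  calc a = (weight δ x * a) * weight (-δ) x := by
        rw [mul_right_comm, weight_mul_weight_neg, one_mul]
    _ ≤ _ := by gcongr

/-- Estimate of a multiplier by a convolution in frequency. -/
theorem exists_profNorm_mulBy_le_lintegral {G φ : 𝓢(Eu d, ℂ)} (hG : G ≠ 0) (hφ : φ ≠ 0) (δ L : ℝ) :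
    ∃ C : ℝ≥0, ∀ (f : 𝓢'(Eu d, ℂ)) (p : ℝ≥0∞), 1 ≤ p → ∀ (σ : Eu d → ℂ), σ.HasTemperateGrowth →
      ∀ w : ℝ≥0∞, (∀ᵐ x, weight δ x * localNorm 1 σ φ x ≤ w) → ∀ ξ,
      profNorm f p (mulBy σ (translate ξ G)) ≤ w * (C * ∫⁻ z, ENNReal.ofReal ((1 + ‖z‖) ^ (-L)) *
        (weight (-δ) (ξ + z) * profNorm f p (translate (ξ + z) G))) := by
  -- The supports of `G` and `φ` may be disjoint, so `φ` is shifted to overlap `G`. Then `h = |ΦG|²`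
  -- has non-zero integral, and its factors play separate roles: `H` gives decay in `η - ξ`, `Φ`
  -- localizes `σ`, and `G` returns a profile of `f`.
  obtain ⟨y, t₀, ht₀⟩ := exists_mul_translate_ne_zero hG hφ
  set Φ := translate y φ with hΦ
  set H := conjS (mulBy Φ G) with hH
  have hh : ∫ t, mulBy H (mulBy Φ G) t ≠ 0 := by
    refine integral_conjS_mul_self_ne_zero ⟨t₀, ?_⟩
    rwa [mulBy_schwartz_apply, mul_comm]
  set c := ∫ t, mulBy H (mulBy Φ G) t with hc
  obtain ⟨A, hA⟩ := eLpNorm_fourier_mulBy_translate_le G H 1 L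
  -- Peetre's constant for undoing the shift by `y` in the weight.
  set D : ℝ≥0∞ := ENNReal.ofReal (2 ^ |(-δ)|) * ENNReal.ofReal (2 ^ |(-δ)|) *
    ENNReal.ofReal ((1 + ‖y‖) ^ |(-δ)|) with hD
  have hDt : D ≠ ∞ := by
    rw [hD]
    exact ENNReal.mul_ne_top (ENNReal.mul_ne_top ENNReal.ofReal_ne_top ENNReal.ofReal_ne_top)
      ENNReal.ofReal_ne_top
  set K : ℝ≥0∞ := ‖c⁻¹‖ₑ * (A * D) with hK
  have hKt : K ≠ ∞ := ENNReal.mul_ne_top enorm_ne_top (ENNReal.mul_ne_top (by simp) hDt)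
  refine ⟨K.toNNReal, fun f p hp σ hσ w hw ξ => ?_⟩
  rw [ENNReal.coe_toNNReal hKt]
  have hw' : ∀ᵐ η, weight δ (η + y) * localNorm 1 σ φ (η + y) ≤ w :=
    (measurePreserving_add_right volume y).quasiMeasurePreserving.ae hw
  have hw2 : ∀ᵐ η, localNorm 1 σ Φ η ≤ w * (D * weight (-δ) η) := by
    filter_upwards [hw'] with η hη
    have e : localNorm 1 σ Φ η = localNorm 1 σ φ (η + y) := by
      rw [localNorm, localNorm, hΦ, SchwartzMap.compSubConstCLM_comp, add_comm]
    rw [e]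
    refine (weight_neg_mul_le_of_le hη).trans (mul_le_mul' le_rfl ?_)
    have := weight_add_le (-δ) η y
    rw [add_comm y η] at this
    refine this.trans_eq ?_
    rw [hD]; ring
  have hbound : ∀ᵐ η, profNorm f p (mulBy σ (mulBy (translate ξ G)
      (translate η (mulBy H (mulBy Φ G))))) ≤
      (A * D) * w * (ENNReal.ofReal ((1 + ‖η - ξ‖) ^ (-L)) *
        (weight (-δ) η * profNorm f p (translate η G))) := by
    filter_upwards [hw2] with η hη
    have e : mulBy σ (mulBy (translate ξ G) (translate η (mulBy H (mulBy Φ G)))) =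
        mulBy (mulBy (translate ξ G) (translate η H))
          (mulBy (mulBy σ (translate η Φ)) (translate η G)) := by
      ext t
      simp only [translate_mulBy, mulBy_schwartz_apply, mulBy_apply hσ]
      ring
    rw [e]
    calc _ ≤ _ := profNorm_mulBy_mulBy_le f hp _ _ _
      _ ≤ (A * ENNReal.ofReal ((1 + ‖η - ξ‖) ^ (-L))) *
          ((w * (D * weight (-δ) η)) * profNorm f p (translate η G)) :=
        mul_le_mul' (hA ξ η) (mul_le_mul' hη le_rfl)
      _ = _ := by ring
  have hmeasN : Measurable fun η => profNorm f p (translate η G) :=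
    measurable_profNorm f p (ContinuousLinearMap.id ℂ _) G
  have hmeas : Measurable fun η : Eu d => ENNReal.ofReal ((1 + ‖η - ξ‖) ^ (-L)) *
        (weight (-δ) η * profNorm f p (translate η G)) :=
    ((measurable_one_add_norm_rpow (-L)).comp (measurable_id.sub_const ξ)).mul
      ((measurable_weight _).mul hmeasN)
  calc profNorm f p (mulBy σ (translate ξ G))
      ≤ ‖c⁻¹‖ₑ * ∫⁻ η, profNorm f p (mulBy σ (mulBy (translate ξ G)
          (translate η (mulBy H (mulBy Φ G))))) :=
        profNorm_le_lintegral f hp σ (translate ξ G) _ hh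
    _ ≤ ‖c⁻¹‖ₑ * ∫⁻ η, (A * D) * w * (ENNReal.ofReal ((1 + ‖η - ξ‖) ^ (-L)) *
        (weight (-δ) η * profNorm f p (translate η G))) := by
        gcongr 1
        exact lintegral_mono_ae hbound
    _ = w * (K * ∫⁻ η, ENNReal.ofReal ((1 + ‖η - ξ‖) ^ (-L)) *
        (weight (-δ) η * profNorm f p (translate η G))) := by
        rw [lintegral_const_mul _ hmeas, hK]; ring
    _ = _ := by
        congr 2
        rw [← lintegral_add_right_eq_self _ ξ]
        refine lintegral_congr fun z => ?_
        rw [add_sub_cancel_right, add_comm z ξ]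

/-- Pointwise estimate of a multiplier for a band-limited window. -/
theorem exists_profNorm_mulBy_le {G θ φ : 𝓢(Eu d, ℂ)} (hθ : ∀ t, θ t * G t = G t) (hφ : φ ≠ 0)
    (δ : ℝ) : ∃ C : ℝ≥0, ∀ (f : 𝓢'(Eu d, ℂ)) (p : ℝ≥0∞), 1 ≤ p →
      ∀ (σ : Eu d → ℂ), σ.HasTemperateGrowth → ∀ w : ℝ≥0∞,
      (∀ᵐ x, weight δ x * localNorm 1 σ φ x ≤ w) → ∀ ξ,
      profNorm f p (mulBy σ (translate ξ G)) ≤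
        w * (C * (weight (-δ) ξ * profNorm f p (translate ξ G))) := by
  have hφ' : ∃ t, φ t ≠ 0 := by
    by_contra! h
    exact hφ (SchwartzMap.ext h)
  set c := ∫ t, mulBy (conjS φ) φ t with hc
  have hc0 : c ≠ 0 := integral_conjS_mul_self_ne_zero hφ'
  -- The power `|δ|` pays for moving the weight from `η` to `ξ`, and `d + 1` for integrability in
  -- `η`.
  set L : ℝ := |(-δ)| + (d + 1) with hL
  obtain ⟨A, hA⟩ := eLpNorm_fourier_mulBy_translate_le θ (conjS φ) 1 L
  set D : ℝ≥0∞ := ENNReal.ofReal (2 ^ |(-δ)|) * ENNReal.ofReal (2 ^ |(-δ)|) with hD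
  have hDt : D ≠ ∞ := ENNReal.mul_ne_top ENNReal.ofReal_ne_top ENNReal.ofReal_ne_top
  set I : ℝ≥0∞ := ∫⁻ x : Eu d, ENNReal.ofReal ((1 + ‖x‖) ^ (-((d : ℝ) + 1))) with hI
  have hIt : I ≠ ∞ := (lintegral_one_add_norm_lt_top (by linarith)).ne
  set K : ℝ≥0∞ := ‖c⁻¹‖ₑ * (A * (D * I)) with hK
  have hKt : K ≠ ∞ := ENNReal.mul_ne_top enorm_ne_top
    (ENNReal.mul_ne_top (by simp) (ENNReal.mul_ne_top hDt hIt))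
  refine ⟨K.toNNReal, fun f p hp σ hσ w hw ξ => ?_⟩
  rw [ENNReal.coe_toNNReal hKt]
  set N := profNorm f p (translate ξ G) with hN
  have hbound : ∀ᵐ η, profNorm f p (mulBy σ (mulBy (translate ξ G)
      (translate η (mulBy (conjS φ) φ)))) ≤
      ENNReal.ofReal ((1 + ‖η - ξ‖) ^ (-((d : ℝ) + 1))) * (A * D * w * weight (-δ) ξ * N) := by
    filter_upwards [hw] with η hη
    -- Since `G = θ G`, the extra copy `T_ξ θ` provides the decay in `η - ξ` while `T_ξ G` is kept
    -- for the profile. The profile thus stays at `ξ`, with no averaging in frequency.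
    have e : mulBy σ (mulBy (translate ξ G) (translate η (mulBy (conjS φ) φ))) =
        mulBy (mulBy (translate ξ θ) (translate η (conjS φ)))
          (mulBy (mulBy σ (translate η φ)) (translate ξ G)) := by
      ext t
      simp only [translate_mulBy, mulBy_schwartz_apply, mulBy_apply hσ,
        SchwartzMap.compSubConstCLM_apply]
      conv_lhs => rw [← hθ]
      ring
    have hwt : weight (-δ) η ≤ D * (weight (-δ) ξ * ENNReal.ofReal ((1 + ‖η - ξ‖) ^ |(-δ)|)) := by
      have := weight_add_le (-δ) ξ (η - ξ)
      rwa [sub_add_cancel] at this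
    have hpow : ENNReal.ofReal ((1 + ‖η - ξ‖) ^ (-L)) * ENNReal.ofReal ((1 + ‖η - ξ‖) ^ |(-δ)|) =
        ENNReal.ofReal ((1 + ‖η - ξ‖) ^ (-((d : ℝ) + 1))) := by
      rw [← ENNReal.ofReal_mul (by positivity), ← Real.rpow_add (by positivity)]
      congr 2
      rw [hL]; ring
    rw [e]
    calc _ ≤ _ := profNorm_mulBy_mulBy_le f hp _ _ _
      _ ≤ (A * ENNReal.ofReal ((1 + ‖η - ξ‖) ^ (-L))) *
          ((w * (D * (weight (-δ) ξ * ENNReal.ofReal ((1 + ‖η - ξ‖) ^ |(-δ)|)))) * N) :=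
        mul_le_mul' (hA ξ η) (mul_le_mul' ((weight_neg_mul_le_of_le hη).trans
          (mul_le_mul' le_rfl hwt)) le_rfl)
      _ = (ENNReal.ofReal ((1 + ‖η - ξ‖) ^ (-L)) * ENNReal.ofReal ((1 + ‖η - ξ‖) ^ |(-δ)|)) *
          (A * D * w * weight (-δ) ξ * N) := by ring
      _ = _ := by rw [hpow]
  calc profNorm f p (mulBy σ (translate ξ G))
      ≤ ‖c⁻¹‖ₑ * ∫⁻ η, profNorm f p (mulBy σ (mulBy (translate ξ G)
          (translate η (mulBy (conjS φ) φ)))) :=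
        profNorm_le_lintegral f hp σ (translate ξ G) _ hc0
    _ ≤ ‖c⁻¹‖ₑ * ∫⁻ η, ENNReal.ofReal ((1 + ‖η - ξ‖) ^ (-((d : ℝ) + 1))) *
          (A * D * w * weight (-δ) ξ * N) := by
        gcongr 1
        exact lintegral_mono_ae hbound
    _ = ‖c⁻¹‖ₑ * (I * (A * D * w * weight (-δ) ξ * N)) := by
        have hm : Measurable fun η : Eu d => ENNReal.ofReal ((1 + ‖η - ξ‖) ^ (-((d : ℝ) + 1))) :=
          (measurable_one_add_norm_rpow _).comp (measurable_id.sub_const ξ)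
        rw [lintegral_mul_const _ hm, lintegral_sub_right_eq_self
            (fun x : Eu d => ENNReal.ofReal ((1 + ‖x‖) ^ (-((d : ℝ) + 1)))) ξ]
    _ = _ := by rw [hK]; ring

/-- The frequency convolution is bounded on weighted `L^q` for `q ≥ 1`. -/
theorem exists_eLpNorm_convolution_le {q : ℝ≥0∞} (hq : 1 ≤ q) (s t : ℝ) : ∃ (L : ℝ) (C : ℝ≥0),
    ∀ N : Eu d → ℝ≥0∞, Measurable N → eLpNorm (fun ξ => weight t ξ *
      ∫⁻ z, ENNReal.ofReal ((1 + ‖z‖) ^ (-L)) * (weight (s - t) (ξ + z) * N (ξ + z))) q volume ≤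
        C * eLpNorm (fun ξ => weight s ξ * N ξ) q volume := by
  -- Peetre's inequality moves `⟨ξ⟩^t` to `ξ + z` at the cost `|t|`, leaving an integrable kernel
  -- for Young's inequality.
  set L : ℝ := |t| + (d + 1) with hL
  set D : ℝ≥0∞ := ENNReal.ofReal (2 ^ |t|) * ENNReal.ofReal (2 ^ |t|) with hD
  have hDt : D ≠ ∞ := ENNReal.mul_ne_top ENNReal.ofReal_ne_top ENNReal.ofReal_ne_top
  set I : ℝ≥0∞ := ∫⁻ x : Eu d, ENNReal.ofReal ((1 + ‖x‖) ^ (-((d : ℝ) + 1))) with hI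
  have hIt : I ≠ ∞ := (lintegral_one_add_norm_lt_top (by linarith)).ne
  refine ⟨L, (D * I).toNNReal, fun N hN => ?_⟩
  rw [ENNReal.coe_toNNReal (ENNReal.mul_ne_top hDt hIt)]
  have hy := eLpNorm_lintegral_mul_comp_add_le hq (measurable_one_add_norm_rpow (-((d : ℝ) + 1)))
    (u := fun ξ : Eu d => weight s ξ * N ξ) ((measurable_weight s).mul hN)
  have hfin : D * eLpNorm (fun x => ∫⁻ y : Eu d, ENNReal.ofReal ((1 + ‖y‖) ^ (-((d : ℝ) + 1))) *
      (weight s (x + y) * N (x + y))) q volume ≤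
        D * I * eLpNorm (fun ξ => weight s ξ * N ξ) q volume := by
    rw [mul_assoc D I]
    exact mul_le_mul' le_rfl hy
  refine le_trans ?_ hfin
  rw [← eLpNorm_const_mul_ennreal hDt]
  refine eLpNorm_mono_ennreal (ae_of_all _ fun ξ => ?_)
  rw [← lintegral_const_mul' _ _ (weight_ne_top t ξ), ← lintegral_const_mul' _ _ hDt]
  refine lintegral_mono fun z => ?_
  have hwt : weight t ξ ≤ D * (weight t (ξ + z) * ENNReal.ofReal ((1 + ‖z‖) ^ |t|)) := by
    have := weight_add_le t (ξ + z) (-z)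
    rw [norm_neg] at this
    convert this using 2
    abel
  have hpow : ENNReal.ofReal ((1 + ‖z‖) ^ (-L)) * ENNReal.ofReal ((1 + ‖z‖) ^ |t|) =
      ENNReal.ofReal ((1 + ‖z‖) ^ (-((d : ℝ) + 1))) := by
    rw [← ENNReal.ofReal_mul (by positivity), ← Real.rpow_add (by positivity)]
    congr 2
    rw [hL]; ring
  have hw2 : weight t (ξ + z) * weight (s - t) (ξ + z) = weight s (ξ + z) := by
    rw [← weight_add]; congr 1; ring
  calc weight t ξ * (ENNReal.ofReal ((1 + ‖z‖) ^ (-L)) * (weight (s - t) (ξ + z) * N (ξ + z)))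
      ≤ (D * (weight t (ξ + z) * ENNReal.ofReal ((1 + ‖z‖) ^ |t|))) *
        (ENNReal.ofReal ((1 + ‖z‖) ^ (-L)) * (weight (s - t) (ξ + z) * N (ξ + z))) := by gcongr
    _ = D * ((ENNReal.ofReal ((1 + ‖z‖) ^ (-L)) * ENNReal.ofReal ((1 + ‖z‖) ^ |t|)) *
        ((weight t (ξ + z) * weight (s - t) (ξ + z)) * N (ξ + z))) := by ring
    _ = _ := by rw [hpow, hw2]

theorem conjS_ne_zero {g : 𝓢(Eu d, ℂ)} (hg : g ≠ 0) : conjS g ≠ 0 := by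
  intro h
  refine hg (SchwartzMap.ext fun t => ?_)
  have := DFunLike.congr_fun h t
  rw [conjS_apply] at this
  simpa using this

theorem win_ne_zero {g : 𝓢(Eu d, ℂ)} (hg : g ≠ 0) : win g ≠ 0 := by
  intro h
  have h1 := fourier_win g
  rw [h] at h1
  refine conjS_ne_zero hg ?_
  rw [← h1]
  exact map_zero (fourierCLM ℂ 𝓢(Eu d, ℂ))

/-- Transfers the support condition on `𝓕 g` to `win g`. -/
theorem win_apply (g : 𝓢(Eu d, ℂ)) (t : Eu d) : win g t = (starRingEnd ℂ) (𝓕 (g : Eu d → ℂ) t) := by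
  rw [win, SchwartzMap.fourierInv_coe, Real.fourierInv_eq, Real.fourier_eq, ← integral_conj]
  congr 1 with v
  rw [Circle.smul_def, Circle.smul_def, smul_eq_mul, smul_eq_mul, map_mul, conjS_apply,
    ← Circle.coe_inv_eq_conj, ← AddChar.map_neg_eq_inv, neg_neg]

/-- A smooth compactly supported function which is `1` on the closed ball of radius `R`. -/
theorem exists_cutoff {R : ℝ} (hR : 0 < R) : ∃ θ : 𝓢(Eu d, ℂ), (∀ t, ‖t‖ ≤ R → θ t = 1) ∧
    ∀ t, 2 * R ≤ ‖t‖ → θ t = 0 := by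
  let b : ContDiffBump (0 : Eu d) := ⟨R, 2 * R, hR, by linarith⟩
  have h1 : ContDiff ℝ ((⊤ : ℕ∞) : WithTop ℕ∞) fun t : Eu d => ((b t : ℝ) : ℂ) :=
    Complex.ofRealCLM.contDiff.comp b.contDiff
  have h2 : HasCompactSupport fun t : Eu d => ((b t : ℝ) : ℂ) :=
    b.hasCompactSupport.comp_left (g := fun r : ℝ => (r : ℂ)) Complex.ofReal_zero
  refine ⟨h2.toSchwartzMap h1, fun t ht => ?_, fun t ht => ?_⟩
  · change ((b t : ℝ) : ℂ) = 1
    rw [b.one_of_mem_closedBall (by simpa using ht)]; simp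
  · change ((b t : ℝ) : ℂ) = 0
    rw [b.zero_of_le_dist (by simpa using ht)]; simp

theorem IsWindow.exists_cutoff_mul {p q : ℝ≥0∞} {g : 𝓢(Eu d, ℂ)} (h : IsWindow p q g)
    (hpq : p < 1 ∨ q < 1) {θ : 𝓢(Eu d, ℂ)} (hθ : ∀ t, ‖t‖ ≤ 1 → θ t = 1) (t : Eu d) :
    θ t * win g t = win g t := by
  by_cases ht : ‖t‖ ≤ 1
  · rw [hθ t ht, one_mul]
  · have : 𝓕 (g : Eu d → ℂ) t = 0 := by
      by_contra h0
      exact ht (by simpa using (h.2 hpq).1 h0)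
    rw [win_apply, this]; simp

/-- The multiplier estimate for `p ≥ 1`, in a form that is stable under limits of symbols. -/
theorem exists_multiplier_bound {p q : ℝ≥0∞} (hp : 1 ≤ p) (s δ : ℝ) {g φ : 𝓢(Eu d, ℂ)}
    (hg : IsWindow p q g) (hφ : φ ≠ 0) : ∃ K : ℝ≥0, ∀ f : 𝓢'(Eu d, ℂ), ∃ B : Eu d → ℝ≥0∞,
      (∀ σ : Eu d → ℂ, σ.HasTemperateGrowth → ∀ w : ℝ≥0∞,
        (∀ᵐ x, weight δ x * localNorm 1 σ φ x ≤ w) → ∀ ξ,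
          profNorm f p (mulBy σ (translate ξ (win g))) ≤ w * B ξ) ∧
      eLpNorm (fun ξ => weight (s + δ) ξ * B ξ) q volume ≤ K * modNorm p q s g f := by
  -- The convolution argument relies on Young's inequality in `L^q`, which needs `q ≥ 1`. For `q <
  -- 1` the window is band-limited and the estimate is pointwise in `ξ`.
  rcases lt_or_ge q 1 with hq | hq
  · obtain ⟨θ, hθ, -⟩ := exists_cutoff (d := d) zero_lt_one
    obtain ⟨C, hC⟩ := exists_profNorm_mulBy_le (hg.exists_cutoff_mul (Or.inr hq) hθ) hφ δ
    refine ⟨C, fun f => ⟨_, fun σ hσ w hw ξ => hC f p hp σ hσ w hw ξ, ?_⟩⟩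
    rw [modNorm_eq, ← eLpNorm_const_mul_ennreal (by simp)]
    refine eLpNorm_mono_ennreal (ae_of_all _ fun ξ => le_of_eq ?_)
    rw [weight_add]
    calc _ = (weight δ ξ * weight (-δ) ξ) *
          (C * (weight s ξ * profNorm f p (translate ξ (win g)))) := by ring
      _ = _ := by rw [weight_mul_weight_neg, one_mul]
  · obtain ⟨L, D, hD⟩ := exists_eLpNorm_convolution_le (d := d) hq s (s + δ)
    obtain ⟨C, hC⟩ := exists_profNorm_mulBy_le_lintegral (win_ne_zero hg.1) hφ δ L
    refine ⟨C * D, fun f => ⟨_, fun σ hσ w hw ξ => hC f p hp σ hσ w hw ξ, ?_⟩⟩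
    have h1 := hD (fun ξ => profNorm f p (translate ξ (win g)))
      (measurable_profNorm f p (ContinuousLinearMap.id ℂ _) (win g))
    rw [modNorm_eq, ENNReal.coe_mul, mul_assoc]
    refine le_trans ?_ (mul_le_mul' le_rfl h1)
    rw [← eLpNorm_const_mul_ennreal (by simp)]
    refine eLpNorm_mono_ennreal (ae_of_all _ fun ξ => le_of_eq ?_)
    rw [show s - (s + δ) = -δ by ring]
    ring

end

section

open Filter Topology

variable {d : ℕ}

/-! ### Multiplier estimates for `p < 1` -/

/-- Write `u = u^{1-p} u^p`, bound the first factor by its supremum, hence by `(c ∫ u)^{1-p}`, and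
cancel `(∫ u)^{1-p}`. The cancellation needs the integral finite. -/
theorem rpow_lintegral_le_of_le_mul_lintegral {X : Type*} [MeasurableSpace X] {μ : Measure X}
    {u : X → ℝ≥0∞} {c : ℝ≥0∞} {p : ℝ} (hp0 : 0 < p) (hp1 : p ≤ 1)
    (hu : ∀ x, u x ≤ c * ∫⁻ z, u z ∂μ) (hc : c ≠ ∞) (hfin : ∫⁻ z, u z ∂μ ≠ ∞) :
    (∫⁻ z, u z ∂μ) ^ p ≤ c ^ (1 - p) * ∫⁻ z, u z ^ p ∂μ := by
  set I := ∫⁻ z, u z ∂μ with hI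
  rcases eq_or_ne I 0 with h0 | h0
  · rw [h0, ENNReal.zero_rpow_of_pos hp0]; exact zero_le
  have h1 : I ≤ (c * I) ^ (1 - p) * ∫⁻ z, u z ^ p ∂μ := by
    rw [← lintegral_const_mul' _ _ (ENNReal.rpow_ne_top_of_nonneg (by linarith)
      (ENNReal.mul_ne_top hc hfin))]
    refine lintegral_mono fun z => ?_
    calc u z = u z ^ (1 - p) * u z ^ p := by
          rw [← ENNReal.rpow_add_of_nonneg _ _ (by linarith) hp0.le]; simp
      _ ≤ _ := mul_le_mul' (ENNReal.rpow_le_rpow (hu z) (by linarith)) le_rfl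
  rw [ENNReal.mul_rpow_of_nonneg _ _ (by linarith)] at h1
  have h2 : I = I ^ (1 - p) * I ^ p := by
    rw [← ENNReal.rpow_add_of_nonneg _ _ (by linarith) hp0.le]; simp
  have h3 : I ^ (1 - p) * I ^ p ≤ I ^ (1 - p) * (c ^ (1 - p) * ∫⁻ z, u z ^ p ∂μ) := by
    rw [← h2]
    refine h1.trans_eq ?_
    ring
  refine (ENNReal.mul_le_mul_iff_right ?_ ?_).1 h3
  · simp only [ne_eq, ENNReal.rpow_eq_zero_iff, not_or, not_and_or]
    exact ⟨Or.inl h0, Or.inl hfin⟩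
  · exact ENNReal.rpow_ne_top_of_nonneg (by linarith) hfin

theorem fourier_mulBy_apply (a b : 𝓢(Eu d, ℂ)) (t : Eu d) :
    𝓕 (mulBy a b) t = ∫ z, 𝓕 a z * 𝓕 b (t - z) := by
  have := fourier_mulBy_fourierInv (𝓕 a) b t
  rwa [FourierTransform.fourierInv_fourier_eq] at this

theorem fourierInv_apply_neg (a : 𝓢(Eu d, ℂ)) (t : Eu d) : 𝓕⁻ a t = 𝓕 a (-t) := by
  rw [SchwartzMap.fourierInv_coe, Real.fourierInv_eq_fourier_neg]
  rfl

theorem fourier_fourier_apply (a : 𝓢(Eu d, ℂ)) (t : Eu d) : 𝓕 (𝓕 a) t = a (-t) := by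
  have := fourierInv_apply_neg (𝓕 a) (-t)
  rw [neg_neg, FourierTransform.fourierInv_fourier_eq] at this
  exact this.symm

/-- Band-limited products reproduce under convolution with a fixed Schwartz function. -/
theorem reproducing_fourier {θ a m : 𝓢(Eu d, ℂ)} {R : ℝ} {ξ : Eu d}
    (hθ : ∀ t, ‖t‖ ≤ 2 * R → θ t = 1) (ha : ∀ t, a t ≠ 0 → ‖t - ξ‖ ≤ R)
    (hm : ∀ t, m t ≠ 0 → ‖t - ξ‖ ≤ R) (z' : Eu d) :
    mulBy (𝓕⁻ (mulBy (translate z' (𝓕⁻ θ : 𝓢(Eu d, ℂ))) (𝓕 a)) : 𝓢(Eu d, ℂ)) m =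
      (𝓕 a z') • 𝓕⁻ (translate z' (𝓕 m)) := by
  ext ζ
  rw [mulBy_schwartz_apply, smul_apply, fourierInv_translate_apply,
    FourierTransform.fourierInv_fourier_eq, smul_eq_mul, ← mul_assoc]
  by_cases h0 : m ζ = 0
  · simp [h0]
  congr 1
  rw [fourierInv_apply_neg, fourier_mulBy_apply]
  have h1 : ∀ v, 𝓕 (translate z' (𝓕⁻ θ : 𝓢(Eu d, ℂ))) v * 𝓕 (𝓕 a) (-ζ - v) =
      (Real.fourierChar (inner ℝ z' ζ) : ℂ) *
        ((Real.fourierChar (-inner ℝ (v + ζ) z') : ℂ) * a (v + ζ)) := by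
    intro v
    rw [fourier_translate_apply, FourierTransform.fourier_fourierInv_eq, fourier_fourier_apply,
      show -(-ζ - v) = v + ζ by abel]
    by_cases ha0 : a (v + ζ) = 0
    · simp [ha0]
    -- Both `v + ζ` and `ζ` lie within `R` of `ξ`, so their difference lies in a ball that no longer
    -- depends on `ξ`.
    have hv : ‖v‖ ≤ 2 * R := by
      have h2 := ha _ ha0
      have h3 := hm _ h0
      have : ‖v‖ ≤ ‖v + ζ - ξ‖ + ‖ζ - ξ‖ := by
        have := norm_sub_le (v + ζ - ξ) (ζ - ξ)
        simpa using this
      linarith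
    rw [hθ v hv, mul_one, ← mul_assoc, ← Circle.coe_mul, ← AddChar.map_add_eq_mul]
    congr 3
    rw [inner_add_left, real_inner_comm z' v, real_inner_comm z' ζ]; ring
  simp only [h1]
  rw [integral_const_mul, integral_add_right_eq_self
    (fun v => (Real.fourierChar (-inner ℝ v z') : ℂ) * a v) ζ, mul_comm,
    SchwartzMap.fourier_coe, Real.fourier_eq]
  simp only [Circle.smul_def, smul_eq_mul]

/-- Convolution inequality for band-limited profiles in the quasi-Banach range. -/
theorem exists_profNorm_mulBy_le_of_le_one {p : ℝ≥0∞} (hp0 : 0 < p) (hp : p ≤ 1) {R : ℝ}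
    (hR : 0 < R) : ∃ C : ℝ≥0, ∀ (f : 𝓢'(Eu d, ℂ)) (ξ : Eu d) (a m : 𝓢(Eu d, ℂ)),
      (∀ t, a t ≠ 0 → ‖t - ξ‖ ≤ R) → (∀ t, m t ≠ 0 → ‖t - ξ‖ ≤ R) →
      profNorm f p (mulBy a m) ≤ C * eLpNorm (𝓕 a : 𝓢(Eu d, ℂ)) p volume * profNorm f p m := by
  obtain ⟨θ, hθ, -⟩ := exists_cutoff (d := d) (R := 2 * R) (by positivity)
  have hpt : p ≠ ∞ := (hp.trans_lt ENNReal.one_lt_top).ne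
  have hr0 : 0 < p.toReal := ENNReal.toReal_pos hp0.ne' hpt
  have hr1 : p.toReal ≤ 1 := by
    rw [← ENNReal.toReal_one]
    exact ENNReal.toReal_mono ENNReal.one_ne_top hp
  set c : ℝ≥0 := (SchwartzMap.seminorm ℂ 0 0 (𝓕⁻ θ : 𝓢(Eu d, ℂ))).toNNReal with hc
  have hcb : ∀ t, ‖(𝓕⁻ θ : 𝓢(Eu d, ℂ)) t‖ₑ ≤ c := fun t => by
    rw [← ofReal_norm]
    exact ENNReal.ofReal_le_ofReal (SchwartzMap.norm_le_seminorm ℂ _ t)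
  refine ⟨(c ^ (1 - p.toReal)) ^ (1 / p.toReal), fun f ξ a m ha hm => ?_⟩
  have hpt1 : ∀ x, ‖prof f (mulBy a m) x‖ₑ ^ p.toReal ≤ (c : ℝ≥0∞) ^ (1 - p.toReal) *
      ∫⁻ z, ‖(𝓕 a : 𝓢(Eu d, ℂ)) z‖ₑ ^ p.toReal * ‖prof f m (x + z)‖ₑ ^ p.toReal := by
    intro x
    set w : Eu d → ℂ := fun z => 𝓕 a z * prof f m (x + z) with hw
    have hwint : Integrable w := by
      have := (isIntegralOf_convolution (𝓕 a) m x).integrable (functional f)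
      simpa [functional_apply, prof, hw] using this
    -- The integrand `w` of the convolution has spectrum in the difference of two sets close to `ξ`,
    -- where `θ = 1`. Reproduction by `𝓕⁻¹θ` bounds its supremum by its `L¹` norm with a constant
    -- depending on `θ` only.
    have hrep : ∀ z', w z' = ∫ z, 𝓕⁻ θ (z - z') * w z := by
      intro z'
      have h1 := prof_convolution f (mulBy (translate z' (𝓕⁻ θ : 𝓢(Eu d, ℂ))) (𝓕 a)) m x
      rw [reproducing_fourier hθ ha hm] at h1
      have h2 : prof f ((𝓕 a z') • 𝓕⁻ (translate z' (𝓕 m))) x = w z' := by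
        have e : 𝓕 ((𝓕 a z') • 𝓕⁻ (translate z' (𝓕 m))) = (𝓕 a z') • translate z' (𝓕 m) := by
          rw [FourierTransform.fourier_smul, FourierTransform.fourier_fourierInv_eq]
        rw [prof, e, map_smul, map_smul, SchwartzMap.compSubConstCLM_comp, add_comm z' x,
          smul_eq_mul, hw]
        rfl
      rw [← h2, h1]
      congr 1 with z
      rw [mulBy_schwartz_apply, SchwartzMap.compSubConstCLM_apply, hw]
      ring
    have hu : ∀ z', ‖w z'‖ₑ ≤ c * ∫⁻ z, ‖w z‖ₑ := by
      intro z'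
      rw [hrep z', ← lintegral_const_mul' _ _ ENNReal.coe_ne_top]
      refine (enorm_integral_le_lintegral_enorm _).trans (lintegral_mono fun z => ?_)
      rw [enorm_mul]
      exact mul_le_mul' (hcb _) le_rfl
    have h3 := rpow_lintegral_le_of_le_mul_lintegral hr0 hr1 hu ENNReal.coe_ne_top hwint.2.ne
    calc ‖prof f (mulBy a m) x‖ₑ ^ p.toReal ≤ (∫⁻ z, ‖w z‖ₑ) ^ p.toReal := by
          gcongr
          rw [prof_mulBy]
          exact enorm_integral_le_lintegral_enorm _
      _ ≤ _ := h3
      _ = _ := by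
          simp only [hw, enorm_mul, ENNReal.mul_rpow_of_nonneg _ _ hr0.le]
  have hm1 : Measurable fun z => ‖(𝓕 a : 𝓢(Eu d, ℂ)) z‖ₑ ^ p.toReal :=
    (𝓕 a : 𝓢(Eu d, ℂ)).continuous.enorm.measurable.pow_const _
  have hm2 : Measurable fun z => ‖prof f m z‖ₑ ^ p.toReal :=
    (continuous_prof f m).enorm.measurable.pow_const _
  have hint : ∫⁻ x, ‖prof f (mulBy a m) x‖ₑ ^ p.toReal ≤ (c : ℝ≥0∞) ^ (1 - p.toReal) *
      ((∫⁻ z, ‖(𝓕 a : 𝓢(Eu d, ℂ)) z‖ₑ ^ p.toReal) * ∫⁻ x, ‖prof f m x‖ₑ ^ p.toReal) := by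
    refine (lintegral_mono hpt1).trans ?_
    rw [lintegral_const_mul' _ _ (ENNReal.rpow_ne_top_of_nonneg (by linarith) ENNReal.coe_ne_top)]
    refine mul_le_mul' le_rfl ?_
    rw [lintegral_lintegral_swap ((hm1.comp measurable_snd).mul
      (hm2.comp (measurable_fst.add measurable_snd))).aemeasurable, ← lintegral_mul_const _ hm1]
    refine lintegral_mono fun z => ?_
    have hm3 : Measurable fun x => ‖prof f m (x + z)‖ₑ ^ p.toReal :=
      hm2.comp (measurable_add_const z)
    rw [lintegral_const_mul _ hm3, lintegral_add_right_eq_self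
      (fun x => ‖prof f m x‖ₑ ^ p.toReal) z]
  rw [profNorm, profNorm, eLpNorm_eq_lintegral_rpow_enorm_toReal hp0.ne' hpt,
    eLpNorm_eq_lintegral_rpow_enorm_toReal hp0.ne' hpt,
    eLpNorm_eq_lintegral_rpow_enorm_toReal hp0.ne' hpt]
  have hinv : 0 ≤ 1 / p.toReal := by positivity
  refine (ENNReal.rpow_le_rpow hint hinv).trans_eq ?_
  rw [ENNReal.mul_rpow_of_nonneg _ _ hinv, ENNReal.mul_rpow_of_nonneg _ _ hinv, ← mul_assoc,
    ENNReal.coe_rpow_of_nonneg _ hinv, ENNReal.coe_rpow_of_nonneg _ (by linarith)]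

/-- Multipliers with smooth symbols are bounded between modulation spaces. -/
theorem HasSymbolBound.exists_modNorm_le {δ : ℝ} {σ : Eu d → ℂ} (hσ : HasSymbolBound δ σ)
    {p q : ℝ≥0∞} (hp0 : 0 < p) (s : ℝ) {g : 𝓢(Eu d, ℂ)} (hg : IsWindow p q g) :
    ∃ K : ℝ≥0, ∀ f : 𝓢'(Eu d, ℂ), modNorm p q (s + δ) g
      (TemperedDistribution.fourierMultiplierCLM ℂ σ f) ≤ K * modNorm p q s g f := by
  have hT := hσ.hasTemperateGrowth
  obtain ⟨θ, hθ, hθ'⟩ := exists_cutoff (d := d) zero_lt_one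
  have hwt : ∀ x : Eu d, weight δ x * ENNReal.ofReal ((1 + ‖x‖) ^ (-δ)) ≤
      ENNReal.ofReal (2 ^ |δ|) := by
    intro x
    have := le_weight (-δ) x
    rw [abs_neg] at this
    calc weight δ x * ENNReal.ofReal ((1 + ‖x‖) ^ (-δ)) ≤
          weight δ x * (ENNReal.ofReal (2 ^ |δ|) * weight (-δ) x) := by gcongr
      _ = ENNReal.ofReal (2 ^ |δ|) * (weight δ x * weight (-δ) x) := by ring
      _ = _ := by rw [weight_mul_weight_neg, mul_one]
  have hlocal : ∀ (r : ℝ≥0∞) (φ : 𝓢(Eu d, ℂ)), ∃ w : ℝ≥0, ∀ x,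
      weight δ x * localNorm r σ φ x ≤ w := by
    intro r φ
    obtain ⟨C, hC⟩ := hσ.eLpNorm_fourier_le φ r
    refine ⟨C * (2 ^ |δ| : ℝ).toNNReal, fun x => ?_⟩
    calc weight δ x * localNorm r σ φ x ≤
          weight δ x * (C * ENNReal.ofReal ((1 + ‖x‖) ^ (-δ))) := by
            gcongr; exact hC x
      _ = C * (weight δ x * ENNReal.ofReal ((1 + ‖x‖) ^ (-δ))) := by ring
      _ ≤ C * ENNReal.ofReal (2 ^ |δ|) := by gcongr; exact hwt x
      _ = _ := by rw [ENNReal.coe_mul]; rfl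
  rcases lt_or_ge p 1 with hp | hp
  -- Radius two because `θ`, equal to one on the unit ball, vanishes only outside the ball of radius
  -- two.
  · obtain ⟨C, hC⟩ := exists_profNorm_mulBy_le_of_le_one (d := d) hp0 hp.le zero_lt_two
    obtain ⟨w, hw⟩ := hlocal p θ
    refine ⟨C * w, fun f => ?_⟩
    rw [modNorm_eq, modNorm_eq, ← eLpNorm_const_mul_ennreal ENNReal.coe_ne_top]
    refine eLpNorm_mono_ennreal (ae_of_all _ fun ξ => ?_)
    have hN : profNorm (TemperedDistribution.fourierMultiplierCLM ℂ σ f) p (translate ξ (win g)) ≤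
        C * localNorm p σ θ ξ * profNorm f p (translate ξ (win g)) := by
      have e : mulBy σ (translate ξ (win g)) =
          mulBy (mulBy σ (translate ξ θ)) (translate ξ (win g)) := by
        ext t
        rw [mulBy_apply hT, mulBy_schwartz_apply, mulBy_apply hT,
          SchwartzMap.compSubConstCLM_apply, SchwartzMap.compSubConstCLM_apply, mul_assoc,
          hg.exists_cutoff_mul (Or.inl hp) hθ]
      rw [profNorm, prof_fourierMultiplier hT, e]
      refine hC f ξ _ _ (fun t ht => ?_) (fun t ht => ?_)
      · by_contra! h
        refine ht ?_
        rw [mulBy_apply hT, SchwartzMap.compSubConstCLM_apply, hθ' _ (by linarith), mul_zero]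
      · by_contra! h
        refine ht ?_
        rw [SchwartzMap.compSubConstCLM_apply, ← hg.exists_cutoff_mul (Or.inl hp) hθ,
          hθ' _ (by linarith), zero_mul]
    rw [weight_add]
    calc _ ≤ weight s ξ * weight δ ξ *
          (C * localNorm p σ θ ξ * profNorm f p (translate ξ (win g))) := by gcongr
      _ = (C * (weight δ ξ * localNorm p σ θ ξ)) *
          (weight s ξ * profNorm f p (translate ξ (win g))) := by ring
      _ ≤ _ := by
        rw [ENNReal.coe_mul]
        gcongr
        exact hw ξ
  -- Any non-zero localizing window serves here; `g` itself is taken.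
  · obtain ⟨K, hK⟩ := exists_multiplier_bound (q := q) hp s δ hg hg.1
    obtain ⟨w, hw⟩ := hlocal 1 g
    refine ⟨w * K, fun f => ?_⟩
    obtain ⟨B, hB, hB'⟩ := hK f
    rw [modNorm_eq, ENNReal.coe_mul, mul_assoc]
    refine le_trans ?_ (mul_le_mul' le_rfl hB')
    rw [← eLpNorm_const_mul_ennreal ENNReal.coe_ne_top]
    refine eLpNorm_mono_ennreal (ae_of_all _ fun ξ => ?_)
    have := hB σ hT w (ae_of_all _ hw) ξ
    rw [profNorm, prof_fourierMultiplier hT]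
    calc _ ≤ weight (s + δ) ξ * (w * B ξ) := by gcongr; exact this
      _ = _ := by ring

/-! ### Wiener amalgam norms -/

theorem wienerNorm_congr {σ τ : Eu d → ℂ} (h : σ =ᵐ[volume] τ) (r : ℝ≥0∞) (γ : ℝ)
    (φ : 𝓢(Eu d, ℂ)) : wienerNorm r ∞ γ φ σ = wienerNorm r ∞ γ φ τ := by
  have e : ∀ x, 𝓕 (fun ξ : Eu d => σ ξ * φ (ξ - x)) = 𝓕 (fun ξ : Eu d => τ ξ * φ (ξ - x)) := by
    intro x
    ext ζ
    rw [Real.fourier_eq, Real.fourier_eq]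
    refine integral_congr_ae ?_
    filter_upwards [h] with ξ hξ
    rw [hξ]
  simp only [wienerNorm, e]

theorem fourier_mul_translate {σ : Eu d → ℂ} (hσ : σ.HasTemperateGrowth) (φ : 𝓢(Eu d, ℂ))
    (x : Eu d) : 𝓕 (fun ξ : Eu d => σ ξ * φ (ξ - x)) =
      (𝓕 (mulBy σ (translate x φ)) : 𝓢(Eu d, ℂ)) := by
  rw [SchwartzMap.fourier_coe]
  congr 1
  ext ξ
  rw [mulBy_apply hσ, SchwartzMap.compSubConstCLM_apply]

theorem wienerNorm_eq {σ : Eu d → ℂ} (hσ : σ.HasTemperateGrowth) (r : ℝ≥0∞) (γ : ℝ)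
    (φ : 𝓢(Eu d, ℂ)) :
    wienerNorm r ∞ γ φ σ = essSup (fun x => weight γ x * localNorm r σ φ x) volume := by
  simp only [wienerNorm, fourier_mul_translate hσ, eLpNorm_exponent_top, eLpNormEssSup,
    enorm_eq_self, localNorm]

theorem HasSymbolBound.wienerNorm_lt_top {δ : ℝ} {σ : Eu d → ℂ} (hσ : HasSymbolBound δ σ)
    (r : ℝ≥0∞) (φ : 𝓢(Eu d, ℂ)) : wienerNorm r ∞ δ φ σ < ∞ := by
  rw [wienerNorm_eq hσ.hasTemperateGrowth]
  obtain ⟨C, hC⟩ := hσ.eLpNorm_fourier_le φ r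
  refine lt_of_le_of_lt (essSup_le_of_ae_le (C * ENNReal.ofReal (2 ^ |δ|))
    (ae_of_all _ fun x => ?_)) (ENNReal.mul_lt_top ENNReal.coe_lt_top ENNReal.ofReal_lt_top)
  have := le_weight (-δ) x
  rw [abs_neg] at this
  calc weight δ x * localNorm r σ φ x ≤
        weight δ x * (C * (ENNReal.ofReal (2 ^ |δ|) * weight (-δ) x)) := by
          gcongr; exact (hC x).trans (by gcongr)
    _ = C * ENNReal.ofReal (2 ^ |δ|) * (weight δ x * weight (-δ) x) := by ring
    _ = _ := by rw [weight_mul_weight_neg, mul_one]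

/-- If the norm vanishes, Fourier inversion makes `σ T_x φ` vanish for almost every `x`; at a point
`ξ₀` where `σ` is non-zero this forces `φ(ξ₀ - x) = 0` for almost every, hence every, `x`. -/
theorem wienerNorm_ne_zero {σ : Eu d → ℂ} (hσ : σ.HasTemperateGrowth) (h0 : ∃ ξ, σ ξ ≠ 0)
    {r : ℝ≥0∞} (hr : r ≠ 0) (γ : ℝ) {φ : 𝓢(Eu d, ℂ)} (hφ : φ ≠ 0) :
    wienerNorm r ∞ γ φ σ ≠ 0 := by
  obtain ⟨ξ₀, hξ₀⟩ := h0
  intro h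
  rw [wienerNorm_eq hσ, ENNReal.essSup_eq_zero_iff] at h
  refine hφ (SchwartzMap.ext fun t => ?_)
  have h1 : (fun x => φ (ξ₀ - x)) =ᵐ[volume] fun _ => 0 := by
    filter_upwards [h] with x hx
    have h2 : localNorm r σ φ x = 0 := by
      simpa [(weight_pos γ x).ne'] using hx
    rw [localNorm, eLpNorm_eq_zero_iff
      (𝓕 (mulBy σ (translate x φ)) : 𝓢(Eu d, ℂ)).continuous.aestronglyMeasurable hr] at h2
    have h3 : ((𝓕 (mulBy σ (translate x φ)) : 𝓢(Eu d, ℂ)) : Eu d → ℂ) = fun _ => 0 :=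
      (Continuous.ae_eq_iff_eq volume (𝓕 (mulBy σ (translate x φ)) : 𝓢(Eu d, ℂ)).continuous
        continuous_const).1 h2
    have h4 : (𝓕 (mulBy σ (translate x φ)) : 𝓢(Eu d, ℂ)) = 0 :=
      SchwartzMap.ext fun ζ => congrFun h3 ζ
    have h5 : mulBy σ (translate x φ) = 0 := by
      have h6 : 𝓕⁻ (𝓕 (mulBy σ (translate x φ)) : 𝓢(Eu d, ℂ)) = mulBy σ (translate x φ) := by simp
      rw [← h6, h4]
      exact map_zero (fourierInvCLM ℂ 𝓢(Eu d, ℂ))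
    have h6 := DFunLike.congr_fun h5 ξ₀
    rw [mulBy_apply hσ, SchwartzMap.compSubConstCLM_apply] at h6
    exact (mul_eq_zero.1 h6).resolve_left hξ₀
  have h2 := (Continuous.ae_eq_iff_eq (volume : Measure (Eu d))
    (φ.continuous.comp (continuous_const.sub continuous_id)) continuous_const).1 h1
  have := congrFun h2 (ξ₀ - t)
  simpa using this

end

/-! ### Bounded extensions for smooth symbols -/

section

open Filter Topology

variable {d : ℕ}

theorem multiplier_congr {σ τ : Eu d → ℂ} (h : σ =ᵐ[volume] τ) (φ : 𝓢(Eu d, ℂ)) :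
    multiplier σ φ = multiplier τ φ := by
  ext x
  rw [multiplier, multiplier, Real.fourierInv_eq, Real.fourierInv_eq]
  refine integral_congr_ae ?_
  filter_upwards [h] with ξ hξ
  rw [hξ]

theorem multiplier_eq {σ : Eu d → ℂ} (hσ : σ.HasTemperateGrowth) (φ : 𝓢(Eu d, ℂ)) :
    multiplier σ φ = (SchwartzMap.fourierMultiplierCLM ℂ σ φ : 𝓢(Eu d, ℂ)) := by
  rw [SchwartzMap.fourierMultiplierCLM_apply, SchwartzMap.fourierInv_coe, multiplier]
  congr 1
  ext ξ
  rw [mulBy_apply hσ, SchwartzMap.fourier_coe]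

theorem ofSchwartz_apply (φ ψ : 𝓢(Eu d, ℂ)) : ofSchwartz φ ψ = ∫ x, φ x * ψ x := by
  refine (SchwartzMap.toTemperedDistributionCLM_apply_apply volume φ ψ).trans ?_
  simp only [smul_eq_mul, mul_comm]

theorem fourierMultiplier_ofSchwartz {σ : Eu d → ℂ} (hσ : σ.HasTemperateGrowth) (φ : 𝓢(Eu d, ℂ)) :
    TemperedDistribution.fourierMultiplierCLM ℂ σ (ofSchwartz φ) =
      ofSchwartz (SchwartzMap.fourierMultiplierCLM ℂ σ φ) :=
  TemperedDistribution.fourierMultiplierCLM_toTemperedDistributionCLM_eq hσ φ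

/-- A bounded operator that preserves the Schwartz class preserves its closure. The divisor `K + 1`
avoids dividing by zero. -/
theorem modNorm_lt_of_le {p q : ℝ≥0∞} {s t : ℝ} {g : 𝓢(Eu d, ℂ)} {K : ℝ≥0}
    {T : 𝓢'(Eu d, ℂ) →L[ℂ] 𝓢'(Eu d, ℂ)} {U : 𝓢(Eu d, ℂ) → 𝓢(Eu d, ℂ)}
    (hT : ∀ f, modNorm p q t g (T f) ≤ K * modNorm p q s g f)
    (hU : ∀ φ, T (ofSchwartz φ) = ofSchwartz (U φ)) {f : 𝓢'(Eu d, ℂ)}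
    (hf : f ∈ modSpace p q s g) : T f ∈ modSpace p q t g := by
  intro ε hε
  obtain ⟨φ, hφ⟩ := hf (ε / (K + 1)) (ENNReal.div_pos hε.ne' (by simp))
  refine ⟨U φ, ?_⟩
  rw [← hU, ← map_sub]
  have h1 : modNorm p q s g (f - ofSchwartz φ) * (K + 1) < ε :=
    (ENNReal.lt_div_iff_mul_lt (Or.inl (by simp)) (Or.inl (by simp))).1 hφ
  refine lt_of_le_of_lt ((hT _).trans ?_) h1
  rw [mul_comm]
  gcongr
  exact le_self_add

/-- Multipliers agreeing almost everywhere with a smooth symbol. -/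
theorem HasSymbolBound.exists_isBoundedExtension {δ : ℝ} {σ τ : Eu d → ℂ} (hτ : HasSymbolBound δ τ)
    (h : σ =ᵐ[volume] τ) (hne : ∃ ξ, τ ξ ≠ 0) {p q r : ℝ≥0∞} (hp : 0 < p) (hr : r ≠ 0) (s : ℝ)
    {g φ : 𝓢(Eu d, ℂ)} (hg : IsWindow p q g) (hφ : φ ≠ 0) :
    ∃ C : ℝ≥0, wienerNorm r ∞ δ φ σ < ∞ ∧ ∃ T : 𝓢'(Eu d, ℂ) → 𝓢'(Eu d, ℂ),
      IsBoundedExtension σ p q s (s + δ) g (C * wienerNorm r ∞ δ φ σ) T := by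
  have hT := hτ.hasTemperateGrowth
  rw [wienerNorm_congr h]
  have hW := hτ.wienerNorm_lt_top r φ
  have hW0 := wienerNorm_ne_zero hT hne hr δ hφ
  obtain ⟨K, hK⟩ := hτ.exists_modNorm_le (q := q) hp s hg
  -- The symbol is fixed here, so the constant may depend on it: the amalgam norm, finite and
  -- non-zero, is divided out of the operator bound.
  have hC : ((K / wienerNorm r ∞ δ φ τ).toNNReal : ℝ≥0∞) * wienerNorm r ∞ δ φ τ = K := by
    rw [ENNReal.coe_toNNReal (ENNReal.div_lt_top (by simp) hW0).ne,
      ENNReal.div_mul_cancel hW0 hW.ne]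
  refine ⟨(K / wienerNorm r ∞ δ φ τ).toNNReal, hW,
    TemperedDistribution.fourierMultiplierCLM ℂ τ, ?_⟩
  rw [hC]
  exact
    { maps_to := fun f hf => modNorm_lt_of_le hK (fourierMultiplier_ofSchwartz hT) hf
      map_add := fun f₁ _ f₂ _ => map_add _ _ _
      map_smul := fun c f _ => map_smul _ _ _
      integrable := fun φ => by
        refine (mulBy τ (𝓕 φ) : 𝓢(Eu d, ℂ)).integrable.congr ?_
        filter_upwards [h] with ξ hξ
        rw [mulBy_apply hT, hξ, SchwartzMap.fourier_coe]
      extends_multiplier := fun φ ψ => by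
        rw [fourierMultiplier_ofSchwartz hT, ofSchwartz_apply, multiplier_congr h, multiplier_eq hT]
      bound := fun f _ => hK f }

end

/-! ### Perturbations of smooth symbols that are small in `𝓕L¹` -/

section

open Filter Topology

variable {d : ℕ}

theorem enorm_le_eLpNorm_fourier (b : 𝓢(Eu d, ℂ)) (t : Eu d) :
    ‖b t‖ₑ ≤ eLpNorm (𝓕 b : 𝓢(Eu d, ℂ)) 1 := by
  have h : b t = ∫ z, (Real.fourierChar (inner ℝ z t) : ℂ) * (𝓕 b : 𝓢(Eu d, ℂ)) z := by
    have h1 : 𝓕⁻ (𝓕 b : 𝓢(Eu d, ℂ)) t = b t := by simp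
    rw [← h1, SchwartzMap.fourierInv_coe, Real.fourierInv_eq]
    rfl
  rw [h, eLpNorm_one_eq_lintegral_enorm]
  refine (enorm_integral_le_lintegral_enorm _).trans (lintegral_mono fun z => le_of_eq ?_)
  rw [enorm_mul, ← ofReal_norm (Real.fourierChar _ : ℂ), Circle.norm_coe]
  simp

theorem eLpNorm_fourier_lt_top (b : 𝓢(Eu d, ℂ)) : eLpNorm (𝓕 b : 𝓢(Eu d, ℂ)) 1 volume < ∞ :=
  ((𝓕 b : 𝓢(Eu d, ℂ)).memLp 1 volume).eLpNorm_lt_top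

theorem norm_le_toReal_eLpNorm_fourier (b : 𝓢(Eu d, ℂ)) (t : Eu d) :
    ‖b t‖ ≤ (eLpNorm (𝓕 b : 𝓢(Eu d, ℂ)) 1 volume).toReal := by
  have := ENNReal.toReal_mono (eLpNorm_fourier_lt_top b).ne (enorm_le_eLpNorm_fourier b t)
  simpa using this

/-- `𝓕L¹` is an algebra under multiplication, because `L¹` is one under convolution. -/
theorem eLpNorm_fourier_mulBy_le (a b : 𝓢(Eu d, ℂ)) :
    eLpNorm (𝓕 (mulBy a b) : 𝓢(Eu d, ℂ)) 1 ≤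
      eLpNorm (𝓕 a : 𝓢(Eu d, ℂ)) 1 * eLpNorm (𝓕 b : 𝓢(Eu d, ℂ)) 1 := by
  simp only [eLpNorm_one_eq_lintegral_enorm]
  have ha : Measurable fun z => ‖(𝓕 a : 𝓢(Eu d, ℂ)) z‖ₑ :=
    (𝓕 a : 𝓢(Eu d, ℂ)).continuous.enorm.measurable
  have hb : Measurable fun z => ‖(𝓕 b : 𝓢(Eu d, ℂ)) z‖ₑ :=
    (𝓕 b : 𝓢(Eu d, ℂ)).continuous.enorm.measurable
  calc ∫⁻ t, ‖𝓕 (mulBy a b) t‖ₑ ≤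
        ∫⁻ t, ∫⁻ z, ‖(𝓕 a : 𝓢(Eu d, ℂ)) z‖ₑ * ‖(𝓕 b : 𝓢(Eu d, ℂ)) (t - z)‖ₑ := by
        refine lintegral_mono fun t => ?_
        rw [fourier_mulBy_apply]
        refine (enorm_integral_le_lintegral_enorm _).trans (lintegral_mono fun z => ?_)
        rw [enorm_mul]
    _ = ∫⁻ z, ∫⁻ t, ‖(𝓕 a : 𝓢(Eu d, ℂ)) z‖ₑ * ‖(𝓕 b : 𝓢(Eu d, ℂ)) (t - z)‖ₑ := by
        refine lintegral_lintegral_swap (Measurable.aemeasurable ?_)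
        exact (ha.comp measurable_snd).mul (hb.comp (measurable_fst.sub measurable_snd))
    _ = _ := by
        rw [← lintegral_mul_const _ ha]
        refine lintegral_congr fun z => ?_
        have hm : Measurable fun t => ‖(𝓕 b : 𝓢(Eu d, ℂ)) (t - z)‖ₑ :=
          hb.comp (measurable_id.sub_const z)
        rw [lintegral_const_mul _ hm,
          lintegral_sub_right_eq_self (fun t => ‖(𝓕 b : 𝓢(Eu d, ℂ)) t‖ₑ)]

/-- A symbol that differs from a smooth one by an absolutely convergent series (in `𝓕 L^1`) of
Schwartz functions supported in a fixed ball. -/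
structure IsLocalPerturbation (δ R : ℝ) (σ₀ : Eu d → ℂ) (b : ℕ → 𝓢(Eu d, ℂ)) (σ : Eu d → ℂ) :
    Prop where
  symbol : HasSymbolBound δ σ₀
  support : ∀ j t, R ≤ ‖t‖ → b j t = 0
  tsum_ne_top : ∑' j, eLpNorm (𝓕 (b j) : 𝓢(Eu d, ℂ)) 1 ≠ ∞
  hasSum : ∀ᵐ ξ, HasSum (fun j => b j ξ) (σ ξ - σ₀ ξ)

/-- The partial sums of a perturbed symbol. -/
def partialSymbol (σ₀ : Eu d → ℂ) (b : ℕ → 𝓢(Eu d, ℂ)) (J : ℕ) (ξ : Eu d) : ℂ :=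
  σ₀ ξ + ∑ j ∈ Finset.range J, b j ξ

theorem HasSymbolBound.add {δ : ℝ} {σ τ : Eu d → ℂ} (hσ : HasSymbolBound δ σ)
    (hτ : HasSymbolBound δ τ) : HasSymbolBound δ (fun ξ => σ ξ + τ ξ) := by
  refine ⟨hσ.smooth.add hτ.smooth, fun n => ?_⟩
  obtain ⟨C, hC⟩ := hσ.bound n
  obtain ⟨D, hD⟩ := hτ.bound n
  refine ⟨C + D, fun ξ => ?_⟩
  have e : iteratedFDeriv ℝ n (fun ξ => σ ξ + τ ξ) ξ =
      iteratedFDeriv ℝ n σ ξ + iteratedFDeriv ℝ n τ ξ :=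
    iteratedFDeriv_add_apply (hσ.smooth.contDiffAt.of_le (mod_cast le_top))
      (hτ.smooth.contDiffAt.of_le (mod_cast le_top))
  rw [e, add_mul]
  exact (norm_add_le _ _).trans (add_le_add (hC ξ) (hD ξ))

namespace IsLocalPerturbation

variable {δ R : ℝ} {σ₀ σ : Eu d → ℂ} {b : ℕ → 𝓢(Eu d, ℂ)}

theorem hasSymbolBound_partialSymbol (h : IsLocalPerturbation δ R σ₀ b σ) (J : ℕ) :
    HasSymbolBound δ (partialSymbol σ₀ b J) := by
  have e : partialSymbol σ₀ b J = fun ξ => σ₀ ξ + (∑ j ∈ Finset.range J, b j) ξ := by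
    ext ξ; simp [partialSymbol]
  rw [e]
  exact h.symbol.add (hasSymbolBound_schwartz δ _)

theorem summable_toReal (h : IsLocalPerturbation δ R σ₀ b σ) :
    Summable fun j => (eLpNorm (𝓕 (b j) : 𝓢(Eu d, ℂ)) 1).toReal :=
  ENNReal.summable_toReal h.tsum_ne_top

/-- The same `σ` is a perturbation of smoother and smoother approximations with ever smaller
remainder; this later removes the error terms from the bound. -/
theorem tail (h : IsLocalPerturbation δ R σ₀ b σ) (J : ℕ) :
    IsLocalPerturbation δ R (partialSymbol σ₀ b J) (fun j => b (j + J)) σ where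
  symbol := h.hasSymbolBound_partialSymbol J
  support j := h.support (j + J)
  tsum_ne_top := by
    have := ENNReal.tsum_comp_le_tsum_of_injective (add_left_injective J)
      fun j => eLpNorm (𝓕 (b j) : 𝓢(Eu d, ℂ)) 1
    exact ne_top_of_le_ne_top h.tsum_ne_top this
  hasSum := by
    filter_upwards [h.hasSum] with ξ hξ
    have := (hasSum_nat_add_iff' J).2 hξ
    rwa [sub_sub] at this

theorem hasSum_integral (h : IsLocalPerturbation δ R σ₀ b σ) {u : Eu d → ℂ} (hu : Integrable u) :
    HasSum (fun j => ∫ ξ, b j ξ * u ξ) (∫ ξ, (σ ξ - σ₀ ξ) * u ξ) := by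
  have hb : ∀ j, ∀ᵐ ξ, ‖b j ξ * u ξ‖ ≤ (eLpNorm (𝓕 (b j) : 𝓢(Eu d, ℂ)) 1).toReal * ‖u ξ‖ := by
    intro j
    refine ae_of_all _ fun ξ => ?_
    rw [norm_mul]
    exact mul_le_mul_of_nonneg_right (norm_le_toReal_eLpNorm_fourier (b j) ξ) (norm_nonneg _)
  have hs := h.summable_toReal
  set c : ℕ → ℝ := fun j => (eLpNorm (𝓕 (b j) : 𝓢(Eu d, ℂ)) 1).toReal
  have hm : ∀ j, AEStronglyMeasurable (fun ξ => b j ξ * u ξ) volume := fun j =>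
    (b j).continuous.aestronglyMeasurable.mul hu.1
  have hsum : ∀ᵐ ξ, HasSum (fun j => b j ξ * u ξ) ((σ ξ - σ₀ ξ) * u ξ) := by
    filter_upwards [h.hasSum] with ξ hξ
    exact hξ.mul_right (u ξ)
  have hi : Integrable fun ξ => ∑' j, c j * ‖u ξ‖ := by
    simp only [tsum_mul_right]
    exact hu.norm.const_mul _
  exact hasSum_integral_of_dominated_convergence (fun j ξ => c j * ‖u ξ‖) hm hb
    (ae_of_all _ fun ξ => hs.mul_right _) hi hsum

theorem integrable_mul (h : IsLocalPerturbation δ R σ₀ b σ) {u : Eu d → ℂ} (hu : Integrable u) :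
    Integrable fun ξ => (σ ξ - σ₀ ξ) * u ξ := by
  have hm : AEStronglyMeasurable (fun ξ => σ ξ - σ₀ ξ) (volume : Measure (Eu d)) := by
    refine aestronglyMeasurable_of_tendsto_ae atTop
      (f := fun (J : ℕ) ξ => ∑ j ∈ Finset.range J, b j ξ)
      (fun J => (continuous_finsetSum _ fun j _ => (b j).continuous).aestronglyMeasurable) ?_
    filter_upwards [h.hasSum] with ξ hξ
    exact hξ.tendsto_sum_nat
  refine hu.bdd_mul hm (c := ∑' j, (eLpNorm (𝓕 (b j) : 𝓢(Eu d, ℂ)) 1).toReal) ?_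
  filter_upwards [h.hasSum] with ξ hξ
  rw [← hξ.tsum_eq]
  exact tsum_of_norm_bounded h.summable_toReal.hasSum fun j => norm_le_toReal_eLpNorm_fourier (b j) ξ

theorem hasSum_fourier (h : IsLocalPerturbation δ R σ₀ b σ) (ψ : 𝓢(Eu d, ℂ)) (ζ : Eu d) :
    HasSum (fun j => 𝓕 (mulBy (b j) ψ) ζ) (𝓕 (fun ξ => σ ξ * ψ ξ) ζ - 𝓕 (mulBy σ₀ ψ) ζ) := by
  have hu : Integrable fun ξ : Eu d => (Real.fourierChar (-inner ℝ ξ ζ) : ℂ) * ψ ξ := by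
    refine ψ.integrable.bdd_mul (c := 1) ?_ (ae_of_all _ fun ξ => (Circle.norm_coe _).le)
    exact (hasTemperateGrowth_char ζ).1.continuous.aestronglyMeasurable
  have h1 := h.hasSum_integral hu
  have hT := h.symbol.hasTemperateGrowth
  have i1 : Integrable fun ξ : Eu d => (Real.fourierChar (-inner ℝ ξ ζ) : ℂ) * (mulBy σ₀ ψ) ξ := by
    refine (mulBy σ₀ ψ).integrable.bdd_mul (c := 1) ?_ (ae_of_all _ fun ξ => (Circle.norm_coe _).le)
    exact (hasTemperateGrowth_char ζ).1.continuous.aestronglyMeasurable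
  have i2 := (h.integrable_mul hu).add i1
  convert h1 using 1
  · ext j
    rw [SchwartzMap.fourier_coe, Real.fourier_eq]
    refine integral_congr_ae (ae_of_all _ fun ξ => ?_)
    simp only [mulBy_schwartz_apply, Circle.smul_def, smul_eq_mul]
    ring
  · rw [SchwartzMap.fourier_coe, Real.fourier_eq, Real.fourier_eq, ← integral_sub]
    · refine integral_congr_ae (ae_of_all _ fun ξ => ?_)
      simp only [mulBy_apply hT, Circle.smul_def, smul_eq_mul]
      ring
    · refine i2.congr (ae_of_all _ fun ξ => ?_)
      simp only [Pi.add_apply, mulBy_apply hT, Circle.smul_def, smul_eq_mul]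
      ring
    · exact i1

theorem eLpNorm_fourier_le (h : IsLocalPerturbation δ R σ₀ b σ) (ψ : 𝓢(Eu d, ℂ)) :
    eLpNorm (𝓕 (fun ξ => σ ξ * ψ ξ)) 1 ≤ eLpNorm (𝓕 (mulBy σ₀ ψ) : 𝓢(Eu d, ℂ)) 1 +
      ∑' j, eLpNorm (𝓕 (mulBy (b j) ψ) : 𝓢(Eu d, ℂ)) 1 := by
  simp only [eLpNorm_one_eq_lintegral_enorm]
  rw [← lintegral_tsum fun j =>
    (𝓕 (mulBy (b j) ψ) : 𝓢(Eu d, ℂ)).continuous.enorm.measurable.aemeasurable,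
    ← lintegral_add_left (𝓕 (mulBy σ₀ ψ) : 𝓢(Eu d, ℂ)).continuous.enorm.measurable]
  refine lintegral_mono fun ζ => ?_
  have h1 := h.hasSum_fourier ψ ζ
  have h2 : 𝓕 (fun ξ => σ ξ * ψ ξ) ζ = 𝓕 (mulBy σ₀ ψ) ζ + ∑' j, 𝓕 (mulBy (b j) ψ) ζ := by
    rw [h1.tsum_eq]; ring
  rw [h2]
  exact (enorm_add_le _ _).trans (add_le_add le_rfl (enorm_tsum_le_tsum_enorm))

/-- The comparison in the opposite direction, so that the amalgam norm of the smooth part can be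
bounded by that of `σ`. -/
theorem eLpNorm_fourier_symbol_le (h : IsLocalPerturbation δ R σ₀ b σ) (ψ : 𝓢(Eu d, ℂ)) :
    eLpNorm (𝓕 (mulBy σ₀ ψ) : 𝓢(Eu d, ℂ)) 1 ≤ eLpNorm (𝓕 (fun ξ => σ ξ * ψ ξ)) 1 +
      ∑' j, eLpNorm (𝓕 (mulBy (b j) ψ) : 𝓢(Eu d, ℂ)) 1 := by
  have hm : ∀ j, Measurable fun ζ => ‖(𝓕 (mulBy (b j) ψ) : 𝓢(Eu d, ℂ)) ζ‖ₑ := fun j =>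
    (𝓕 (mulBy (b j) ψ) : 𝓢(Eu d, ℂ)).continuous.enorm.measurable
  simp only [eLpNorm_one_eq_lintegral_enorm]
  rw [← lintegral_tsum fun j => (hm j).aemeasurable,
    ← lintegral_add_right _ (Measurable.tsum hm)]
  refine lintegral_mono fun ζ => ?_
  have h1 := h.hasSum_fourier ψ ζ
  have h2 : 𝓕 (mulBy σ₀ ψ) ζ = 𝓕 (fun ξ => σ ξ * ψ ξ) ζ - ∑' j, 𝓕 (mulBy (b j) ψ) ζ := by
    rw [h1.tsum_eq]; ring
  rw [h2]
  exact (enorm_sub_le).trans (add_le_add le_rfl (enorm_tsum_le_tsum_enorm))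

end IsLocalPerturbation

/-- The local norms of a symbol supported in a fixed ball. -/
theorem exists_weight_mul_localNorm_le {R : ℝ} (hR : 0 < R) (δ : ℝ) (φ : 𝓢(Eu d, ℂ)) :
    ∃ C : ℝ≥0, ∀ b : 𝓢(Eu d, ℂ), (∀ t, R ≤ ‖t‖ → b t = 0) → ∀ x,
      weight δ x * localNorm 1 b φ x ≤ C * eLpNorm (𝓕 b : 𝓢(Eu d, ℂ)) 1 := by
  obtain ⟨θ, hθ, -⟩ := exists_cutoff (d := d) hR
  obtain ⟨C, hC⟩ := (hasSymbolBound_schwartz δ θ).eLpNorm_fourier_le φ 1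
  refine ⟨C * Real.toNNReal (2 ^ |δ|), fun b hb x => ?_⟩
  -- A cutoff equal to one where `b` lives costs nothing, and `θ T_x φ` decays in `x` fast enough to
  -- beat the weight.
  have e : mulBy b (translate x φ) = mulBy b (mulBy θ (translate x φ)) := by
    ext t
    rw [mulBy_schwartz_apply, mulBy_schwartz_apply, mulBy_schwartz_apply]
    rcases le_total ‖t‖ R with h | h
    · rw [hθ t h, one_mul]
    · rw [hb t h, zero_mul, zero_mul]
  have h2 := le_weight (-δ) x
  rw [abs_neg] at h2
  rw [localNorm, e]
  calc _ ≤ weight δ x * (eLpNorm (𝓕 b : 𝓢(Eu d, ℂ)) 1 *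
        (C * (ENNReal.ofReal (2 ^ |δ|) * weight (-δ) x))) := by
        gcongr
        refine (eLpNorm_fourier_mulBy_le _ _).trans ?_
        gcongr
        exact (hC x).trans (by gcongr)
    _ = (weight δ x * weight (-δ) x) * (C * ENNReal.ofReal (2 ^ |δ|)) *
        eLpNorm (𝓕 b : 𝓢(Eu d, ℂ)) 1 := by ring
    _ = _ := by rw [weight_mul_weight_neg, one_mul, ENNReal.coe_mul]; rfl

end

/-! ### Finiteness of modulation norms and boundedness of low frequencies -/

section

open Filter Topology

variable {d : ℕ}

theorem exists_eLpNorm_one_add_norm_lt_top {p : ℝ≥0∞} (hp : 0 < p) : ∃ γ : ℝ, 0 ≤ γ ∧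
    eLpNorm (fun x : Eu d => ENNReal.ofReal ((1 + ‖x‖) ^ (-γ))) p volume < ∞ := by
  rcases eq_or_ne p ∞ with rfl | hp'
  · refine ⟨0, le_rfl, ?_⟩
    simp only [neg_zero, Real.rpow_zero, ENNReal.ofReal_one]
    exact lt_of_le_of_lt (eLpNorm_exponent_top (ε := ℝ≥0∞)).le
      (lt_of_le_of_lt (essSup_le_of_ae_le 1 (ae_of_all _ fun x => by simp)) ENNReal.one_lt_top)
  · have h0 : 0 < p.toReal := ENNReal.toReal_pos hp.ne' hp'
    refine ⟨(d + 1) / p.toReal, by positivity, ?_⟩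
    rw [eLpNorm_ennreal_eq_lintegral hp.ne' hp']
    refine ENNReal.rpow_lt_top_of_nonneg (by positivity) ?_
    have h1 := lintegral_one_add_norm_lt_top (d := d) (r := d + 1) (by linarith)
    refine ne_of_lt (lt_of_le_of_lt (lintegral_mono fun x => le_of_eq ?_) h1)
    rw [ENNReal.ofReal_rpow_of_nonneg (by positivity) h0.le, ← Real.rpow_mul (by positivity)]
    congr 2
    field_simp

theorem stft_ofSchwartz (g φ : 𝓢(Eu d, ℂ)) (x ξ : Eu d) :
    stft g (ofSchwartz φ) x ξ = 𝓕 (mulBy φ (translate x (conjS g))) ξ := by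
  rw [stft, ofSchwartz_apply, SchwartzMap.fourier_coe, Real.fourier_eq]
  refine integral_congr_ae (ae_of_all _ fun y => ?_)
  simp only [atom_apply, mulBy_schwartz_apply, SchwartzMap.compSubConstCLM_apply, conjS_apply,
    Circle.smul_def, smul_eq_mul]
  ring

/-- The transform of a Schwartz function decays rapidly in both variables. The exponent `⌈κ + s⌉₊`
absorbs the weight and leaves a function of `ξ` in `L^q`. -/
theorem modNorm_ofSchwartz_lt_top {p q : ℝ≥0∞} (hp : 0 < p) (hq : 0 < q) (s : ℝ)
    (g φ : 𝓢(Eu d, ℂ)) : modNorm p q s g (ofSchwartz φ) < ∞ := by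
  obtain ⟨γ, -, hγ⟩ := exists_eLpNorm_one_add_norm_lt_top (d := d) hp
  obtain ⟨κ, -, hκ⟩ := exists_eLpNorm_one_add_norm_lt_top (d := d) hq
  obtain ⟨C, hC0, hC⟩ := (hasSymbolBound_schwartz γ φ).norm_fourier_le (conjS g) ⌈κ + s⌉₊
  set A := eLpNorm (fun x : Eu d => ENNReal.ofReal ((1 + ‖x‖) ^ (-γ))) p volume
  set N := ⌈κ + s⌉₊
  have h1 : ∀ ξ, eLpNorm (fun x : Eu d => stft g (ofSchwartz φ) x ξ) p volume ≤
      ENNReal.ofReal C * ENNReal.ofReal ((1 + ‖ξ‖) ^ (-(N : ℝ))) * A := by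
    intro ξ
    rw [← ENNReal.ofReal_mul hC0, ← eLpNorm_const_mul_ennreal ENNReal.ofReal_ne_top,
      ← eLpNorm_enorm]
    refine eLpNorm_mono_ennreal (ae_of_all _ fun x => ?_)
    rw [stft_ofSchwartz, ← ofReal_norm, ← ENNReal.ofReal_mul (by positivity)]
    refine ENNReal.ofReal_le_ofReal ((hC x ξ).trans_eq ?_)
    ring
  have h2 : modNorm p q s g (ofSchwartz φ) ≤ ENNReal.ofReal C * A * ENNReal.ofReal (2 ^ |s|) *
      eLpNorm (fun x : Eu d => ENNReal.ofReal ((1 + ‖x‖) ^ (-κ))) q volume := by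
    have hc : ENNReal.ofReal C * A * ENNReal.ofReal (2 ^ |s|) ≠ ∞ :=
      ENNReal.mul_ne_top (ENNReal.mul_ne_top ENNReal.ofReal_ne_top hγ.ne) ENNReal.ofReal_ne_top
    rw [← eLpNorm_const_mul_ennreal hc, modNorm]
    refine eLpNorm_mono_ennreal (ae_of_all _ fun ξ => ?_)
    calc _ ≤ (ENNReal.ofReal (2 ^ |s|) * ENNReal.ofReal ((1 + ‖ξ‖) ^ s)) *
          (ENNReal.ofReal C * ENNReal.ofReal ((1 + ‖ξ‖) ^ (-(N : ℝ))) * A) :=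
          mul_le_mul' (weight_le s ξ) (h1 ξ)
      _ = ENNReal.ofReal C * A * ENNReal.ofReal (2 ^ |s|) *
          (ENNReal.ofReal ((1 + ‖ξ‖) ^ s) * ENNReal.ofReal ((1 + ‖ξ‖) ^ (-(N : ℝ)))) := by ring
      _ ≤ _ := by
        gcongr
        rw [← ENNReal.ofReal_mul (by positivity), ← Real.rpow_add (by positivity)]
        refine ENNReal.ofReal_le_ofReal (Real.rpow_le_rpow_of_exponent_le ?_ ?_)
        · linarith [norm_nonneg ξ]
        · have := Nat.le_ceil (κ + s)
          change _ ≤ (N : ℝ) at this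
          linarith
  exact h2.trans_lt (ENNReal.mul_lt_top (ENNReal.mul_lt_top (ENNReal.mul_lt_top
    ENNReal.ofReal_lt_top hγ) ENNReal.ofReal_lt_top) hκ)

theorem profNorm_add_le {p : ℝ≥0∞} (hp : 1 ≤ p) (f₁ f₂ : 𝓢'(Eu d, ℂ)) (m : 𝓢(Eu d, ℂ)) :
    profNorm (f₁ + f₂) p m ≤ profNorm f₁ p m + profNorm f₂ p m := by
  rw [profNorm, prof_add]
  exact eLpNorm_add_le (continuous_prof f₁ m).aestronglyMeasurable
    (continuous_prof f₂ m).aestronglyMeasurable hp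

theorem measurable_weight_mul_profNorm (f : 𝓢'(Eu d, ℂ)) (p : ℝ≥0∞) (s : ℝ) (g : 𝓢(Eu d, ℂ)) :
    Measurable fun ξ => weight s ξ * profNorm f p (translate ξ (win g)) :=
  (measurable_weight s).mul (measurable_profNorm f p (ContinuousLinearMap.id ℂ _) (win g))

theorem modNorm_add_le {p : ℝ≥0∞} (hp : 1 ≤ p) (q : ℝ≥0∞) (s : ℝ) (g : 𝓢(Eu d, ℂ))
    (f₁ f₂ : 𝓢'(Eu d, ℂ)) : modNorm p q s g (f₁ + f₂) ≤
      q.LpAddConst * (modNorm p q s g f₁ + modNorm p q s g f₂) := by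
  rw [modNorm_eq, modNorm_eq, modNorm_eq]
  refine le_trans (eLpNorm_mono_ennreal (ae_of_all _ fun ξ => ?_)) (eLpNorm_add_le'
    (measurable_weight_mul_profNorm f₁ p s g).aestronglyMeasurable
    (measurable_weight_mul_profNorm f₂ p s g).aestronglyMeasurable q)
  rw [Pi.add_apply, ← mul_add]
  gcongr
  exact profNorm_add_le hp f₁ f₂ _

theorem modNorm_lt_top_of_mem {p q : ℝ≥0∞} (hp : 1 ≤ p) (hq : 0 < q) {s : ℝ} {g : 𝓢(Eu d, ℂ)}
    {f : 𝓢'(Eu d, ℂ)} (hf : f ∈ modSpace p q s g) : modNorm p q s g f < ∞ := by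
  obtain ⟨φ, hφ⟩ := hf 1 one_pos
  have h := modNorm_add_le hp q s g (f - ofSchwartz φ) (ofSchwartz φ)
  rw [sub_add_cancel] at h
  refine h.trans_lt (ENNReal.mul_lt_top (ENNReal.LpAddConst_lt_top q) (ENNReal.add_lt_top.2
    ⟨hφ.trans ENNReal.one_lt_top, modNorm_ofSchwartz_lt_top (zero_lt_one.trans_le hp) hq s g φ⟩))

theorem ae_lt_top_of_eLpNorm_lt_top {X : Type*} [MeasurableSpace X] {μ : Measure X} {q : ℝ≥0∞}
    (hq : 0 < q) {u : X → ℝ≥0∞} (hu : Measurable u) (h : eLpNorm u q μ < ∞) : ∀ᵐ x ∂μ, u x < ∞ := by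
  rcases eq_or_ne q ∞ with rfl | hq'
  · rw [eLpNorm_exponent_top] at h
    have := ae_lt_of_essSup_lt h
    simpa using this
  · have h0 : 0 < q.toReal := ENNReal.toReal_pos hq.ne' hq'
    have h1 := lintegral_rpow_enorm_lt_top_of_eLpNorm_lt_top hq.ne' hq' h
    simp only [enorm_eq_self] at h1
    filter_upwards [ae_lt_top (hu.pow_const _) h1.ne] with x hx
    rw [lt_top_iff_ne_top] at hx ⊢
    intro h2
    rw [h2, ENNReal.top_rpow_of_pos h0] at hx
    exact hx rfl

theorem ae_profNorm_lt_top {p q : ℝ≥0∞} (hq : 0 < q) {s : ℝ} {g : 𝓢(Eu d, ℂ)}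
    {f : 𝓢'(Eu d, ℂ)} (hf : modNorm p q s g f < ∞) :
    ∀ᵐ ξ, profNorm f p (translate ξ (win g)) < ∞ := by
  rw [modNorm_eq] at hf
  filter_upwards [ae_lt_top_of_eLpNorm_lt_top hq (measurable_weight_mul_profNorm f p s g) hf]
    with ξ hξ
  rw [lt_top_iff_ne_top] at hξ ⊢
  intro h
  rw [h, ENNReal.mul_top (weight_pos s ξ).ne'] at hξ
  exact hξ rfl

theorem profNorm_add_right_le {p : ℝ≥0∞} (hp : 1 ≤ p) (f : 𝓢'(Eu d, ℂ)) (m₁ m₂ : 𝓢(Eu d, ℂ)) :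
    profNorm f p (m₁ + m₂) ≤ profNorm f p m₁ + profNorm f p m₂ := by
  have e : prof f (m₁ + m₂) = prof f m₁ + prof f m₂ := by
    ext x
    simp only [prof, Pi.add_apply]
    have h1 : 𝓕 (m₁ + m₂) = 𝓕 m₁ + 𝓕 m₂ := map_add (fourierCLM ℂ 𝓢(Eu d, ℂ)) m₁ m₂
    rw [h1, map_add]
    exact map_add (functional f) _ _
  rw [profNorm, e]
  exact eLpNorm_add_le (continuous_prof f m₁).aestronglyMeasurable
    (continuous_prof f m₂).aestronglyMeasurable hp

open scoped ComplexOrder in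
/-- If the profiles of `f` are in `L^p` for almost all translates of `G`, some nonnegative function,
positive on a given compact set, has the same property. -/
theorem exists_profNorm_lt_top_of_isCompact {p : ℝ≥0∞} (hp : 1 ≤ p) {f : 𝓢'(Eu d, ℂ)}
    {G : 𝓢(Eu d, ℂ)} (hG : G ≠ 0) (h : ∀ᵐ ξ, profNorm f p (translate ξ G) < ∞) {K : Set (Eu d)}
    (hK : IsCompact K) : ∃ D : 𝓢(Eu d, ℂ), profNorm f p D < ∞ ∧ (∀ t, 0 ≤ D t) ∧
      ∀ t ∈ K, D t ≠ 0 := by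
  refine hK.induction_on (p := fun K => ∃ D : 𝓢(Eu d, ℂ), profNorm f p D < ∞ ∧ (∀ t, 0 ≤ D t) ∧
      ∀ t ∈ K, D t ≠ 0) ?_ ?_ ?_ ?_
  · refine ⟨0, ?_, fun t => le_rfl, by simp⟩
    have e : profNorm f p 0 = 0 := by
      have e : prof f 0 = 0 := by
        ext x
        rw [prof, show 𝓕 (0 : 𝓢(Eu d, ℂ)) = 0 from map_zero (fourierCLM ℂ 𝓢(Eu d, ℂ)), map_zero]
        exact map_zero (functional f)
      rw [profNorm, e]
      exact eLpNorm_zero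
    rw [e]; simp
  · rintro s t hst ⟨D, h1, h2, h3⟩
    exact ⟨D, h1, h2, fun x hx => h3 x (hst hx)⟩
  · rintro s t ⟨D, h1, h2, h3⟩ ⟨D', h1', h2', h3'⟩
    refine ⟨D + D', (profNorm_add_right_le hp f D D').trans_lt (ENNReal.add_lt_top.2 ⟨h1, h1'⟩),
      fun x => add_nonneg (h2 x) (h2' x), fun x hx h0 => ?_⟩
    have := (add_eq_zero_iff_of_nonneg (h2 x) (h2' x)).1 h0
    rcases hx with hx | hx
    · exact h3 x hx this.1
    · exact h3' x hx this.2
  · intro t _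
    obtain ⟨u, hu⟩ : ∃ u, G u ≠ 0 := by
      by_contra! h0
      exact hG (SchwartzMap.ext h0)
    -- The good translations have full measure, hence are dense and meet the open set of those with
    -- `T_ξ G` non-zero at `t`. Taking `|T_ξ G|²` excludes cancellation when finitely many such
    -- functions are added.
    obtain ⟨ξ, hξ, hξt⟩ := (Measure.dense_of_ae h).exists_mem_open (U := {ξ | G (t - ξ) ≠ 0})
      ((G.continuous.comp (continuous_const.sub continuous_id)).isOpen_preimage _
        isOpen_compl_singleton) ⟨t - u, by simpa using hu⟩
    refine ⟨{y | G (y - ξ) ≠ 0}, mem_nhdsWithin_of_mem_nhds (IsOpen.mem_nhds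
      ((G.continuous.comp (continuous_id.sub continuous_const)).isOpen_preimage _
        isOpen_compl_singleton) hξt), mulBy (conjS (translate ξ G)) (translate ξ G), ?_, ?_, ?_⟩
    · exact (profNorm_mulBy_le f hp _ _).trans_lt
        (ENNReal.mul_lt_top (eLpNorm_fourier_lt_top _) hξ)
    · intro y
      rw [mulBy_schwartz_apply, conjS_apply]
      exact star_mul_self_nonneg _
    · intro y hy
      rw [mulBy_schwartz_apply, conjS_apply]
      have : translate ξ G y ≠ 0 := hy
      simpa using this

open scoped ComplexOrder in
-- Write `θ = (θ / D) D` with `D` non-vanishing on a slightly larger ball. The quotient is smooth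
-- with compact support, so Young's inequality applies.
theorem profNorm_lt_top_of_cutoff {p : ℝ≥0∞} (hp : 1 ≤ p) {f : 𝓢'(Eu d, ℂ)}
    {G : 𝓢(Eu d, ℂ)} (hG : G ≠ 0) (h : ∀ᵐ ξ, profNorm f p (translate ξ G) < ∞) {R : ℝ}
    {θ : 𝓢(Eu d, ℂ)} (hθ : ∀ t, R ≤ ‖t‖ → θ t = 0) : profNorm f p θ < ∞ := by
  obtain ⟨D, hD, -, hD'⟩ := exists_profNorm_lt_top_of_isCompact hp hG h
    (isCompact_closedBall (0 : Eu d) (R + 1))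
  have hs : ContDiff ℝ ((⊤ : ℕ∞) : WithTop ℕ∞) (θ / D : Eu d → ℂ) := by
    refine contDiff_iff_contDiffAt.2 fun t => ?_
    by_cases ht : ‖t‖ ≤ R + 1
    · rw [div_eq_mul_inv]
      exact (θ.smooth ⊤).contDiffAt.mul ((D.smooth ⊤).contDiffAt.inv (hD' t (by simpa using ht)))
    · have : (θ / D : Eu d → ℂ) =ᶠ[𝓝 t] fun _ => 0 := by
        filter_upwards [(isOpen_lt continuous_const continuous_norm).mem_nhds
          (show R < ‖t‖ by linarith)] with y hy
        simp [hθ y (le_of_lt hy)]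
      exact contDiffAt_const.congr_of_eventuallyEq this
  have hc : HasCompactSupport (θ / D : Eu d → ℂ) := by
    refine HasCompactSupport.of_support_subset_isCompact (isCompact_closedBall (0 : Eu d) R) ?_
    intro y hy
    by_contra h0
    refine hy ?_
    have : θ y = 0 := hθ y (by simp at h0; exact h0.le)
    simp [this]
  have e : θ = mulBy (hc.toSchwartzMap hs) D := by
    ext t
    rw [mulBy_schwartz_apply]
    change θ t = (θ t / D t) * D t
    by_cases ht : ‖t‖ ≤ R + 1
    · rw [div_mul_cancel₀ _ (hD' t (by simpa using ht))]
    · rw [hθ t (by linarith)]; simp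
  rw [e]
  exact (profNorm_mulBy_le f hp _ _).trans_lt (ENNReal.mul_lt_top (eLpNorm_fourier_lt_top _) hD)

/-- Hölder's inequality in the convolution raises integrability from `p` to `∞`, at the cost of the
dual norm of `𝓕 a`. -/
theorem profNorm_top_mulBy_le {p : ℝ≥0∞} (hp : 1 ≤ p) (f : 𝓢'(Eu d, ℂ)) (a m : 𝓢(Eu d, ℂ)) :
    profNorm f ∞ (mulBy a m) ≤
      eLpNorm (𝓕 a : 𝓢(Eu d, ℂ)) p.conjExponent volume * profNorm f p m := by
  rw [profNorm, eLpNorm_exponent_top, eLpNormEssSup]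
  refine essSup_le_of_ae_le _ (ae_of_all _ fun x => ?_)
  have := ENNReal.HolderConjugate.conjExponent hp
  have : p.conjExponent.HolderTriple p 1 := ENNReal.HolderTriple.symm
  have h1 := eLpNorm_smul_le_mul_eLpNorm (μ := volume) (p := p.conjExponent) (q := p) (r := 1)
    (f := fun z => prof f m (z + x)) (φ := (𝓕 a : 𝓢(Eu d, ℂ)))
    ((continuous_prof f m).comp (continuous_add_const x)).aestronglyMeasurable
    (𝓕 a : 𝓢(Eu d, ℂ)).continuous.aestronglyMeasurable
  rw [eLpNorm_comp_add_right] at h1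
  refine le_trans ?_ h1
  beta_reduce
  rw [prof_mulBy, eLpNorm_one_eq_lintegral_enorm]
  refine (enorm_integral_le_lintegral_enorm _).trans (lintegral_mono fun z => le_of_eq ?_)
  simp [add_comm]

/-- Low-frequency parts of `f` have bounded profiles; this makes the multiplier series converge on
all of the modulation space. -/
theorem profNorm_top_lt_top {p q : ℝ≥0∞} (hp : 1 ≤ p) (hq : 0 < q) {s : ℝ} {g : 𝓢(Eu d, ℂ)}
    (hg : g ≠ 0) {f : 𝓢'(Eu d, ℂ)} (hf : modNorm p q s g f < ∞) {R : ℝ} (hR : 0 < R)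
    {θ : 𝓢(Eu d, ℂ)} (hθ : ∀ t, R ≤ ‖t‖ → θ t = 0) : profNorm f ∞ θ < ∞ := by
  obtain ⟨χ, hχ, hχ'⟩ := exists_cutoff (d := d) hR
  have e : θ = mulBy θ χ := by
    ext t
    rw [mulBy_schwartz_apply]
    rcases le_total ‖t‖ R with h | h
    · rw [hχ t h, mul_one]
    · rw [hθ t h, zero_mul]
  rw [e]
  refine (profNorm_top_mulBy_le hp f θ χ).trans_lt (ENNReal.mul_lt_top
    ((𝓕 θ : 𝓢(Eu d, ℂ)).memLp _ volume).eLpNorm_lt_top ?_)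
  exact profNorm_lt_top_of_cutoff hp (win_ne_zero hg) (ae_profNorm_lt_top hq hf) hχ'

end

/-! ### Multipliers with perturbed symbols as weak limits -/

section

open Filter Topology

variable {d : ℕ}

/-- Duality for merely integrable functions is needed because `σ · 𝓕 φ` is not Schwartz when `σ` is
singular at the origin. -/
theorem integral_fourierInv_mul_eq_of_integrable {v : Eu d → ℂ} (hv : Integrable v)
    (ψ : 𝓢(Eu d, ℂ)) :
    ∫ x, 𝓕⁻ v x * ψ x = ∫ ξ, v ξ * (𝓕⁻ ψ : 𝓢(Eu d, ℂ)) ξ := by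
  have h := VectorFourier.integral_fourierIntegral_smul_eq_flip (L := -innerₗ (Eu d))
    (μ := volume) (ν := volume) Real.continuous_fourierChar (continuous_inner.neg) hv ψ.integrable
  simp only [smul_eq_mul] at h
  have e1 : 𝓕⁻ v = VectorFourier.fourierIntegral Real.fourierChar volume (-innerₗ (Eu d)) v := by
    ext w
    rw [Real.fourierInv_eq, VectorFourier.fourierIntegral]
    simp
  have e2 : ((𝓕⁻ ψ : 𝓢(Eu d, ℂ)) : Eu d → ℂ) =
      VectorFourier.fourierIntegral Real.fourierChar volume (-innerₗ (Eu d)).flip ψ := by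
    ext w
    rw [SchwartzMap.fourierInv_coe, Real.fourierInv_eq, VectorFourier.fourierIntegral]
    simp [real_inner_comm]
  rw [e1, e2]
  exact h

theorem integral_multiplier_mul {σ : Eu d → ℂ} {φ : 𝓢(Eu d, ℂ)}
    (h : Integrable fun ξ : Eu d => σ ξ * 𝓕 (φ : Eu d → ℂ) ξ) (ψ : 𝓢(Eu d, ℂ)) :
    ∫ x, multiplier σ φ x * ψ x = ∫ ξ, σ ξ * (mulBy (𝓕 φ : 𝓢(Eu d, ℂ)) (𝓕⁻ ψ)) ξ := by
  rw [multiplier, integral_fourierInv_mul_eq_of_integrable h]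
  refine integral_congr_ae (ae_of_all _ fun ξ => ?_)
  beta_reduce
  rw [mulBy_schwartz_apply, SchwartzMap.fourier_coe]
  ring

theorem integrable_mul_fourier {σ : Eu d → ℂ} (hσ : σ.HasTemperateGrowth) (φ : 𝓢(Eu d, ℂ)) :
    Integrable fun ξ : Eu d => σ ξ * 𝓕 (φ : Eu d → ℂ) ξ := by
  refine (mulBy σ (𝓕 φ) : 𝓢(Eu d, ℂ)).integrable.congr (ae_of_all _ fun ξ => ?_)
  simp only [mulBy_apply hσ, SchwartzMap.fourier_coe]

theorem fourierMultiplier_ofSchwartz_apply {σ : Eu d → ℂ} (hσ : σ.HasTemperateGrowth)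
    (φ ψ : 𝓢(Eu d, ℂ)) : TemperedDistribution.fourierMultiplierCLM ℂ σ (ofSchwartz φ) ψ =
      ∫ ξ, σ ξ * (mulBy (𝓕 φ : 𝓢(Eu d, ℂ)) (𝓕⁻ ψ)) ξ := by
  rw [fourierMultiplier_ofSchwartz hσ, ofSchwartz_apply, ← multiplier_eq hσ,
    integral_multiplier_mul (integrable_mul_fourier hσ φ)]

/-- Profiles are continuous, so the essential bound holds at every point, in particular at the
origin. -/
theorem enorm_prof_le (f : 𝓢'(Eu d, ℂ)) (m : 𝓢(Eu d, ℂ)) (x : Eu d) :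
    ‖prof f m x‖ₑ ≤ profNorm f ∞ m := by
  have h : ∀ᵐ x, ‖prof f m x‖ₑ ≤ profNorm f ∞ m := by
    rw [profNorm, eLpNorm_exponent_top]
    exact enorm_ae_le_eLpNormEssSup _ _
  have hc : IsClosed {x | ‖prof f m x‖ₑ ≤ profNorm f ∞ m} :=
    isClosed_le (continuous_prof f m).enorm continuous_const
  have := (Measure.dense_of_ae h).closure_eq
  rw [hc.closure_eq] at this
  exact this.symm.subset (Set.mem_univ x)

/-- Testing against `ψ` is evaluating a profile at the origin; inserting `θ` and using Young's
inequality in `L^∞` twice separates `b`, `ψ` and `f`. -/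
theorem enorm_fourierMultiplier_le {R : ℝ} {θ : 𝓢(Eu d, ℂ)} (hθ : ∀ t, ‖t‖ ≤ R → θ t = 1)
    {b : 𝓢(Eu d, ℂ)} (hb : ∀ t, R ≤ ‖t‖ → b t = 0) (f : 𝓢'(Eu d, ℂ)) (ψ : 𝓢(Eu d, ℂ)) :
    ‖TemperedDistribution.fourierMultiplierCLM ℂ b f ψ‖ₑ ≤
      eLpNorm (𝓕 b : 𝓢(Eu d, ℂ)) 1 volume * (eLpNorm ψ 1 volume * profNorm f ∞ θ) := by
  have e : mulBy b (𝓕⁻ ψ) = mulBy b (mulBy (𝓕⁻ ψ : 𝓢(Eu d, ℂ)) θ) := by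
    ext t
    simp only [mulBy_schwartz_apply]
    rcases le_total ‖t‖ R with h | h
    · rw [hθ t h, mul_one]
    · rw [hb t h, zero_mul, zero_mul]
  have e2 : TemperedDistribution.fourierMultiplierCLM ℂ b f ψ =
      prof f (mulBy b (mulBy (𝓕⁻ ψ : 𝓢(Eu d, ℂ)) θ)) 0 := by
    rw [TemperedDistribution.fourierMultiplierCLM_apply_apply, ← e, prof]
    congr 1
    ext t
    simp
  rw [e2]
  refine (enorm_prof_le f _ 0).trans ((profNorm_mulBy_le f le_top _ _).trans ?_)
  gcongr
  have h := profNorm_mulBy_le f (p := ∞) le_top (𝓕⁻ ψ : 𝓢(Eu d, ℂ)) θ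
  rwa [FourierTransform.fourier_fourierInv_eq] at h

/-- `F` is the image of `f` under the multiplier with symbol `σ₀ + ∑ b j`. -/
def IsMultiplierLimit (σ₀ : Eu d → ℂ) (b : ℕ → 𝓢(Eu d, ℂ)) (f F : 𝓢'(Eu d, ℂ)) : Prop :=
  ∀ ψ, HasSum (fun j => TemperedDistribution.fourierMultiplierCLM ℂ (b j) f ψ)
    (F ψ - TemperedDistribution.fourierMultiplierCLM ℂ σ₀ f ψ)

namespace IsLocalPerturbation

variable {δ R : ℝ} {σ₀ σ : Eu d → ℂ} {b : ℕ → 𝓢(Eu d, ℂ)}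

/-- Tested on `ψ`, the series is dominated by the summable `𝓕L¹` norms times the `L¹` norm of `ψ`,
itself bounded by a Schwartz seminorm. The sum is therefore a tempered distribution. -/
theorem exists_isMultiplierLimit (h : IsLocalPerturbation δ R σ₀ b σ) {θ : 𝓢(Eu d, ℂ)}
    (hθ : ∀ t, ‖t‖ ≤ R → θ t = 1) {f : 𝓢'(Eu d, ℂ)} (hf : profNorm f ∞ θ < ∞) :
    ∃ F, IsMultiplierLimit σ₀ b f F := by
  set u : ℕ → 𝓢(Eu d, ℂ) → ℂ := fun j ψ => TemperedDistribution.fourierMultiplierCLM ℂ (b j) f ψ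
  have hb : ∀ j ψ, ‖u j ψ‖ ≤ (eLpNorm (𝓕 (b j) : 𝓢(Eu d, ℂ)) 1 volume).toReal *
      ((eLpNorm ψ 1 volume).toReal * (profNorm f ∞ θ).toReal) := by
    intro j ψ
    have := ENNReal.toReal_mono (ENNReal.mul_ne_top (eLpNorm_fourier_lt_top (b j)).ne
      (ENNReal.mul_ne_top (ψ.memLp 1 volume).eLpNorm_lt_top.ne hf.ne))
      (enorm_fourierMultiplier_le hθ (h.support j) f ψ)
    simpa only [toReal_enorm, ENNReal.toReal_mul] using this
  have hs : ∀ ψ, Summable fun j => u j ψ := fun ψ =>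
    Summable.of_norm_bounded (h.summable_toReal.mul_right _) fun j => hb j ψ
  set A := ∑' j, (eLpNorm (𝓕 (b j) : 𝓢(Eu d, ℂ)) 1 volume).toReal
  have hA : 0 ≤ A := tsum_nonneg fun j => ENNReal.toReal_nonneg
  have hle : ∀ ψ, ‖∑' j, u j ψ‖ ≤ A * ((eLpNorm ψ 1 volume).toReal * (profNorm f ∞ θ).toReal) :=
    fun ψ => tsum_of_norm_bounded (h.summable_toReal.hasSum.mul_right _) fun j => hb j ψ
  obtain ⟨k, C, hC⟩ := SchwartzMap.eLpNorm_le_seminorm ℂ ℂ (E := Eu d) 1 volume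
  let F : 𝓢(Eu d, ℂ) →L[ℂ] ℂ := SchwartzMap.mkCLMtoNormedSpace (fun ψ => ∑' j, u j ψ)
    (fun ψ₁ ψ₂ => by
      rw [← (hs ψ₁).tsum_add (hs ψ₂)]
      exact tsum_congr fun j =>
        map_add (functional (TemperedDistribution.fourierMultiplierCLM ℂ (b j) f)) _ _)
    (fun c ψ => by
      rw [RingHom.id_apply, smul_eq_mul, ← tsum_mul_left]
      exact tsum_congr fun j =>
        map_smul (functional (TemperedDistribution.fourierMultiplierCLM ℂ (b j) f)) _ _)
    ⟨Finset.Iic (k, 0), A * (C * (profNorm f ∞ θ).toReal), by positivity, fun ψ => by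
      refine (hle ψ).trans ?_
      have h1 := ENNReal.toReal_mono (by finiteness) (hC ψ)
      rw [ENNReal.toReal_mul, ENNReal.toReal_ofReal (apply_nonneg _ _), ENNReal.coe_toReal] at h1
      calc _ ≤ A * ((C * ((Finset.Iic (k, 0)).sup (schwartzSeminormFamily ℂ (Eu d) ℂ)) ψ) *
            (profNorm f ∞ θ).toReal) := by gcongr
        _ = _ := by ring⟩
  let F' : 𝓢'(Eu d, ℂ) := ⟨F.toLinearMap, F.cont⟩
  refine ⟨TemperedDistribution.fourierMultiplierCLM ℂ σ₀ f + F', fun ψ => ?_⟩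
  have e : (TemperedDistribution.fourierMultiplierCLM ℂ σ₀ f + F') ψ -
      TemperedDistribution.fourierMultiplierCLM ℂ σ₀ f ψ = ∑' j, u j ψ := by
    change TemperedDistribution.fourierMultiplierCLM ℂ σ₀ f ψ + F' ψ - _ = _
    rw [add_sub_cancel_left]
    rfl
  rw [e]
  exact (hs ψ).hasSum

end IsLocalPerturbation

theorem IsMultiplierLimit.unique {σ₀ : Eu d → ℂ} {b : ℕ → 𝓢(Eu d, ℂ)} {f F F' : 𝓢'(Eu d, ℂ)}
    (h : IsMultiplierLimit σ₀ b f F) (h' : IsMultiplierLimit σ₀ b f F') : F = F' := by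
  ext ψ
  exact sub_left_injective ((h ψ).unique (h' ψ))

theorem fourierMultiplier_add_apply (σ : Eu d → ℂ) (f₁ f₂ : 𝓢'(Eu d, ℂ)) (ψ : 𝓢(Eu d, ℂ)) :
    TemperedDistribution.fourierMultiplierCLM ℂ σ (f₁ + f₂) ψ =
      TemperedDistribution.fourierMultiplierCLM ℂ σ f₁ ψ +
        TemperedDistribution.fourierMultiplierCLM ℂ σ f₂ ψ := by
  rw [map_add]; rfl

theorem fourierMultiplier_smul_apply (σ : Eu d → ℂ) (c : ℂ) (f : 𝓢'(Eu d, ℂ)) (ψ : 𝓢(Eu d, ℂ)) :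
    TemperedDistribution.fourierMultiplierCLM ℂ σ (c • f) ψ =
      c * TemperedDistribution.fourierMultiplierCLM ℂ σ f ψ := by
  rw [map_smul]; rfl

theorem IsMultiplierLimit.add {σ₀ : Eu d → ℂ} {b : ℕ → 𝓢(Eu d, ℂ)} {f₁ f₂ F₁ F₂ : 𝓢'(Eu d, ℂ)}
    (h₁ : IsMultiplierLimit σ₀ b f₁ F₁) (h₂ : IsMultiplierLimit σ₀ b f₂ F₂) :
    IsMultiplierLimit σ₀ b (f₁ + f₂) (F₁ + F₂) := by
  intro ψ
  have h := (h₁ ψ).add (h₂ ψ)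
  simp only [fourierMultiplier_add_apply]
  convert h using 1
  change F₁ ψ + F₂ ψ - _ = _
  ring

theorem IsMultiplierLimit.smul {σ₀ : Eu d → ℂ} {b : ℕ → 𝓢(Eu d, ℂ)} {f F : 𝓢'(Eu d, ℂ)}
    (h : IsMultiplierLimit σ₀ b f F) (c : ℂ) : IsMultiplierLimit σ₀ b (c • f) (c • F) := by
  intro ψ
  have h := (h ψ).mul_left c
  have e : (c • F) ψ - c * TemperedDistribution.fourierMultiplierCLM ℂ σ₀ f ψ =
      c * (F ψ - TemperedDistribution.fourierMultiplierCLM ℂ σ₀ f ψ) := by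
    change c * F ψ - _ = _
    ring
  simp only [fourierMultiplier_smul_apply]
  rw [e]
  exact h

theorem mulBy_sum_apply (s : Finset ℕ) (b : ℕ → 𝓢(Eu d, ℂ)) (ψ : 𝓢(Eu d, ℂ)) :
    mulBy (∑ j ∈ s, b j : 𝓢(Eu d, ℂ)) ψ = ∑ j ∈ s, mulBy (b j) ψ := by
  ext t
  simp only [mulBy_schwartz_apply, sum_apply, Finset.sum_mul]

theorem fourierMultiplier_sum (s : Finset ℕ) (b : ℕ → 𝓢(Eu d, ℂ)) (f : 𝓢'(Eu d, ℂ))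
    (ψ : 𝓢(Eu d, ℂ)) :
    TemperedDistribution.fourierMultiplierCLM ℂ (∑ j ∈ s, b j : 𝓢(Eu d, ℂ)) f ψ =
      ∑ j ∈ s, TemperedDistribution.fourierMultiplierCLM ℂ (b j) f ψ := by
  simp only [TemperedDistribution.fourierMultiplierCLM_apply_apply]
  rw [mulBy_sum_apply]
  exact (map_sum ((functional f).comp (fourierCLM ℂ 𝓢(Eu d, ℂ))) _ _)

/-- The limit `F` does not depend on how many terms are counted in the smooth part, so bounds for
every `J` concern the same distribution. -/
theorem IsMultiplierLimit.tail {σ₀ : Eu d → ℂ} (hσ₀ : σ₀.HasTemperateGrowth)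
    {b : ℕ → 𝓢(Eu d, ℂ)} {f F : 𝓢'(Eu d, ℂ)} (h : IsMultiplierLimit σ₀ b f F) (J : ℕ)
    (hJ : (partialSymbol σ₀ b J).HasTemperateGrowth) :
    IsMultiplierLimit (partialSymbol σ₀ b J) (fun j => b (j + J)) f F := by
  intro ψ
  have h1 := (hasSum_nat_add_iff' J).2 (h ψ)
  have e : TemperedDistribution.fourierMultiplierCLM ℂ (partialSymbol σ₀ b J) f ψ =
      TemperedDistribution.fourierMultiplierCLM ℂ σ₀ f ψ +
        ∑ j ∈ Finset.range J, TemperedDistribution.fourierMultiplierCLM ℂ (b j) f ψ := by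
    rw [← fourierMultiplier_sum]
    simp only [TemperedDistribution.fourierMultiplierCLM_apply_apply]
    have : mulBy (partialSymbol σ₀ b J) (𝓕⁻ ψ) = mulBy σ₀ (𝓕⁻ ψ) +
        mulBy (∑ j ∈ Finset.range J, b j : 𝓢(Eu d, ℂ)) (𝓕⁻ ψ) := by
      ext t
      rw [mulBy_apply hJ, add_apply, mulBy_apply hσ₀, mulBy_schwartz_apply]
      simp only [partialSymbol, sum_apply]
      ring
    rw [this]
    exact map_add ((functional f).comp (fourierCLM ℂ 𝓢(Eu d, ℂ))) _ _
  rw [e, ← sub_sub]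
  exact h1

/-- Weak convergence gives pointwise convergence of profiles, as Fatou's lemma requires. -/
theorem IsMultiplierLimit.tendsto_prof {σ₀ : Eu d → ℂ} {b : ℕ → 𝓢(Eu d, ℂ)} {f F : 𝓢'(Eu d, ℂ)}
    (h : IsMultiplierLimit σ₀ b f F) (m : 𝓢(Eu d, ℂ)) (x : Eu d) :
    Tendsto (fun n => prof f (mulBy (∑ j ∈ Finset.range n, b j : 𝓢(Eu d, ℂ)) m) x) atTop
      (𝓝 (prof (F - TemperedDistribution.fourierMultiplierCLM ℂ σ₀ f) m x)) := by
  have h1 := (h (translate x (𝓕 m))).tendsto_sum_nat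
  refine h1.congr fun n => ?_
  rw [← fourierMultiplier_sum, ← prof_fourierMultiplier
    (hasSymbolBound_schwartz 0 _).hasTemperateGrowth]
  rfl

/-- The multiplier with symbol `σ₀ + ∑ b j`, wherever the series converges. -/
def limitMultiplier (σ₀ : Eu d → ℂ) (b : ℕ → 𝓢(Eu d, ℂ)) (f : 𝓢'(Eu d, ℂ)) : 𝓢'(Eu d, ℂ) :=
  open scoped Classical in
  if h : ∃ F, IsMultiplierLimit σ₀ b f F then h.choose else 0

theorem IsMultiplierLimit.limitMultiplier_eq {σ₀ : Eu d → ℂ} {b : ℕ → 𝓢(Eu d, ℂ)}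
    {f F : 𝓢'(Eu d, ℂ)} (h : IsMultiplierLimit σ₀ b f F) : limitMultiplier σ₀ b f = F := by
  have h' : ∃ F, IsMultiplierLimit σ₀ b f F := ⟨F, h⟩
  rw [limitMultiplier, dif_pos h']
  exact h'.choose_spec.unique h

namespace IsLocalPerturbation

variable {δ R : ℝ} {σ₀ σ : Eu d → ℂ} {b : ℕ → 𝓢(Eu d, ℂ)}

theorem integrable_mul_fourier (h : IsLocalPerturbation δ R σ₀ b σ) (φ : 𝓢(Eu d, ℂ)) :
    Integrable fun ξ : Eu d => σ ξ * 𝓕 (φ : Eu d → ℂ) ξ := by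
  have h1 := h.integrable_mul (𝓕 φ : 𝓢(Eu d, ℂ)).integrable
  refine (h1.add (ModSpace.integrable_mul_fourier h.symbol.hasTemperateGrowth φ)).congr
    (ae_of_all _ fun ξ => ?_)
  simp only [Pi.add_apply, SchwartzMap.fourier_coe]
  ring

theorem isMultiplierLimit_apply (h : IsLocalPerturbation δ R σ₀ b σ) {φ : 𝓢(Eu d, ℂ)}
    {F : 𝓢'(Eu d, ℂ)} (hF : IsMultiplierLimit σ₀ b (ofSchwartz φ) F) (ψ : 𝓢(Eu d, ℂ)) :
    F ψ = ∫ x, multiplier σ φ x * ψ x := by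
  have hT := h.symbol.hasTemperateGrowth
  have h1 := h.hasSum_integral (mulBy (𝓕 φ : 𝓢(Eu d, ℂ)) (𝓕⁻ ψ)).integrable
  have i1 := h.integrable_mul (mulBy (𝓕 φ : 𝓢(Eu d, ℂ)) (𝓕⁻ ψ)).integrable
  have i2 : Integrable fun ξ => σ₀ ξ * (mulBy (𝓕 φ : 𝓢(Eu d, ℂ)) (𝓕⁻ ψ)) ξ := by
    refine (mulBy σ₀ (mulBy (𝓕 φ : 𝓢(Eu d, ℂ)) (𝓕⁻ ψ))).integrable.congr (ae_of_all _ fun ξ => ?_)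
    simp only [mulBy_apply hT]
  have h2 := hF ψ
  simp only [fourierMultiplier_ofSchwartz_apply (hasSymbolBound_schwartz 0 _).hasTemperateGrowth,
    fourierMultiplier_ofSchwartz_apply hT] at h2
  have h3 := h2.unique h1
  rw [integral_multiplier_mul (h.integrable_mul_fourier φ), sub_eq_iff_eq_add.1 h3,
    ← integral_add i1 i2]
  refine integral_congr_ae (ae_of_all _ fun ξ => ?_)
  ring

end IsLocalPerturbation

end

/-! ### Norm bounds and extension for perturbed symbols -/

section

open Filter Topology

variable {d : ℕ}

theorem eLpNorm_fourier_sum_le (s : Finset ℕ) (b : ℕ → 𝓢(Eu d, ℂ)) :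
    eLpNorm (𝓕 (∑ j ∈ s, b j : 𝓢(Eu d, ℂ)) : 𝓢(Eu d, ℂ)) 1 volume ≤
      ∑' j, eLpNorm (𝓕 (b j) : 𝓢(Eu d, ℂ)) 1 volume := by
  have e : ((𝓕 (∑ j ∈ s, b j : 𝓢(Eu d, ℂ)) : 𝓢(Eu d, ℂ)) : Eu d → ℂ) =
      ∑ j ∈ s, ((𝓕 (b j) : 𝓢(Eu d, ℂ)) : Eu d → ℂ) := by
    have h : (𝓕 (∑ j ∈ s, b j : 𝓢(Eu d, ℂ)) : 𝓢(Eu d, ℂ)) = ∑ j ∈ s, 𝓕 (b j) :=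
      map_sum (fourierCLM ℂ 𝓢(Eu d, ℂ)) b s
    rw [h]
    ext t
    rw [sum_apply, Finset.sum_apply]
  rw [e]
  exact (eLpNorm_sum_le (fun j _ => (𝓕 (b j) : 𝓢(Eu d, ℂ)).continuous.aestronglyMeasurable)
    le_rfl).trans (ENNReal.sum_le_tsum s)

namespace IsLocalPerturbation

variable {δ R : ℝ} {σ₀ σ : Eu d → ℂ} {b : ℕ → 𝓢(Eu d, ℂ)}

/-- Fatou's lemma over the partial sums: the majorant `B` depends on `f` but not on the symbol, so
one bound serves all of them. -/
theorem profNorm_sub_le (h : IsLocalPerturbation δ R σ₀ b σ) {φ : 𝓢(Eu d, ℂ)} {C : ℝ≥0}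
    (hC : ∀ b : 𝓢(Eu d, ℂ), (∀ t, R ≤ ‖t‖ → b t = 0) → ∀ x,
      weight δ x * localNorm 1 b φ x ≤ C * eLpNorm (𝓕 b : 𝓢(Eu d, ℂ)) 1 volume)
    {p : ℝ≥0∞} {g : 𝓢(Eu d, ℂ)} {f F : 𝓢'(Eu d, ℂ)} {B : Eu d → ℝ≥0∞}
    (hB : ∀ σ : Eu d → ℂ, σ.HasTemperateGrowth → ∀ w : ℝ≥0∞,
        (∀ᵐ x, weight δ x * localNorm 1 σ φ x ≤ w) → ∀ ξ,
          profNorm f p (mulBy σ (translate ξ (win g))) ≤ w * B ξ)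
    (hF : IsMultiplierLimit σ₀ b f F) (ξ : Eu d) :
    profNorm (F - TemperedDistribution.fourierMultiplierCLM ℂ σ₀ f) p (translate ξ (win g)) ≤
      C * (∑' j, eLpNorm (𝓕 (b j) : 𝓢(Eu d, ℂ)) 1 volume) * B ξ := by
  refine (Lp.eLpNorm_lim_le_liminf_eLpNorm (fun n => (continuous_prof f
    (mulBy (∑ j ∈ Finset.range n, b j : 𝓢(Eu d, ℂ)) (translate ξ (win g)))).aestronglyMeasurable) _
    (ae_of_all _ fun x => hF.tendsto_prof _ x)).trans ?_
  refine (liminf_le_liminf (v := fun _ => C * (∑' j, eLpNorm (𝓕 (b j) : 𝓢(Eu d, ℂ)) 1 volume) * B ξ)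
    (Eventually.of_forall fun n => ?_)).trans (by simp)
  refine hB _ (hasSymbolBound_schwartz 0 _).hasTemperateGrowth _ (ae_of_all _ fun x => ?_) ξ
  refine (hC _ (fun t ht => ?_) x).trans (mul_le_mul' le_rfl (eLpNorm_fourier_sum_le _ b))
  rw [sum_apply]
  exact Finset.sum_eq_zero fun j _ => h.support j t ht

theorem fourier_mul_translate_le (h : IsLocalPerturbation δ R σ₀ b σ) {φ : 𝓢(Eu d, ℂ)} {C : ℝ≥0}
    (hC : ∀ b : 𝓢(Eu d, ℂ), (∀ t, R ≤ ‖t‖ → b t = 0) → ∀ x,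
      weight δ x * localNorm 1 b φ x ≤ C * eLpNorm (𝓕 b : 𝓢(Eu d, ℂ)) 1 volume) (x : Eu d) :
    weight δ x * ∑' j, eLpNorm (𝓕 (mulBy (b j) (translate x φ)) : 𝓢(Eu d, ℂ)) 1 volume ≤
      C * ∑' j, eLpNorm (𝓕 (b j) : 𝓢(Eu d, ℂ)) 1 volume := by
  rw [← ENNReal.tsum_mul_left, ← ENNReal.tsum_mul_left]
  exact ENNReal.tsum_le_tsum fun j => hC (b j) (h.support j) x

theorem wienerNorm_eq_essSup (σ : Eu d → ℂ) (r : ℝ≥0∞) (δ : ℝ) (φ : 𝓢(Eu d, ℂ)) :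
    wienerNorm r ∞ δ φ σ = essSup (fun x => weight δ x *
      eLpNorm (𝓕 (fun ξ => σ ξ * translate x φ ξ)) r volume) volume := by
  simp only [wienerNorm, eLpNorm_exponent_top, eLpNormEssSup, enorm_eq_self,
    SchwartzMap.compSubConstCLM_apply]

theorem wienerNorm_lt_top (h : IsLocalPerturbation δ R σ₀ b σ) (hR : 0 < R) (φ : 𝓢(Eu d, ℂ)) :
    wienerNorm 1 ∞ δ φ σ < ∞ := by
  obtain ⟨C, hC⟩ := exists_weight_mul_localNorm_le hR δ φ
  have h0 := h.symbol.wienerNorm_lt_top 1 φ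
  refine lt_of_le_of_lt ?_ (ENNReal.add_lt_top.2
    ⟨h0, ENNReal.mul_lt_top (ENNReal.coe_lt_top (r := C)) h.tsum_ne_top.lt_top⟩)
  rw [wienerNorm_eq_essSup]
  refine essSup_le_of_ae_le _ ?_
  rw [wienerNorm_eq h.symbol.hasTemperateGrowth]
  filter_upwards [ENNReal.ae_le_essSup fun x => weight δ x * localNorm 1 σ₀ φ x] with x hx
  refine (mul_le_mul' le_rfl (h.eLpNorm_fourier_le (translate x φ))).trans ?_
  rw [mul_add]
  exact add_le_add hx (h.fourier_mul_translate_le hC x)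

theorem ae_weight_mul_localNorm_le (h : IsLocalPerturbation δ R σ₀ b σ) {φ : 𝓢(Eu d, ℂ)} {C : ℝ≥0}
    (hC : ∀ b : 𝓢(Eu d, ℂ), (∀ t, R ≤ ‖t‖ → b t = 0) → ∀ x,
      weight δ x * localNorm 1 b φ x ≤ C * eLpNorm (𝓕 b : 𝓢(Eu d, ℂ)) 1 volume) :
    ∀ᵐ x, weight δ x * localNorm 1 σ₀ φ x ≤ wienerNorm 1 ∞ δ φ σ +
      C * ∑' j, eLpNorm (𝓕 (b j) : 𝓢(Eu d, ℂ)) 1 volume := by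
  rw [wienerNorm_eq_essSup]
  filter_upwards [ENNReal.ae_le_essSup fun x => weight δ x *
      eLpNorm (𝓕 (fun ξ => σ ξ * translate x φ ξ)) 1 volume] with x hx
  refine (mul_le_mul' le_rfl (h.eLpNorm_fourier_symbol_le (translate x φ))).trans ?_
  rw [mul_add]
  exact add_le_add hx (h.fourier_mul_translate_le hC x)

theorem modNorm_sub_le (h : IsLocalPerturbation δ R σ₀ b σ) {φ : 𝓢(Eu d, ℂ)} {C : ℝ≥0}
    (hC : ∀ b : 𝓢(Eu d, ℂ), (∀ t, R ≤ ‖t‖ → b t = 0) → ∀ x,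
      weight δ x * localNorm 1 b φ x ≤ C * eLpNorm (𝓕 b : 𝓢(Eu d, ℂ)) 1 volume)
    {p q : ℝ≥0∞} {s : ℝ} {g : 𝓢(Eu d, ℂ)} {f F : 𝓢'(Eu d, ℂ)} {B : Eu d → ℝ≥0∞} {K : ℝ≥0}
    (hB : ∀ σ : Eu d → ℂ, σ.HasTemperateGrowth → ∀ w : ℝ≥0∞,
        (∀ᵐ x, weight δ x * localNorm 1 σ φ x ≤ w) → ∀ ξ,
          profNorm f p (mulBy σ (translate ξ (win g))) ≤ w * B ξ)
    (hBK : eLpNorm (fun ξ => weight (s + δ) ξ * B ξ) q volume ≤ K * modNorm p q s g f)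
    (hF : IsMultiplierLimit σ₀ b f F) :
    modNorm p q (s + δ) g (F - TemperedDistribution.fourierMultiplierCLM ℂ σ₀ f) ≤
      C * (∑' j, eLpNorm (𝓕 (b j) : 𝓢(Eu d, ℂ)) 1 volume) * (K * modNorm p q s g f) := by
  refine le_trans ?_ (mul_le_mul' le_rfl hBK)
  rw [modNorm_eq, ← eLpNorm_const_mul_ennreal (ENNReal.mul_ne_top ENNReal.coe_ne_top h.tsum_ne_top)]
  refine eLpNorm_mono_ennreal (ae_of_all _ fun ξ => ?_)
  refine (mul_le_mul' le_rfl (h.profNorm_sub_le hC hB hF ξ)).trans_eq ?_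
  ring

/-- The error enters twice: in `F` minus its smooth part, and in comparing the amalgam norm of `σ₀`
with that of `σ`. The triangle inequality is used on profiles in `L^p`, so no quasi-norm constant
from `L^q` appears. -/
theorem modNorm_le (h : IsLocalPerturbation δ R σ₀ b σ) (hR : 0 < R) {φ : 𝓢(Eu d, ℂ)} {C : ℝ≥0}
    (hC : ∀ b : 𝓢(Eu d, ℂ), (∀ t, R ≤ ‖t‖ → b t = 0) → ∀ x,
      weight δ x * localNorm 1 b φ x ≤ C * eLpNorm (𝓕 b : 𝓢(Eu d, ℂ)) 1 volume)
    {p q : ℝ≥0∞} (hp : 1 ≤ p) {s : ℝ} {g : 𝓢(Eu d, ℂ)} {f F : 𝓢'(Eu d, ℂ)} {B : Eu d → ℝ≥0∞}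
    {K : ℝ≥0} (hB : ∀ σ : Eu d → ℂ, σ.HasTemperateGrowth → ∀ w : ℝ≥0∞,
        (∀ᵐ x, weight δ x * localNorm 1 σ φ x ≤ w) → ∀ ξ,
          profNorm f p (mulBy σ (translate ξ (win g))) ≤ w * B ξ)
    (hBK : eLpNorm (fun ξ => weight (s + δ) ξ * B ξ) q volume ≤ K * modNorm p q s g f)
    (hF : IsMultiplierLimit σ₀ b f F) :
    modNorm p q (s + δ) g F ≤ (wienerNorm 1 ∞ δ φ σ +
      2 * (C * ∑' j, eLpNorm (𝓕 (b j) : 𝓢(Eu d, ℂ)) 1 volume)) * (K * modNorm p q s g f) := by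
  refine le_trans ?_ (mul_le_mul' le_rfl hBK)
  set E : ℝ≥0∞ := C * ∑' j, eLpNorm (𝓕 (b j) : 𝓢(Eu d, ℂ)) 1 volume
  have hE : E ≠ ∞ := ENNReal.mul_ne_top ENNReal.coe_ne_top h.tsum_ne_top
  rw [modNorm_eq, ← eLpNorm_const_mul_ennreal (ENNReal.add_ne_top.2
    ⟨(h.wienerNorm_lt_top hR φ).ne, ENNReal.mul_ne_top (by simp) hE⟩)]
  refine eLpNorm_mono_ennreal (ae_of_all _ fun ξ => ?_)
  have h1 := h.profNorm_sub_le hC hB hF ξ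
  have h2 := hB σ₀ h.symbol.hasTemperateGrowth _ (h.ae_weight_mul_localNorm_le hC) ξ
  have h3 := profNorm_add_le hp (F - TemperedDistribution.fourierMultiplierCLM ℂ σ₀ f)
    (TemperedDistribution.fourierMultiplierCLM ℂ σ₀ f) (translate ξ (win g))
  rw [sub_add_cancel] at h3
  have h4 : profNorm (TemperedDistribution.fourierMultiplierCLM ℂ σ₀ f) p (translate ξ (win g)) =
      profNorm f p (mulBy σ₀ (translate ξ (win g))) := by
    rw [profNorm, prof_fourierMultiplier h.symbol.hasTemperateGrowth, profNorm]
  rw [h4] at h3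
  calc _ ≤ weight (s + δ) ξ * (E * B ξ + (wienerNorm 1 ∞ δ φ σ + E) * B ξ) :=
        mul_le_mul' le_rfl (h3.trans (add_le_add h1 h2))
    _ = _ := by ring

theorem tendsto_tail (h : IsLocalPerturbation δ R σ₀ b σ) :
    Tendsto (fun J => ∑' j, eLpNorm (𝓕 (b (j + J)) : 𝓢(Eu d, ℂ)) 1 volume) atTop (𝓝 0) :=
  ENNReal.tendsto_sum_nat_add _ h.tsum_ne_top

end IsLocalPerturbation

/-- Bounded extension for perturbed symbols, with a constant independent of the symbol. -/
theorem exists_isBoundedExtension_of_perturbation {p q : ℝ≥0∞} (hp : 1 ≤ p) (hq : 0 < q)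
    (s δ : ℝ) {g φ : 𝓢(Eu d, ℂ)} (hg : IsWindow p q g) (hφ : φ ≠ 0) :
    ∃ K : ℝ≥0, ∀ (R : ℝ) (σ σ₀ : Eu d → ℂ) (b : ℕ → 𝓢(Eu d, ℂ)), 0 < R →
      IsLocalPerturbation δ R σ₀ b σ → wienerNorm 1 ∞ δ φ σ < ∞ ∧
        ∃ T : 𝓢'(Eu d, ℂ) → 𝓢'(Eu d, ℂ),
          IsBoundedExtension σ p q s (s + δ) g (K * wienerNorm 1 ∞ δ φ σ) T := by
  -- This constant is fixed before the symbol, whence the uniformity in `α`.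
  obtain ⟨K, hK⟩ := exists_multiplier_bound (q := q) hp s δ hg hφ
  refine ⟨K, fun R σ σ₀ b hR h => ⟨h.wienerNorm_lt_top hR φ, limitMultiplier σ₀ b, ?_⟩⟩
  obtain ⟨C, hC⟩ := exists_weight_mul_localNorm_le hR δ φ
  obtain ⟨θ, hθ, hθ'⟩ := exists_cutoff (d := d) hR
  have hT := h.symbol.hasTemperateGrowth
  have hTJ := fun J => (h.hasSymbolBound_partialSymbol J).hasTemperateGrowth
  have hlim : ∀ f, modNorm p q s g f < ∞ →
      IsMultiplierLimit σ₀ b f (limitMultiplier σ₀ b f) := by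
    intro f hf
    obtain ⟨F, hF⟩ := h.exists_isMultiplierLimit hθ
      (profNorm_top_lt_top hp hq hg.1 hf (by linarith : 0 < 2 * R) hθ')
    rwa [hF.limitMultiplier_eq]
  have hS : ∀ φ, modNorm p q s g (ofSchwartz φ) < ∞ :=
    modNorm_ofSchwartz_lt_top (zero_lt_one.trans_le hp) hq s g
  have hmem : ∀ f ∈ modSpace p q s g, modNorm p q s g f < ∞ := fun f hf =>
    modNorm_lt_top_of_mem hp hq hf
  have hbound : ∀ f, modNorm p q s g f < ∞ → modNorm p q (s + δ) g (limitMultiplier σ₀ b f) ≤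
      K * wienerNorm 1 ∞ δ φ σ * modNorm p q s g f := by
    intro f hf
    obtain ⟨B, hB, hBK⟩ := hK f
    -- The bound is applied with `J` terms absorbed in the smooth part. As `J → ∞` the remainder
    -- tends to zero, and with it the constant `C`, which depends on `R`, drops out.
    have h1 := fun J => (h.tail J).modNorm_le hR hC hp hB hBK ((hlim f hf).tail hT J (hTJ J))
    have h2 : Tendsto (fun J => (wienerNorm 1 ∞ δ φ σ +
        2 * (C * ∑' j, eLpNorm (𝓕 (b (j + J)) : 𝓢(Eu d, ℂ)) 1 volume)) *
          (K * modNorm p q s g f)) atTop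
        (𝓝 ((wienerNorm 1 ∞ δ φ σ + 2 * (C * 0)) * (K * modNorm p q s g f))) := by
      refine ENNReal.Tendsto.mul_const (tendsto_const_nhds.add (ENNReal.Tendsto.const_mul
        (ENNReal.Tendsto.const_mul h.tendsto_tail (Or.inr (by simp))) (Or.inr (by simp))))
        (Or.inr (ENNReal.mul_ne_top (by simp) hf.ne))
    refine (ge_of_tendsto' h2 h1).trans_eq ?_
    ring
  have hadd : ∀ f₁ f₂, modNorm p q s g f₁ < ∞ → modNorm p q s g f₂ < ∞ →
      limitMultiplier σ₀ b (f₁ + f₂) = limitMultiplier σ₀ b f₁ + limitMultiplier σ₀ b f₂ :=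
    fun f₁ f₂ h₁ h₂ => ((hlim f₁ h₁).add (hlim f₂ h₂)).limitMultiplier_eq
  refine
    { maps_to := fun f hf ε hε => ?_
      map_add := fun f₁ h₁ f₂ h₂ => hadd f₁ f₂ (hmem f₁ h₁) (hmem f₂ h₂)
      map_smul := fun c f hf => ((hlim f (hmem f hf)).smul c).limitMultiplier_eq
      integrable := h.integrable_mul_fourier
      extends_multiplier := fun φ ψ => h.isMultiplierLimit_apply (hlim _ (hS φ)) ψ
      bound := fun f hf => hbound f (hmem f hf) }
  set A : ℝ≥0∞ := q.LpAddConst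
  have hA : A ≠ ∞ := (ENNReal.LpAddConst_lt_top q).ne
  set W : ℝ≥0∞ := K * wienerNorm 1 ∞ δ φ σ
  have hW : W ≠ ∞ := ENNReal.mul_ne_top (by simp) (h.wienerNorm_lt_top hR φ).ne
  obtain ⟨ε', hε', hε''⟩ : ∃ ε' : ℝ≥0∞, 0 < ε' ∧ A * (ε' + ε') < ε := by
    have ht : Tendsto (fun e : ℝ≥0∞ => A * (e + e)) (𝓝 0) (𝓝 (A * (0 + 0))) :=
      ENNReal.Tendsto.const_mul (tendsto_id.add tendsto_id) (Or.inr hA)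
    rw [add_zero, mul_zero] at ht
    have h1 := (ht.mono_left (nhdsWithin_le_nhds (s := Set.Ioi 0))).eventually (Iio_mem_nhds hε)
    obtain ⟨e, he1, he2⟩ := (h1.and self_mem_nhdsWithin).exists
    exact ⟨e, he2, he1⟩
  obtain ⟨u, hu⟩ := hf (ε' / (W + 1)) (ENNReal.div_pos hε'.ne' (ENNReal.add_ne_top.2 ⟨hW, by simp⟩))
  have hfu : modNorm p q s g (f - ofSchwartz u) < ∞ := hu.trans_le le_top
  have h1 : modNorm p q (s + δ) g (limitMultiplier σ₀ b (f - ofSchwartz u)) ≤ ε' := by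
    refine (hbound _ hfu).trans ?_
    have h2 := (ENNReal.lt_div_iff_mul_lt (Or.inl (by simp)) (Or.inl
      (ENNReal.add_ne_top.2 ⟨hW, by simp⟩))).1 hu
    refine le_trans ?_ h2.le
    rw [mul_comm]
    gcongr
    exact le_self_add
  obtain ⟨B, hB, hBK⟩ := hK (ofSchwartz u)
  -- The image of a Schwartz function need not be Schwartz, since `σ` may be singular; it is
  -- approximated by its images under the smooth partial symbols, which are.
  obtain ⟨J, hJ⟩ : ∃ J, modNorm p q (s + δ) g (limitMultiplier σ₀ b (ofSchwartz u) -
      TemperedDistribution.fourierMultiplierCLM ℂ (partialSymbol σ₀ b J) (ofSchwartz u)) < ε' := by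
    have h2 : Tendsto (fun J => C * (∑' j, eLpNorm (𝓕 (b (j + J)) : 𝓢(Eu d, ℂ)) 1 volume) *
          (K * modNorm p q s g (ofSchwartz u))) atTop
        (𝓝 (C * 0 * (K * modNorm p q s g (ofSchwartz u)))) :=
      ENNReal.Tendsto.mul_const (ENNReal.Tendsto.const_mul h.tendsto_tail (Or.inr (by simp)))
        (Or.inr (ENNReal.mul_ne_top (by simp) (hS u).ne))
    rw [mul_zero, zero_mul] at h2
    obtain ⟨J, hJ⟩ := (h2.eventually (Iio_mem_nhds hε')).exists
    exact ⟨J, ((h.tail J).modNorm_sub_le hC hB hBK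
      ((hlim _ (hS u)).tail hT J (hTJ J))).trans_lt hJ⟩
  refine ⟨SchwartzMap.fourierMultiplierCLM ℂ (partialSymbol σ₀ b J) u, ?_⟩
  rw [← fourierMultiplier_ofSchwartz (hTJ J)]
  have e : limitMultiplier σ₀ b f = limitMultiplier σ₀ b (f - ofSchwartz u) +
      limitMultiplier σ₀ b (ofSchwartz u) := by
    rw [← hadd _ _ hfu (hS u), sub_add_cancel]
  rw [e, add_sub_assoc]
  refine (modNorm_add_le hp q (s + δ) g _ _).trans_lt (lt_of_le_of_lt ?_ hε'')
  exact mul_le_mul' le_rfl (add_le_add h1 hJ.le)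

end

/-! ### Oscillating radial symbols away from the origin -/

section

open Filter Topology

variable {d : ℕ}

theorem contDiffAt_norm_rpow (r : ℝ) {ξ : Eu d} (hξ : ξ ≠ 0) {n : WithTop ℕ∞} :
    ContDiffAt ℝ n (fun ξ : Eu d => ‖ξ‖ ^ r) ξ :=
  (Real.contDiffAt_rpow_const_of_ne (norm_ne_zero_iff.2 hξ)).comp ξ (contDiffAt_norm ℝ hξ)

/-- Derivatives of homogeneous functions. -/
theorem exists_norm_iteratedFDeriv_norm_rpow_le (r : ℝ) (n : ℕ) : ∃ M : ℝ, 0 ≤ M ∧ ∀ ξ : Eu d,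
    ξ ≠ 0 → ‖iteratedFDeriv ℝ n (fun ξ : Eu d => ‖ξ‖ ^ r) ξ‖ ≤ M * ‖ξ‖ ^ (r - n) := by
  set N : Eu d → ℝ := fun ξ => ‖ξ‖ ^ r
  have hopen : IsOpen ({0}ᶜ : Set (Eu d)) := isOpen_compl_singleton
  have hN : ContDiffOn ℝ n N {0}ᶜ := fun ξ hξ => (contDiffAt_norm_rpow r hξ).contDiffWithinAt
  have hcont : ContinuousOn (iteratedFDeriv ℝ n N) {0}ᶜ :=
    (hN.continuousOn_iteratedFDerivWithin le_rfl hopen.uniqueDiffOn).congr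
      (iteratedFDerivWithin_of_isOpen n hopen).symm
  -- Compactness gives the bound on the unit sphere; homogeneity under `ξ ↦ ξ / ‖ξ‖` carries it to
  -- all non-zero points.
  obtain ⟨M, hM⟩ := (isCompact_sphere (0 : Eu d) 1).exists_bound_of_continuousOn
    (hcont.mono fun ξ hξ h0 => by simp [Set.mem_singleton_iff.1 h0] at hξ)
  refine ⟨|M|, abs_nonneg M, fun ξ hξ => ?_⟩
  have hρ : 0 < ‖ξ‖ := norm_pos_iff.2 hξ
  set t := ‖ξ‖⁻¹
  have ht : 0 < t := inv_pos.2 hρ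
  let g : Eu d ≃L[ℝ] Eu d := ContinuousLinearEquiv.smulLeft (Units.mk0 t ht.ne')
  have hg : ∀ x, g x = t • x := fun x => rfl
  have hgn : ‖(g : Eu d →L[ℝ] Eu d)‖ ≤ t := by
    refine ContinuousLinearMap.opNorm_le_bound _ ht.le fun x => le_of_eq ?_
    change ‖g x‖ = _
    rw [hg, norm_smul, Real.norm_of_nonneg ht.le]
  have h1 : iteratedFDeriv ℝ n (N ∘ g) ξ =
      (iteratedFDeriv ℝ n N (g ξ)).compContinuousLinearMap fun _ => (g : Eu d →L[ℝ] Eu d) := by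
    have := g.iteratedFDerivWithin_comp_right (s := Set.univ) N uniqueDiffOn_univ (x := ξ)
      (Set.mem_univ _) n
    simpa only [Set.preimage_univ, iteratedFDerivWithin_univ] using this
  have h2 : N ∘ g = (t ^ r) • N := by
    ext x
    simp only [Function.comp, hg, N, Pi.smul_apply, smul_eq_mul, norm_smul,
      Real.norm_of_nonneg ht.le]
    rw [Real.mul_rpow ht.le (norm_nonneg x)]
  rw [h2, iteratedFDeriv_const_smul_apply (contDiffAt_norm_rpow r hξ)] at h1
  have h3 : t ^ r * ‖iteratedFDeriv ℝ n N ξ‖ ≤ |M| * t ^ n := by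
    calc t ^ r * ‖iteratedFDeriv ℝ n N ξ‖ = ‖t ^ r • iteratedFDeriv ℝ n N ξ‖ := by
          rw [norm_smul, Real.norm_of_nonneg (by positivity)]
      _ ≤ ‖iteratedFDeriv ℝ n N (g ξ)‖ * ∏ _i : Fin n, ‖(g : Eu d →L[ℝ] Eu d)‖ := by
          rw [h1]; exact ContinuousMultilinearMap.norm_compContinuousLinearMap_le _ _
      _ ≤ |M| * t ^ n := by
          rw [Finset.prod_const, Finset.card_univ, Fintype.card_fin]
          gcongr
          refine (hM (g ξ) ?_).trans (le_abs_self M)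
          rw [hg, mem_sphere_zero_iff_norm, norm_smul, Real.norm_of_nonneg ht.le]
          exact inv_mul_cancel₀ hρ.ne'
  have h4 : ‖ξ‖ ^ r * t ^ r = 1 := by
    rw [← Real.mul_rpow hρ.le ht.le, mul_inv_cancel₀ hρ.ne', Real.one_rpow]
  calc ‖iteratedFDeriv ℝ n N ξ‖ = ‖ξ‖ ^ r * (t ^ r * ‖iteratedFDeriv ℝ n N ξ‖) := by
        rw [← mul_assoc, h4, one_mul]
    _ ≤ ‖ξ‖ ^ r * (|M| * t ^ n) := by gcongr
    _ = |M| * ‖ξ‖ ^ (r - n) := by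
        rw [Real.rpow_sub hρ, Real.rpow_natCast, inv_pow]
        ring

/-- An oscillating symbol of the form `S(|ξ| ^ α) / |ξ| ^ δ`. -/
def radialSymbol (S : ℝ → ℂ) (α δ : ℝ) (ξ : Eu d) : ℂ := S (‖ξ‖ ^ α) * ((‖ξ‖ ^ (-δ) : ℝ) : ℂ)

theorem contDiffAt_radialSymbol {S : ℝ → ℂ} {n : WithTop ℕ∞} (hS : ContDiff ℝ n S)
    (α δ : ℝ) {ξ : Eu d} (hξ : ξ ≠ 0) : ContDiffAt ℝ n (radialSymbol S α δ) ξ :=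
  (hS.contDiffAt.comp ξ (contDiffAt_norm_rpow α hξ)).mul
    (Complex.ofRealCLM.contDiff.contDiffAt.comp ξ (contDiffAt_norm_rpow (-δ) hξ))

/-- Since `α ≤ 1`, all derivatives of `|ξ|^α` of positive order are bounded on `|ξ| ≥ 1`, so the
chain rule keeps those of `S(|ξ|^α)` bounded. Those of `|ξ|^{-δ}` are no larger than a multiple of
`|ξ|^{-δ}`. -/
theorem exists_norm_iteratedFDeriv_radialSymbol_le {S : ℝ → ℂ}
    (hS : ContDiff ℝ ((⊤ : ℕ∞) : WithTop ℕ∞) S)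
    (hSb : ∀ n : ℕ, ∃ C, ∀ u, ‖iteratedFDeriv ℝ n S u‖ ≤ C) {α : ℝ} (hα : α ≤ 1) (δ : ℝ) (n : ℕ) :
    ∃ C : ℝ, ∀ ξ : Eu d, 1 ≤ ‖ξ‖ →
      ‖iteratedFDeriv ℝ n (radialSymbol S α δ) ξ‖ ≤ C * ‖ξ‖ ^ (-δ) := by
  choose A hA using hSb
  choose M hM0 hM using exists_norm_iteratedFDeriv_norm_rpow_le (d := d) α
  choose L hL0 hL using exists_norm_iteratedFDeriv_norm_rpow_le (d := d) (-δ)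
  have hopen : IsOpen ({0}ᶜ : Set (Eu d)) := isOpen_compl_singleton
  have hf : ContDiffOn ℝ ((⊤ : ℕ∞) : WithTop ℕ∞) (fun ξ : Eu d => ‖ξ‖ ^ α) {0}ᶜ :=
    fun ξ hξ => (contDiffAt_norm_rpow α hξ).contDiffWithinAt
  have hg : ContDiffOn ℝ ((⊤ : ℕ∞) : WithTop ℕ∞) (fun ξ : Eu d => ((‖ξ‖ ^ (-δ) : ℝ) : ℂ)) {0}ᶜ :=
    fun ξ hξ => (Complex.ofRealCLM.contDiff.contDiffAt.comp ξ
      (contDiffAt_norm_rpow (-δ) hξ)).contDiffWithinAt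
  have hfg : ContDiffOn ℝ ((⊤ : ℕ∞) : WithTop ℕ∞) (fun ξ : Eu d => S (‖ξ‖ ^ α)) {0}ᶜ :=
    fun ξ hξ => (hS.contDiffAt.comp ξ (contDiffAt_norm_rpow α hξ)).contDiffWithinAt
  have hsum : ∀ (a : ℕ → ℝ), (∀ i, 0 ≤ a i) → ∀ (m i : ℕ), i ≤ m →
      a i ≤ ∑ i ∈ Finset.range (m + 1), a i := fun a ha m i hi =>
    Finset.single_le_sum (f := a) (fun j _ => ha j) (Finset.mem_range.2 (by omega))
  have h1 : ∀ m : ℕ, ∃ D : ℝ, 0 ≤ D ∧ ∀ ξ : Eu d, 1 ≤ ‖ξ‖ →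
      ‖iteratedFDerivWithin ℝ m (fun ξ : Eu d => S (‖ξ‖ ^ α)) {0}ᶜ ξ‖ ≤ D := by
    intro m
    set CA := ∑ i ∈ Finset.range (m + 1), |A i|
    -- The summand `1` makes `CM ≤ CM ^ i`, the form required by the chain-rule estimate.
    set CM := 1 + ∑ i ∈ Finset.range (m + 1), M i
    have hCA : 0 ≤ CA := Finset.sum_nonneg fun i _ => abs_nonneg _
    have hCM : 1 ≤ CM := le_add_of_nonneg_right (Finset.sum_nonneg fun i _ => hM0 i)
    refine ⟨m.factorial * CA * CM ^ m, by positivity, fun ξ hξ => ?_⟩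
    have hξ0 : ξ ≠ 0 := fun h => by simp [h] at hξ; linarith
    refine norm_iteratedFDerivWithin_comp_le (g := S) (f := fun ξ : Eu d => ‖ξ‖ ^ α)
      (t := Set.univ) hS.contDiffOn hf (mod_cast le_top) uniqueDiffOn_univ hopen.uniqueDiffOn
      (Set.mapsTo_univ _ _) hξ0 (fun i hi => ?_) (fun i hi1 hi => ?_)
    · rw [iteratedFDerivWithin_univ]
      exact (hA i _).trans ((le_abs_self _).trans (hsum _ (fun i => abs_nonneg _) m i hi))
    · rw [iteratedFDerivWithin_of_isOpen i hopen hξ0]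
      calc _ ≤ M i * ‖ξ‖ ^ (α - i) := hM i ξ hξ0
        _ ≤ M i * 1 := by
            refine mul_le_mul_of_nonneg_left (Real.rpow_le_one_of_one_le_of_nonpos hξ ?_) (hM0 i)
            have : (1 : ℝ) ≤ i := mod_cast hi1
            linarith
        _ ≤ CM := by
            rw [mul_one]
            exact (hsum _ hM0 m i hi).trans (le_add_of_nonneg_left zero_le_one)
        _ ≤ CM ^ i := le_self_pow₀ hCM (by omega)
  choose D hD0 hD using h1
  refine ⟨∑ i ∈ Finset.range (n + 1), n.choose i * D i * L (n - i), fun ξ hξ => ?_⟩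
  have hξ0 : ξ ≠ 0 := fun h => by simp [h] at hξ; linarith
  rw [← iteratedFDerivWithin_of_isOpen n hopen hξ0]
  refine (norm_iteratedFDerivWithin_mul_le hfg hg hopen.uniqueDiffOn hξ0
    (mod_cast le_top)).trans ?_
  rw [Finset.sum_mul]
  refine Finset.sum_le_sum fun i _ => ?_
  rw [mul_assoc _ (L (n - i))]
  refine mul_le_mul (mul_le_mul_of_nonneg_left (hD i ξ hξ) (by positivity)) ?_ (norm_nonneg _)
    (mul_nonneg (by positivity) (hD0 i))
  rw [iteratedFDerivWithin_of_isOpen _ hopen hξ0]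
  have e : ‖iteratedFDeriv ℝ (n - i) (fun ξ : Eu d => ((‖ξ‖ ^ (-δ) : ℝ) : ℂ)) ξ‖ =
      ‖iteratedFDeriv ℝ (n - i) (fun ξ : Eu d => ‖ξ‖ ^ (-δ)) ξ‖ :=
    Complex.ofRealLI.norm_iteratedFDeriv_comp_left (contDiffAt_norm_rpow (-δ) hξ0) le_rfl
  rw [e]
  refine (hL (n - i) ξ hξ0).trans (mul_le_mul_of_nonneg_left ?_ (hL0 _))
  exact Real.rpow_le_rpow_of_exponent_le hξ (by
    have : (0 : ℝ) ≤ ((n - i : ℕ) : ℝ) := by positivity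
    linarith)

theorem norm_rpow_le_one_add_norm_rpow (r : ℝ) {ξ : Eu d} (hξ : 1 ≤ ‖ξ‖) :
    ‖ξ‖ ^ r ≤ 2 ^ |r| * (1 + ‖ξ‖) ^ r := by
  rcases le_total 0 r with h | h
  · calc ‖ξ‖ ^ r ≤ (1 + ‖ξ‖) ^ r := Real.rpow_le_rpow (norm_nonneg _) (by linarith) h
      _ ≤ _ := le_mul_of_one_le_left (by positivity)
        (Real.one_le_rpow (by norm_num) (abs_nonneg r))
  · rw [abs_of_nonpos h]
    have h2 : 0 < (1 + ‖ξ‖) / 2 := by positivity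
    calc ‖ξ‖ ^ r ≤ ((1 + ‖ξ‖) / 2) ^ r :=
          Real.rpow_le_rpow_of_nonpos h2 (by linarith) h
      _ = _ := by
        rw [Real.div_rpow (by positivity) (by norm_num), Real.rpow_neg (by norm_num)]
        ring

/-- A smooth symbol that is of the radial form outside the unit ball. -/
theorem hasSymbolBound_of_eq_radialSymbol {S : ℝ → ℂ} (hS : ContDiff ℝ ((⊤ : ℕ∞) : WithTop ℕ∞) S)
    (hSb : ∀ n : ℕ, ∃ C, ∀ u, ‖iteratedFDeriv ℝ n S u‖ ≤ C) {α : ℝ} (hα : α ≤ 1) {δ : ℝ}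
    {σ : Eu d → ℂ} (hσ : ContDiff ℝ ((⊤ : ℕ∞) : WithTop ℕ∞) σ)
    (h : ∀ ξ, 1 < ‖ξ‖ → σ ξ = radialSymbol S α δ ξ) : HasSymbolBound δ σ := by
  refine ⟨hσ, fun n => ?_⟩
  obtain ⟨C, hC⟩ := exists_norm_iteratedFDeriv_radialSymbol_le (d := d) hS hSb hα δ n
  have hcont : Continuous fun ξ => ‖iteratedFDeriv ℝ n σ ξ‖ * (1 + ‖ξ‖) ^ δ :=
    (hσ.continuous_iteratedFDeriv (mod_cast le_top)).norm.mul
      ((continuous_const.add continuous_norm).rpow_const fun ξ =>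
        Or.inl (show (0 : ℝ) < 1 + ‖ξ‖ by linarith [norm_nonneg ξ]).ne')
  obtain ⟨D, hD⟩ := (isCompact_closedBall (0 : Eu d) 1).exists_bound_of_continuousOn
    hcont.continuousOn
  refine ⟨max D (|C| * 2 ^ |δ|), fun ξ => ?_⟩
  have hp : 0 < 1 + ‖ξ‖ := by positivity
  rcases le_or_gt ‖ξ‖ 1 with hξ | hξ
  · have h1 := (le_abs_self _).trans (hD ξ (by simpa using hξ))
    rw [Real.rpow_neg hp.le, ← div_eq_mul_inv, le_div_iff₀ (by positivity)]
    exact h1.trans (le_max_left _ _)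
  · have e : σ =ᶠ[𝓝 ξ] radialSymbol S α δ := by
      filter_upwards [(isOpen_lt continuous_const continuous_norm).mem_nhds hξ] with y hy
      exact h y hy
    have e2 : iteratedFDeriv ℝ n σ ξ = iteratedFDeriv ℝ n (radialSymbol S α δ) ξ :=
      (e.iteratedFDeriv ℝ n).eq_of_nhds
    rw [e2]
    have h2 := norm_rpow_le_one_add_norm_rpow (-δ) hξ.le
    rw [abs_neg] at h2
    calc _ ≤ |C| * (2 ^ |δ| * (1 + ‖ξ‖) ^ (-δ)) := by
          refine (hC ξ hξ.le).trans (mul_le_mul (le_abs_self C) h2 (by positivity) (abs_nonneg C))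
      _ = |C| * 2 ^ |δ| * (1 + ‖ξ‖) ^ (-δ) := by ring
      _ ≤ _ := by gcongr; exact le_max_right _ _

theorem norm_iteratedFDeriv_ofReal_comp {S : ℝ → ℝ} (hS : ContDiff ℝ ((⊤ : ℕ∞) : WithTop ℕ∞) S)
    (n : ℕ) (u : ℝ) : ‖iteratedFDeriv ℝ n (fun u => (S u : ℂ)) u‖ = |iteratedDeriv n S u| := by
  have : ‖iteratedFDeriv ℝ n (fun u => (S u : ℂ)) u‖ = ‖iteratedFDeriv ℝ n S u‖ :=
    Complex.ofRealLI.norm_iteratedFDeriv_comp_left hS.contDiffAt (mod_cast le_top)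
  rw [this, norm_iteratedFDeriv_eq_norm_iteratedDeriv, Real.norm_eq_abs]

theorem exists_norm_iteratedFDeriv_sin_le (n : ℕ) :
    ∃ C, ∀ u, ‖iteratedFDeriv ℝ n (fun u : ℝ => ((Real.sin u : ℝ) : ℂ)) u‖ ≤ C :=
  ⟨1, fun u => by
    rw [norm_iteratedFDeriv_ofReal_comp Real.contDiff_sin]
    exact Real.abs_iteratedDeriv_sin_le_one n u⟩

theorem exists_norm_iteratedFDeriv_cos_le (n : ℕ) :
    ∃ C, ∀ u, ‖iteratedFDeriv ℝ n (fun u : ℝ => ((Real.cos u : ℝ) : ℂ)) u‖ ≤ C :=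
  ⟨1, fun u => by
    rw [norm_iteratedFDeriv_ofReal_comp Real.contDiff_cos]
    exact Real.abs_iteratedDeriv_cos_le_one n u⟩

theorem contDiff_ofReal_sin : ContDiff ℝ ((⊤ : ℕ∞) : WithTop ℕ∞)
    (fun u : ℝ => ((Real.sin u : ℝ) : ℂ)) := Complex.ofRealCLM.contDiff.comp Real.contDiff_sin

theorem contDiff_ofReal_cos : ContDiff ℝ ((⊤ : ℕ∞) : WithTop ℕ∞)
    (fun u : ℝ => ((Real.cos u : ℝ) : ℂ)) := Complex.ofRealCLM.contDiff.comp Real.contDiff_cos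

/-! ### Even entire functions -/

/-- Evenness makes `f(√w)` independent of the branch: the principal root gives holomorphy off the
cut, `i√(-w)` gives it across the cut, and the origin is removable by continuity. -/
theorem exists_entire_comp_sq {f : ℂ → ℂ} (hf : Differentiable ℂ f) (heven : ∀ z, f (-z) = f z) :
    ∃ h : ℂ → ℂ, Differentiable ℂ h ∧ ∀ z, h (z ^ 2) = f z := by
  set r : ℂ → ℂ := fun w => w ^ (1 / 2 : ℂ)
  have hr : ∀ w, r w ^ 2 = w := fun w => by
    simp [r]
  have hsq : ∀ u v : ℂ, u ^ 2 = v ^ 2 → f u = f v := by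
    intro u v huv
    rcases sq_eq_sq_iff_eq_or_eq_neg.1 huv with rfl | rfl
    · rfl
    · exact heven v
  have h0 : ContinuousAt (f ∘ r) 0 :=
    hf.continuous.continuousAt.comp
      (Complex.continuousAt_cpow_const_of_re_pos (Or.inl le_rfl) (by norm_num))
  have hslit : ∀ w ∈ Complex.slitPlane, DifferentiableAt ℂ r w := fun w hw =>
    (differentiableAt_id).cpow_const hw
  have hd : DifferentiableOn ℂ (f ∘ r) (Set.univ \ {0}) := by
    intro w hw
    have hw0 : w ≠ 0 := by simpa using hw
    refine DifferentiableAt.differentiableWithinAt ?_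
    by_cases h : w ∈ Complex.slitPlane
    · exact (hf _).comp w (hslit w h)
    · have h' : -w ∈ Complex.slitPlane := by
        rw [Complex.mem_slitPlane_iff] at h ⊢
        push Not at h
        refine Or.inl ?_
        rw [Complex.neg_re, neg_pos]
        refine lt_of_le_of_ne h.1 fun h2 => hw0 (Complex.ext h2 h.2)
      have e : f ∘ r = fun w => f (Complex.I * r (-w)) := by
        ext w
        refine hsq _ _ ?_
        rw [mul_pow, hr, hr, Complex.I_sq]; ring
      rw [e]
      have h2 : DifferentiableAt ℂ (fun w => Complex.I * r (-w)) w :=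
        ((hslit (-w) h').comp w differentiableAt_id.neg).const_mul _
      exact (hf _).comp w h2
  refine ⟨f ∘ r, ?_, fun z => hsq _ _ (hr _)⟩
  exact differentiableOn_univ.1
    ((Complex.differentiableOn_compl_singleton_and_continuousAt_iff univ_mem).1 ⟨hd, h0⟩)

/-- An even entire function of `|ξ|` is an entire function of `|ξ|²`, which is smooth also at the
origin. -/
theorem contDiff_of_even {f : ℂ → ℂ} (hf : Differentiable ℂ f) (heven : ∀ z, f (-z) = f z)
    {n : WithTop ℕ∞} : ContDiff ℝ n fun ξ : Eu d => f (‖ξ‖ : ℂ) := by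
  obtain ⟨h, hh, e⟩ := exists_entire_comp_sq hf heven
  have e2 : (fun ξ : Eu d => f (‖ξ‖ : ℂ)) = fun ξ : Eu d => h ((‖ξ‖ ^ 2 : ℝ) : ℂ) := by
    ext ξ
    rw [← e]; push_cast; rfl
  rw [e2]
  exact (hh.contDiff.restrict_scalars ℝ).comp
    (Complex.ofRealCLM.contDiff.comp (contDiff_norm_sq ℝ))

/-- The entire function `sin z / z`. -/
def entireSinc : ℂ → ℂ := dslope Complex.sin 0

theorem differentiable_dslope {f : ℂ → ℂ} (hf : Differentiable ℂ f) (c : ℂ) :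
    Differentiable ℂ (dslope f c) :=
  differentiableOn_univ.1 ((Complex.differentiableOn_dslope univ_mem).2 hf.differentiableOn)

theorem differentiable_entireSinc : Differentiable ℂ entireSinc :=
  differentiable_dslope Complex.differentiable_sin 0

theorem entireSinc_zero : entireSinc 0 = 1 := by
  rw [entireSinc, dslope_same, Complex.deriv_sin, Complex.cos_zero]

theorem entireSinc_of_ne {z : ℂ} (hz : z ≠ 0) : entireSinc z = Complex.sin z / z := by
  rw [entireSinc, dslope_of_ne _ hz, slope_def_field, Complex.sin_zero, sub_zero, sub_zero]

theorem entireSinc_neg (z : ℂ) : entireSinc (-z) = entireSinc z := by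
  rcases eq_or_ne z 0 with rfl | hz
  · simp
  · rw [entireSinc_of_ne hz, entireSinc_of_ne (neg_ne_zero.2 hz), Complex.sin_neg, neg_div_neg_eq]

theorem hasSymbolBound_cosSymbol : HasSymbolBound 0 (cosSymbol : Eu d → ℂ) := by
  have e : (cosSymbol : Eu d → ℂ) = fun ξ => Complex.cos (‖ξ‖ : ℂ) := by
    ext ξ; simp [cosSymbol]
  refine hasSymbolBound_of_eq_radialSymbol contDiff_ofReal_cos exists_norm_iteratedFDeriv_cos_le
    le_rfl ?_ fun ξ _ => ?_
  · rw [e]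
    exact contDiff_of_even Complex.differentiable_cos Complex.cos_neg
  · simp [cosSymbol, radialSymbol]

theorem hasSymbolBound_entireSinc : HasSymbolBound 1 (fun ξ : Eu d => entireSinc (‖ξ‖ : ℂ)) := by
  refine hasSymbolBound_of_eq_radialSymbol contDiff_ofReal_sin exists_norm_iteratedFDeriv_sin_le
    le_rfl (contDiff_of_even differentiable_entireSinc entireSinc_neg) fun ξ hξ => ?_
  have h0 : (‖ξ‖ : ℂ) ≠ 0 := by
    have : ‖ξ‖ ≠ 0 := by linarith
    exact_mod_cast this
  rw [entireSinc_of_ne h0, radialSymbol, Real.rpow_one, Real.rpow_neg_one]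
  push_cast
  rw [div_eq_mul_inv]

/-- At the origin the quotient takes the default value `0` while the entire function equals `1`; in
positive dimension a point is null. -/
theorem sinSymbol_one_one_ae (hd : 0 < d) :
    (sinSymbol 1 1 : Eu d → ℂ) =ᵐ[volume] fun ξ => entireSinc (‖ξ‖ : ℂ) := by
  have : NeZero d := ⟨hd.ne'⟩
  filter_upwards [compl_mem_ae_iff.2 (measure_singleton (0 : Eu d))] with ξ hξ
  have h0 : (‖ξ‖ : ℂ) ≠ 0 := by
    have : ‖ξ‖ ≠ 0 := norm_ne_zero_iff.2 hξ
    exact_mod_cast this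
  rw [entireSinc_of_ne h0, sinSymbol, Real.rpow_one]
  push_cast
  rfl

end

/-! ### Dyadic decomposition at the origin -/

section

open Filter Topology

variable {d : ℕ}

theorem exists_eLpNorm_fourier_le_seminorm : ∃ (s : Finset (ℕ × ℕ)) (C : ℝ≥0), ∀ ψ : 𝓢(Eu d, ℂ),
    eLpNorm (𝓕 ψ : 𝓢(Eu d, ℂ)) 1 volume ≤
      C * ENNReal.ofReal (∑ i ∈ s, SchwartzMap.seminorm ℂ i.1 i.2 ψ) := by
  obtain ⟨k, C, hC⟩ := SchwartzMap.eLpNorm_le_seminorm (E := Eu d) (F := ℂ) ℂ 1 volume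
  obtain ⟨s, D, -, hD⟩ := Seminorm.bound_of_continuous (schwartz_withSeminorms ℂ (Eu d) ℂ)
    (((Finset.Iic (k, 0)).sup (schwartzSeminormFamily ℂ (Eu d) ℂ)).comp
      (fourierCLM ℂ 𝓢(Eu d, ℂ)).toLinearMap) (by
      have : Continuous fun ψ : 𝓢(Eu d, ℂ) => (Finset.Iic (k, 0)).sup
          (schwartzSeminormFamily ℂ (Eu d) ℂ) (fourierCLM ℂ 𝓢(Eu d, ℂ) ψ) :=
        (continuous_sup_seminorm _).comp (fourierCLM ℂ 𝓢(Eu d, ℂ)).continuous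
      exact this)
  refine ⟨s, C * D, fun ψ => (hC _).trans ?_⟩
  rw [ENNReal.coe_mul, mul_assoc]
  gcongr
  rw [← ENNReal.ofReal_coe_nnreal (p := D), ← ENNReal.ofReal_mul (NNReal.coe_nonneg D)]
  refine ENNReal.ofReal_le_ofReal ((hD ψ).trans ?_)
  exact mul_le_mul_of_nonneg_left (sup_seminorm_le_sum s ψ) D.2

/-- A smooth one-parameter family of functions supported in the unit ball is bounded
in `𝓕 L^1`. -/
theorem exists_eLpNorm_fourier_le_of_contDiff {Ψ : ℝ × Eu d → ℂ}
    (hΨ : ContDiff ℝ ((⊤ : ℕ∞) : WithTop ℕ∞) Ψ) (h0 : ∀ ε ξ, 1 ≤ ‖ξ‖ → Ψ (ε, ξ) = 0) :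
    ∃ M : ℝ≥0, ∀ ε ∈ Set.Icc (0 : ℝ) 1, ∃ B : 𝓢(Eu d, ℂ), (∀ ξ, B ξ = Ψ (ε, ξ)) ∧
      eLpNorm (𝓕 B : 𝓢(Eu d, ℂ)) 1 volume ≤ M := by
  obtain ⟨s, C, hC⟩ := exists_eLpNorm_fourier_le_seminorm (d := d)
  have hbd : ∀ n : ℕ, ∃ D : ℝ, ∀ z ∈ Set.Icc (0 : ℝ) 1 ×ˢ Metric.closedBall (0 : Eu d) 1,
      ‖iteratedFDeriv ℝ n Ψ z‖ ≤ D := fun n =>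
    (isCompact_Icc.prod (isCompact_closedBall (0 : Eu d) 1)).exists_bound_of_continuousOn
      (hΨ.continuous_iteratedFDeriv (mod_cast le_top)).continuousOn
  choose D hD using hbd
  refine ⟨C * (∑ i ∈ s, |D i.2|).toNNReal, fun ε hε => ?_⟩
  have hs : ContDiff ℝ ((⊤ : ℕ∞) : WithTop ℕ∞) fun ξ : Eu d => Ψ (ε, ξ) :=
    hΨ.comp (contDiff_const.prodMk contDiff_id)
  have hsupp : Function.support (fun ξ : Eu d => Ψ (ε, ξ)) ⊆ Metric.closedBall 0 1 := by
    intro ξ hξ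
    by_contra h
    refine hξ (h0 ε ξ ?_)
    simp only [Metric.mem_closedBall, dist_zero_right, not_le] at h
    exact h.le
  have hc : HasCompactSupport fun ξ : Eu d => Ψ (ε, ξ) :=
    HasCompactSupport.of_support_subset_isCompact (isCompact_closedBall (0 : Eu d) 1) hsupp
  refine ⟨hc.toSchwartzMap hs, fun ξ => rfl, (hC _).trans ?_⟩
  rw [ENNReal.coe_mul]
  gcongr
  refine ENNReal.ofReal_le_ofReal (Finset.sum_le_sum fun i _ => ?_)
  refine SchwartzMap.seminorm_le_bound ℂ _ _ _ (abs_nonneg _) fun ξ => ?_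
  change ‖ξ‖ ^ i.1 * ‖iteratedFDeriv ℝ i.2 (fun ξ : Eu d => Ψ (ε, ξ)) ξ‖ ≤ _
  by_cases hξ : ‖ξ‖ ≤ 1
  · have e1 : (fun ξ : Eu d => Ψ (ε, ξ)) =
        (fun z => Ψ ((ε, 0) + z)) ∘ (ContinuousLinearMap.inr ℝ ℝ (Eu d)) := by
      ext ξ; simp
    have hΨ' : ContDiff ℝ ((⊤ : ℕ∞) : WithTop ℕ∞) fun z : ℝ × Eu d => Ψ ((ε, 0) + z) :=
      hΨ.comp (contDiff_const.add contDiff_id)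
    have h1 : ‖iteratedFDeriv ℝ i.2 (fun ξ : Eu d => Ψ (ε, ξ)) ξ‖ ≤ |D i.2| := by
      rw [e1, (ContinuousLinearMap.inr ℝ ℝ (Eu d)).iteratedFDeriv_comp_right hΨ' ξ
        (mod_cast le_top)]
      refine (ContinuousMultilinearMap.norm_compContinuousLinearMap_le _ _).trans ?_
      rw [Finset.prod_const, Finset.card_univ, Fintype.card_fin]
      have h2 : ‖ContinuousLinearMap.inr ℝ ℝ (Eu d)‖ ≤ 1 :=
        ContinuousLinearMap.opNorm_le_bound _ zero_le_one fun x => by simp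
      have h3 := iteratedFDeriv_comp_add_left (𝕜 := ℝ) (f := Ψ) i.2 (ε, 0)
        ((ContinuousLinearMap.inr ℝ ℝ (Eu d)) ξ)
      have h4 : ‖iteratedFDeriv ℝ i.2 Ψ ((ε, 0) + (ContinuousLinearMap.inr ℝ ℝ (Eu d)) ξ)‖ ≤
          |D i.2| := by
        refine (hD i.2 _ ?_).trans (le_abs_self _)
        refine Set.mem_prod.2 ⟨by simpa using hε, by simpa using hξ⟩
      rw [← h3] at h4
      exact (mul_le_mul h4 (pow_le_one₀ (norm_nonneg _) h2) (by positivity) (abs_nonneg _)).trans_eq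
        (mul_one _)
    exact (mul_le_mul (pow_le_one₀ (norm_nonneg _) hξ) h1 (norm_nonneg _) zero_le_one).trans_eq
      (one_mul _)
  · have h1 : iteratedFDeriv ℝ i.2 (fun ξ : Eu d => Ψ (ε, ξ)) ξ = 0 := by
      have := support_iteratedFDeriv_subset (𝕜 := ℝ) (f := fun ξ : Eu d => Ψ (ε, ξ)) i.2
      by_contra h
      have h2 := this h
      rw [tsupport] at h2
      have h3 := closure_minimal hsupp Metric.isClosed_closedBall h2
      exact hξ (by simpa using h3)
    rw [h1, norm_zero, mul_zero]
    exact abs_nonneg _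

/-- Dilations preserve the norm of `𝓕 L^1`. -/
theorem exists_dilation (B : 𝓢(Eu d, ℂ)) {t : ℝ} (ht : 0 < t) : ∃ b : 𝓢(Eu d, ℂ),
    (∀ ξ, b ξ = B (t • ξ)) ∧
      eLpNorm (𝓕 b : 𝓢(Eu d, ℂ)) 1 volume = eLpNorm (𝓕 B : 𝓢(Eu d, ℂ)) 1 volume := by
  let g : Eu d ≃L[ℝ] Eu d := ContinuousLinearEquiv.smulLeft (Units.mk0 t ht.ne')
  have hb : ∀ ξ, SchwartzMap.compCLMOfContinuousLinearEquiv ℂ g B ξ = B (t • ξ) := fun ξ => rfl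
  refine ⟨SchwartzMap.compCLMOfContinuousLinearEquiv ℂ g B, hb, ?_⟩
  set b := SchwartzMap.compCLMOfContinuousLinearEquiv ℂ g B
  set c : ℝ := |(t ^ Module.finrank ℝ (Eu d))⁻¹|
  have hc : c * |(t⁻¹ ^ Module.finrank ℝ (Eu d))⁻¹| = 1 := by
    rw [← abs_mul, ← mul_inv, ← mul_pow, mul_inv_cancel₀ ht.ne']; simp
  have h1 : ∀ ζ, (𝓕 b : 𝓢(Eu d, ℂ)) ζ = c • (𝓕 B : 𝓢(Eu d, ℂ)) (t⁻¹ • ζ) := by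
    intro ζ
    rw [SchwartzMap.fourier_coe, SchwartzMap.fourier_coe, Real.fourier_eq, Real.fourier_eq,
      ← Measure.integral_comp_smul volume
        (fun ξ => Real.fourierChar (-inner ℝ ξ (t⁻¹ • ζ)) • B ξ) t]
    refine integral_congr_ae (ae_of_all _ fun ξ => ?_)
    beta_reduce
    rw [hb, inner_smul_left, inner_smul_right]
    simp only [RCLike.conj_to_real]
    rw [mul_inv_cancel_left₀ ht.ne']
  have h2 : ∀ ψ : 𝓢(Eu d, ℂ), eLpNorm ψ 1 volume = ENNReal.ofReal (∫ ξ, ‖ψ ξ‖) := fun ψ => by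
    rw [eLpNorm_one_eq_lintegral_enorm, ofReal_integral_norm_eq_lintegral_enorm ψ.integrable]
  rw [h2, h2]
  congr 1
  have hc0 : 0 ≤ c := abs_nonneg _
  simp only [h1, norm_smul, Real.norm_of_nonneg hc0]
  rw [integral_const_mul, Measure.integral_comp_smul volume (fun ζ => ‖(𝓕 B : 𝓢(Eu d, ℂ)) ζ‖),
    smul_eq_mul, ← mul_assoc, hc, one_mul]

theorem contDiff_one_sub_mul {χ F : Eu d → ℂ} {r : ℝ} (hr : 0 < r)
    (hχ : ContDiff ℝ ((⊤ : ℕ∞) : WithTop ℕ∞) χ) (h1 : ∀ t, ‖t‖ ≤ r → χ t = 1)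
    (hF : ∀ ξ ≠ 0, ContDiffAt ℝ ((⊤ : ℕ∞) : WithTop ℕ∞) F ξ) :
    ContDiff ℝ ((⊤ : ℕ∞) : WithTop ℕ∞) fun ξ => (1 - χ ξ) * F ξ := by
  refine contDiff_iff_contDiffAt.2 fun ξ => ?_
  rcases eq_or_ne ξ 0 with rfl | hξ
  · refine (contDiffAt_const (c := (0 : ℂ))).congr_of_eventuallyEq ?_
    filter_upwards [Metric.ball_mem_nhds (0 : Eu d) hr] with y hy
    rw [h1 y (by simpa using (Metric.mem_ball.1 hy).le)]; simp
  · exact (contDiffAt_const.sub hχ.contDiffAt).mul (hF ξ hξ)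

/-- Dyadic decomposition of `E(|ξ| ^ α) |ξ| ^ β` near the origin. -/
theorem exists_dyadic_decomposition {E : ℂ → ℂ} (hE : Differentiable ℂ E) {α β : ℝ} (hα : 0 < α)
    (hβ : 0 < β) {χ : 𝓢(Eu d, ℂ)} (hχ : ∀ t, ‖t‖ ≤ 1 / 2 → χ t = 1)
    (hχ' : ∀ t, 1 ≤ ‖t‖ → χ t = 0) : ∃ b : ℕ → 𝓢(Eu d, ℂ), (∀ j t, 1 ≤ ‖t‖ → b j t = 0) ∧
      ∑' j, eLpNorm (𝓕 (b j) : 𝓢(Eu d, ℂ)) 1 volume ≠ ∞ ∧ ∀ ξ ≠ 0, HasSum (fun j => b j ξ)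
        (χ ξ * (E ((‖ξ‖ ^ α : ℝ) : ℂ) * ((‖ξ‖ ^ β : ℝ) : ℂ))) := by
  have hofReal : ∀ (r : ℝ) (ξ : Eu d), ξ ≠ 0 →
      ContDiffAt ℝ ((⊤ : ℕ∞) : WithTop ℕ∞) (fun ξ : Eu d => ((‖ξ‖ ^ r : ℝ) : ℂ)) ξ := fun r ξ hξ =>
    Complex.ofRealCLM.contDiff.contDiffAt.comp ξ (contDiffAt_norm_rpow r hξ)
  have hχs : ∀ c : ℝ, ContDiff ℝ ((⊤ : ℕ∞) : WithTop ℕ∞) fun ξ => χ (c • ξ) := fun c =>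
    (χ.smooth ⊤).comp (contDiff_const_smul c)
  have hχ4 : ∀ t : Eu d, ‖t‖ ≤ 1 / 8 → χ ((4 : ℝ) • t) = 1 := fun t ht =>
    hχ _ (by rw [norm_smul, Real.norm_of_nonneg (by norm_num)]; linarith)
  -- A globally smooth substitute for `|ξ|^r`: it agrees with it for `|ξ| ≥ 1/4`, hence wherever the
  -- annular function `ρ` is non-zero.
  set P : ℝ → Eu d → ℂ := fun r ξ => (1 - χ ((4 : ℝ) • ξ)) * ((‖ξ‖ ^ r : ℝ) : ℂ) with hP
  have hPs : ∀ r, ContDiff ℝ ((⊤ : ℕ∞) : WithTop ℕ∞) (P r) := fun r =>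
    contDiff_one_sub_mul (by norm_num : (0 : ℝ) < 1 / 8) (hχs 4) hχ4 (hofReal r)
  set ρ : Eu d → ℂ := fun ξ => χ ξ - χ ((2 : ℝ) • ξ) with hρ
  have hρs : ContDiff ℝ ((⊤ : ℕ∞) : WithTop ℕ∞) ρ := (χ.smooth ⊤).sub (hχs 2)
  have hρ1 : ∀ ξ, 1 ≤ ‖ξ‖ → ρ ξ = 0 := fun ξ hξ => by
    simp only [hρ]
    rw [hχ' ξ hξ, hχ', sub_self]
    rw [norm_smul, Real.norm_of_nonneg (by norm_num)]; linarith
  have hPρ : ∀ r ξ, ρ ξ ≠ 0 → P r ξ = ((‖ξ‖ ^ r : ℝ) : ℂ) := by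
    intro r ξ h
    have h4 : 1 / 4 < ‖ξ‖ := by
      by_contra! h4
      refine h ?_
      simp only [hρ]
      rw [hχ ξ (by linarith), hχ, sub_self]
      rw [norm_smul, Real.norm_of_nonneg (by norm_num)]; linarith
    simp only [hP]
    rw [hχ', sub_zero, one_mul]
    rw [norm_smul, Real.norm_of_nonneg (by norm_num)]; linarith
  -- Rescaling the `j`-th annulus to unit size turns `E(|ξ|^α)` into `E(ε |ξ|^α)` with `ε = 2^{-jα}`
  -- in `[0, 1]`. All pieces thus come from one smooth family over a compact interval, with a common
  -- `𝓕L¹` bound.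
  set Ψ : ℝ × Eu d → ℂ := fun z => E ((z.1 : ℂ) * P α z.2) * (P β z.2 * ρ z.2) with hΨdef
  have hΨ : ContDiff ℝ ((⊤ : ℕ∞) : WithTop ℕ∞) Ψ := by
    refine ContDiff.mul ((hE.contDiff.restrict_scalars ℝ).comp (ContDiff.mul ?_ ?_))
      (ContDiff.mul ?_ ?_)
    · exact Complex.ofRealCLM.contDiff.comp contDiff_fst
    · exact (hPs α).comp contDiff_snd
    · exact (hPs β).comp contDiff_snd
    · exact hρs.comp contDiff_snd
  obtain ⟨M, hM⟩ := exists_eLpNorm_fourier_le_of_contDiff hΨ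
    (fun ε ξ hξ => by simp only [hΨdef]; rw [hρ1 ξ hξ]; simp)
  have hε : ∀ j : ℕ, ((2 : ℝ) ^ j) ^ (-α) ∈ Set.Icc (0 : ℝ) 1 := fun j =>
    ⟨by positivity, Real.rpow_le_one_of_one_le_of_nonpos (one_le_pow₀ (by norm_num))
      (by linarith)⟩
  choose B hB hBM using fun j => hM _ (hε j)
  choose b hb hbn using fun j => exists_dilation (B j) (t := 2 ^ j) (by positivity)
  have hval : ∀ j (ξ : Eu d), ((((2 : ℝ) ^ j) ^ (-β) : ℝ) : ℂ) * b j ξ =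
      E ((‖ξ‖ ^ α : ℝ) : ℂ) * ((‖ξ‖ ^ β : ℝ) : ℂ) * ρ (((2 : ℝ) ^ j) • ξ) := by
    intro j ξ
    rw [hb, hB]
    simp only [hΨdef]
    by_cases h : ρ (((2 : ℝ) ^ j) • ξ) = 0
    · rw [h]; simp
    · have hn : ‖((2 : ℝ) ^ j) • ξ‖ = 2 ^ j * ‖ξ‖ := by
        rw [norm_smul, Real.norm_of_nonneg (by positivity)]
      have h2 : (0 : ℝ) < 2 ^ j := by positivity
      have hr : ∀ r : ℝ, ((2 : ℝ) ^ j) ^ (-r) * (2 ^ j * ‖ξ‖) ^ r = ‖ξ‖ ^ r := fun r => by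
        rw [Real.mul_rpow h2.le (norm_nonneg _), ← mul_assoc, ← Real.rpow_add h2]; simp
      rw [hPρ α _ h, hPρ β _ h, hn, ← Complex.ofReal_mul, hr α]
      rw [← hr β, Complex.ofReal_mul]
      ring
  have hsup : ∀ j (t : Eu d), 1 ≤ ‖t‖ → 1 ≤ ‖((2 : ℝ) ^ j) • t‖ := fun j t ht => by
    rw [norm_smul, Real.norm_of_nonneg (by positivity)]
    exact one_le_mul_of_one_le_of_one_le (one_le_pow₀ (by norm_num)) ht
  refine ⟨fun j => ((((2 : ℝ) ^ j) ^ (-β) : ℝ) : ℂ) • b j, fun j t ht => ?_, ?_, fun ξ hξ => ?_⟩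
  · change _ * b j t = 0
    rw [hval, hρ1 _ (hsup j t ht), mul_zero]
  · have h1 : ∀ j, eLpNorm (𝓕 (((((2 : ℝ) ^ j) ^ (-β) : ℝ) : ℂ) • b j) : 𝓢(Eu d, ℂ)) 1 volume ≤
        ENNReal.ofReal (2 ^ (-β)) ^ j * M := by
      intro j
      have e : ((𝓕 (((((2 : ℝ) ^ j) ^ (-β) : ℝ) : ℂ) • b j) : 𝓢(Eu d, ℂ)) : Eu d → ℂ) =
          ((((2 : ℝ) ^ j) ^ (-β) : ℝ) : ℂ) • ((𝓕 (b j) : 𝓢(Eu d, ℂ)) : Eu d → ℂ) := by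
        have : (𝓕 (((((2 : ℝ) ^ j) ^ (-β) : ℝ) : ℂ) • b j) : 𝓢(Eu d, ℂ)) =
            ((((2 : ℝ) ^ j) ^ (-β) : ℝ) : ℂ) • (𝓕 (b j) : 𝓢(Eu d, ℂ)) :=
          map_smul (fourierCLM ℂ 𝓢(Eu d, ℂ)) _ _
        rw [this]; rfl
      have h2 : (0 : ℝ) ≤ ((2 : ℝ) ^ j) ^ (-β) := by positivity
      rw [e, eLpNorm_const_smul, hbn, ← ofReal_norm, Complex.norm_real, Real.norm_of_nonneg h2,
        ← ENNReal.ofReal_pow (by positivity), ← Real.rpow_natCast, ← Real.rpow_natCast,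
        ← Real.rpow_mul (by norm_num), ← Real.rpow_mul (by norm_num), mul_comm (j : ℝ)]
      gcongr
      exact hBM j
    refine ne_top_of_le_ne_top ?_ (ENNReal.tsum_le_tsum h1)
    rw [ENNReal.tsum_mul_right, ENNReal.tsum_geometric]
    refine ENNReal.mul_ne_top (ENNReal.inv_ne_top.2 ?_) ENNReal.coe_ne_top
    rw [← pos_iff_ne_zero, tsub_pos_iff_lt, ← ENNReal.ofReal_one]
    exact (ENNReal.ofReal_lt_ofReal_iff one_pos).2
      (Real.rpow_lt_one_of_one_lt_of_neg (by norm_num) (by linarith))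
  · obtain ⟨J, hJ⟩ : ∃ J : ℕ, 1 / ‖ξ‖ < 2 ^ J := pow_unbounded_of_one_lt _ (by norm_num)
    have hξ0 : 0 < ‖ξ‖ := norm_pos_iff.2 hξ
    have hlarge : ∀ j, J ≤ j → 1 ≤ ‖((2 : ℝ) ^ j) • ξ‖ := fun j hj => by
      rw [norm_smul, Real.norm_of_nonneg (by positivity)]
      rw [div_lt_iff₀ hξ0] at hJ
      refine hJ.le.trans (mul_le_mul_of_nonneg_right ?_ hξ0.le)
      exact pow_le_pow_right₀ (by norm_num) hj
    have h1 : HasSum (fun j : ℕ => ρ (((2 : ℝ) ^ j) • ξ))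
        (∑ j ∈ Finset.range J, ρ (((2 : ℝ) ^ j) • ξ)) :=
      hasSum_sum_of_ne_finset_zero fun j hj => hρ1 _ (hlarge j (by simpa using hj))
    -- The sum telescopes to `χ(ξ) - χ(2^J ξ)`, and the last term vanishes for large `J`.
    have h2 : ∑ j ∈ Finset.range J, ρ (((2 : ℝ) ^ j) • ξ) = χ ξ := by
      have e : ∀ j : ℕ, ρ (((2 : ℝ) ^ j) • ξ) = χ (((2 : ℝ) ^ j) • ξ) -
          χ (((2 : ℝ) ^ (j + 1)) • ξ) := fun j => by
        simp only [hρ]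
        rw [smul_smul, pow_succ']
      simp only [e]
      rw [Finset.sum_range_sub' (fun j => χ (((2 : ℝ) ^ j) • ξ)), hχ' _ (hlarge J le_rfl)]
      simp
    rw [h2] at h1
    have h3 := h1.mul_left (E ((‖ξ‖ ^ α : ℝ) : ℂ) * ((‖ξ‖ ^ β : ℝ) : ℂ))
    have e : (fun j : ℕ => (((((2 : ℝ) ^ j) ^ (-β) : ℝ) : ℂ) • b j) ξ) = fun j : ℕ =>
        E ((‖ξ‖ ^ α : ℝ) : ℂ) * ((‖ξ‖ ^ β : ℝ) : ℂ) * ρ (((2 : ℝ) ^ j) • ξ) :=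
      funext fun j => hval j ξ
    rw [mul_comm (χ ξ), e]
    exact h3

end

/-! ### The symbols `sin |ξ|^α / |ξ|^δ` as perturbations -/

section

open Filter Topology

variable {d : ℕ}

theorem sinSymbol_eq_radialSymbol (α δ : ℝ) (ξ : Eu d) :
    sinSymbol α δ ξ = radialSymbol (fun u => ((Real.sin u : ℝ) : ℂ)) α δ ξ := by
  rw [sinSymbol, radialSymbol, Real.rpow_neg (norm_nonneg ξ), div_eq_mul_inv, Complex.ofReal_mul]

/-- The smooth part is `(1 - χ) σ + c χ`, radial outside the unit ball. What remains, `χ E(|ξ|^α)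
|ξ|^β`, is handled dyadically. -/
theorem exists_isLocalPerturbation_of_eq (hd : 0 < d) {α δ β : ℝ} (hα : 0 < α) (hα1 : α ≤ 1)
    (hβ : 0 < β) {E : ℂ → ℂ} (hE : Differentiable ℂ E) {c : ℂ}
    (h : ∀ ξ : Eu d, ξ ≠ 0 →
      sinSymbol α δ ξ = c + E ((‖ξ‖ ^ α : ℝ) : ℂ) * ((‖ξ‖ ^ β : ℝ) : ℂ)) :
    ∃ (σ₀ : Eu d → ℂ) (b : ℕ → 𝓢(Eu d, ℂ)),
      IsLocalPerturbation δ 1 σ₀ b (sinSymbol α δ) := by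
  obtain ⟨χ, hχ, hχ'⟩ := exists_cutoff (d := d) (R := 1 / 2) (by norm_num)
  rw [show (2 : ℝ) * (1 / 2) = 1 by norm_num] at hχ'
  obtain ⟨b, hb, hsum, hb'⟩ := exists_dyadic_decomposition hE hα hβ hχ hχ'
  refine ⟨fun ξ => (1 - χ ξ) * radialSymbol (fun u => ((Real.sin u : ℝ) : ℂ)) α δ ξ + c * χ ξ, b,
    ?_, hb, hsum, ?_⟩
  · refine hasSymbolBound_of_eq_radialSymbol contDiff_ofReal_sin
      exists_norm_iteratedFDeriv_sin_le hα1 ?_ fun ξ hξ => ?_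
    · exact (contDiff_one_sub_mul (by norm_num : (0 : ℝ) < 1 / 2) (χ.smooth ⊤) hχ fun ξ hξ =>
        contDiffAt_radialSymbol contDiff_ofReal_sin α δ hξ).add
          (contDiff_const.mul (χ.smooth ⊤))
    · rw [hχ' ξ hξ.le]; ring
  · have : NeZero d := ⟨hd.ne'⟩
    filter_upwards [compl_mem_ae_iff.2 (measure_singleton (0 : Eu d))] with ξ hξ
    have h1 := hb' ξ hξ
    have e : χ ξ * (E ((‖ξ‖ ^ α : ℝ) : ℂ) * ((‖ξ‖ ^ β : ℝ) : ℂ)) = sinSymbol α δ ξ -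
        ((1 - χ ξ) * radialSymbol (fun u => ((Real.sin u : ℝ) : ℂ)) α δ ξ + c * χ ξ) := by
      rw [← sinSymbol_eq_radialSymbol, h ξ hξ]; ring
    rwa [e] at h1

/-- The symbol is `sinc(|ξ|^α) |ξ|^{α-δ}`. For `δ < α` the power is already positive. For `δ = α`
there is no decay at the origin, so `sinc(0) = 1` is split off and the difference quotient of `sinc`
supplies the factor `|ξ|^α`. -/
theorem exists_isLocalPerturbation_sinSymbol (hd : 0 < d) {α δ : ℝ} (hα : 0 < α) (hα1 : α ≤ 1)
    (hδ : δ ≤ α) : ∃ (σ₀ : Eu d → ℂ) (b : ℕ → 𝓢(Eu d, ℂ)),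
      IsLocalPerturbation δ 1 σ₀ b (sinSymbol α δ) := by
  have hu : ∀ ξ : Eu d, ξ ≠ 0 → ((‖ξ‖ ^ α : ℝ) : ℂ) ≠ 0 := fun ξ hξ => by
    have : ‖ξ‖ ^ α ≠ 0 := (Real.rpow_pos_of_pos (norm_pos_iff.2 hξ) α).ne'
    exact_mod_cast this
  have hs : ∀ ξ : Eu d, ξ ≠ 0 → sinSymbol α δ ξ =
      entireSinc ((‖ξ‖ ^ α : ℝ) : ℂ) * ((‖ξ‖ ^ (α - δ) : ℝ) : ℂ) := fun ξ hξ => by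
    rw [entireSinc_of_ne (hu ξ hξ), Real.rpow_sub (norm_pos_iff.2 hξ), sinSymbol]
    push_cast
    field_simp [hu ξ hξ]
  rcases hδ.lt_or_eq with h | rfl
  · refine exists_isLocalPerturbation_of_eq hd hα hα1 (sub_pos.2 h) differentiable_entireSinc
      (c := 0) fun ξ hξ => ?_
    rw [hs ξ hξ, zero_add]
  · refine exists_isLocalPerturbation_of_eq hd hα hα1 hα
      (differentiable_dslope differentiable_entireSinc 0) (c := 1) fun ξ hξ => ?_
    rw [hs ξ hξ, dslope_of_ne _ (hu ξ hξ), slope_def_field, entireSinc_zero, sub_zero, sub_self,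
      Real.rpow_zero, div_mul_cancel₀ _ (hu ξ hξ)]
    simp

end

end ModSpace

end

theorem corollary1 (d : ℕ) (hd : 0 < d) (s : ℝ) (q : ℝ≥0∞) (hq : 0 < q) :
    (∀ (p : ℝ≥0∞), 1 ≤ p → ∀ (δ : ℝ) (g φ : 𝓢(ModSpace.Eu d, ℂ)),
      ModSpace.IsWindow p q g → φ ≠ 0 →
      ∃ C : ℝ≥0, ∀ α : ℝ, 0 < α → α ≤ 1 → δ ≤ α →
        ModSpace.wienerNorm 1 ∞ δ φ (ModSpace.sinSymbol α δ) < ∞ ∧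
        ∃ T : 𝓢'(ModSpace.Eu d, ℂ) → 𝓢'(ModSpace.Eu d, ℂ),
          ModSpace.IsBoundedExtension (ModSpace.sinSymbol α δ) p q s (s + δ) g
            (C * ModSpace.wienerNorm 1 ∞ δ φ (ModSpace.sinSymbol α δ)) T) ∧
    (∀ (p : ℝ≥0∞), 0 < p → p < 1 → ∀ (g φ : 𝓢(ModSpace.Eu d, ℂ)),
      ModSpace.IsWindow p q g → φ ≠ 0 →
      ∃ C : ℝ≥0,
        ModSpace.wienerNorm p ∞ 1 φ (ModSpace.sinSymbol 1 1) < ∞ ∧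
        ∃ T : 𝓢'(ModSpace.Eu d, ℂ) → 𝓢'(ModSpace.Eu d, ℂ),
          ModSpace.IsBoundedExtension (ModSpace.sinSymbol 1 1) p q s (s + 1) g
            (C * ModSpace.wienerNorm p ∞ 1 φ (ModSpace.sinSymbol 1 1)) T) ∧
    (∀ (p : ℝ≥0∞), 0 < p → ∀ (g φ : 𝓢(ModSpace.Eu d, ℂ)),
      ModSpace.IsWindow p q g → φ ≠ 0 →
      ∃ C : ℝ≥0,
        ModSpace.wienerNorm (min 1 p) ∞ 0 φ ModSpace.cosSymbol < ∞ ∧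
        ∃ T : 𝓢'(ModSpace.Eu d, ℂ) → 𝓢'(ModSpace.Eu d, ℂ),
          ModSpace.IsBoundedExtension ModSpace.cosSymbol p q s s g
            (C * ModSpace.wienerNorm (min 1 p) ∞ 0 φ ModSpace.cosSymbol) T) := by
  refine ⟨fun p hp δ g φ hg hφ => ?_, fun p hp _ g φ hg hφ => ?_, fun p hp g φ hg hφ => ?_⟩
  · obtain ⟨K, hK⟩ := ModSpace.exists_isBoundedExtension_of_perturbation hp hq s δ hg hφ
    refine ⟨K, fun α hα hα1 hδ => ?_⟩
    obtain ⟨σ₀, b, h⟩ := ModSpace.exists_isLocalPerturbation_sinSymbol hd hα hα1 hδ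
    exact hK 1 _ σ₀ b one_pos h
  · exact ModSpace.hasSymbolBound_entireSinc.exists_isBoundedExtension
      (ModSpace.sinSymbol_one_one_ae hd) ⟨0, by simp [ModSpace.entireSinc_zero]⟩ hp hp.ne' s hg hφ
  · have h := ModSpace.hasSymbolBound_cosSymbol.exists_isBoundedExtension (q := q)
      (r := min 1 p) Filter.EventuallyEq.rfl ⟨0, by simp [ModSpace.cosSymbol]⟩ hp
      (lt_min one_pos hp).ne' s hg hφ
    rwa [add_zero] at h
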